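/- Let $\omega$ be the exponent of square matrix multiplication over a ring, i.e. the infimum of all real $\tau$ such that, for some constant $C$ and every $n\ge 1$, there is a straight-line program with at most $Cn^{\tau}$ instructions (additions, subtractions, multiplications and integer constants) that computes the product of any two $n\times n$ matrices over any ring. A minimum weight cycle in an $n$-node undirected graph with integer edge weights in $[1,M]$ can be found deterministically in $\tilde O(Mn^{\omega})$ time. As usual for an exponent defined as an infimum, this means the following. For every $\varepsilon>0$ there are a deterministic word RAM program $P$ and constants $c,C,k$ such that for all integers $n,M\ge 1$, every simple undirected graph $G$ with vertex set $\{0,\dots,n-1\}$ and every assignment of integer weights in $\{1,\dots,M\}$ to its edges, and for every word length $b\ge c(\lfloor\log_2(nM)\rfloor+1)$, the program $P$, run on words of $b$ bits with input $n$, $M$ and the weighted adjacency matrix of $G$ (with entry $0$ for non-adjacent pairs), halts after at most $$C\, M\, n^{\omega+\varepsilon}\,\bigl(\lfloor\log_2(nM)\rfloor+1\bigr)^{k}$$ steps, each arithmetic operation, comparison and memory access counting as a step, and outputs the successive vertices of a simple cycle of $G$ (on at least three vertices) whose sum of edge weights is minimum among all simple cycles of $G$, or the empty list if $G$ has no cycle.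 -/

import Mathlib

/-! ### The exponent of square matrix multiplication over a ring

Straight-line programs for the product of two `n × n` matrices: every instruction performs one ring
operation, whose operands are entries of the two input matrices or results of earlier instructions. -/

/-- An operand: an entry of the left or of the right input matrix, or the result of instruction
number `k` (counted from `0`). -/
inductive SLOperand (n : ℕ) : Type where
  | left (i j : Fin n) : SLOperand n
  | right (i j : Fin n) : SLOperand n
  | result (k : ℕ) : SLOperand n

/-- An instruction: an integer constant, a sum, a difference or a product. -/
inductive SLInstr (n : ℕ) : Type where
  | const (z : ℤ) : SLInstr n
  | add (x y : SLOperand n) : SLInstr n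
  | sub (x y : SLOperand n) : SLInstr n
  | mul (x y : SLOperand n) : SLInstr n

/-- The value of an operand, where `past` lists the results of the instructions executed so far
(a reference to an instruction that has not been executed yields `0`). -/
def SLOperand.val {n : ℕ} {R : Type} [Ring R] (A B : Matrix (Fin n) (Fin n) R) (past : List R) :
    SLOperand n → R
  | .left i j => A i j
  | .right i j => B i j
  | .result k => past.getD k 0

/-- The value that an instruction computes. -/
def SLInstr.val {n : ℕ} {R : Type} [Ring R] (A B : Matrix (Fin n) (Fin n) R) (past : List R) :
    SLInstr n → R
  | .const z => (z : R)
  | .add x y => x.val A B past + y.val A B past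
  | .sub x y => x.val A B past - y.val A B past
  | .mul x y => x.val A B past * y.val A B past

/-- Execute a straight-line program; the list of all results, in order, is returned. -/
def slRun {n : ℕ} {R : Type} [Ring R] (A B : Matrix (Fin n) (Fin n) R) :
    List (SLInstr n) → List R → List R
  | [], past => past
  | instr :: rest, past => slRun A B rest (past ++ [instr.val A B past])

/-- The straight-line program `p` computes the product of any two `n × n` matrices over any ring:
fixed instructions (or inputs) hold the entries of the product. -/
def ComputesMatrixProduct {n : ℕ} (p : List (SLInstr n)) : Prop :=
  ∃ out : Fin n → Fin n → SLOperand n,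
    ∀ (R : Type) [Ring R] (A B : Matrix (Fin n) (Fin n) R) (i j : Fin n),
      (out i j).val A B (slRun A B p []) = (A * B) i j

/-- The exponent `ω`: the infimum of all real `τ` such that two `n × n` matrices over a ring can be
multiplied with `O(n ^ τ)` ring operations. -/
noncomputable def matMulExponent : ℝ :=
  sInf {τ : ℝ | ∃ C : ℝ, ∀ n : ℕ, 1 ≤ n →
    ∃ p : List (SLInstr n), ComputesMatrixProduct p ∧ (p.length : ℝ) ≤ C * (n : ℝ) ^ τ}

/-! ### The word RAM

A random access machine on words of `b` bits, programmed with assignments, branches and loops.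
A program uses finitely many registers and finitely many arrays with random access. -/

/-- The arithmetic and comparison operations of the machine. -/
inductive WordOp : Type where
  | add | sub | mul | div | mod | lt | eq

/-- The effect of an operation on words of `b` bits: sums and products are reduced modulo `2 ^ b`,
subtraction is truncated at `0`, division is integer division (by zero: quotient `0`),
comparisons return `0` or `1`. -/
def WordOp.apply (b : ℕ) (o : WordOp) (x y : ℕ) : ℕ :=
  match o with
  | .add => (x + y) % 2 ^ b
  | .sub => x - y
  | .mul => (x * y) % 2 ^ b
  | .div => x / y
  | .mod => x % y
  | .lt => (if x < y then 1 else 0) % 2 ^ b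
  | .eq => (if x = y then 1 else 0) % 2 ^ b

/-- Expressions: constants, registers, array cells, operations. -/
inductive WordExpr : Type where
  | const (c : ℕ) : WordExpr
  | reg (x : ℕ) : WordExpr
  | load (a : ℕ) (e : WordExpr) : WordExpr
  | op (o : WordOp) (e₁ e₂ : WordExpr) : WordExpr

/-- Programs: `store a i e` writes the value of `e` into cell `i` of array `a`; the conditions of
`ite` and `loop` (a while loop) hold if their value is nonzero. -/
inductive WordProg : Type where
  | skip : WordProg
  | assign (x : ℕ) (e : WordExpr) : WordProg
  | store (a : ℕ) (i e : WordExpr) : WordProg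
  | seq (p q : WordProg) : WordProg
  | ite (e : WordExpr) (p q : WordProg) : WordProg
  | loop (e : WordExpr) (p : WordProg) : WordProg

/-- The contents of the registers and of the arrays. -/
structure WordState : Type where
  reg : ℕ → ℕ
  arr : ℕ → ℕ → ℕ

/-- The value of an expression on words of `b` bits. -/
def WordExpr.val (b : ℕ) (s : WordState) : WordExpr → ℕ
  | .const c => c % 2 ^ b
  | .reg x => s.reg x
  | .load a e => s.arr a (e.val b s)
  | .op o e₁ e₂ => o.apply b (e₁.val b s) (e₂.val b s)

/-- The number of steps needed to evaluate an expression: one for each constant, register access,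
array access and operation in it. -/
def WordExpr.cost : WordExpr → ℕ
  | .const _ => 1
  | .reg _ => 1
  | .load _ e => e.cost + 1
  | .op _ e₁ e₂ => e₁.cost + e₂.cost + 1

/-- `WordRuns b p s s' t`: on words of `b` bits, the program `p` started in state `s` halts in
state `s'` after exactly `t` steps. -/
inductive WordRuns (b : ℕ) : WordProg → WordState → WordState → ℕ → Prop where
  | skip (s : WordState) : WordRuns b .skip s s 1
  | assign (x : ℕ) (e : WordExpr) (s : WordState) :
      WordRuns b (.assign x e) s
        ⟨Function.update s.reg x (e.val b s), s.arr⟩ (e.cost + 1)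
  | store (a : ℕ) (i e : WordExpr) (s : WordState) :
      WordRuns b (.store a i e) s
        ⟨s.reg, Function.update s.arr a (Function.update (s.arr a) (i.val b s) (e.val b s))⟩
        (i.cost + e.cost + 1)
  | seq {p q : WordProg} {s s' s'' : WordState} {t t' : ℕ} :
      WordRuns b p s s' t → WordRuns b q s' s'' t' → WordRuns b (.seq p q) s s'' (t + t')
  | ite_true {e : WordExpr} {p q : WordProg} {s s' : WordState} {t : ℕ} :
      e.val b s ≠ 0 → WordRuns b p s s' t → WordRuns b (.ite e p q) s s' (e.cost + 1 + t)
  | ite_false {e : WordExpr} {p q : WordProg} {s s' : WordState} {t : ℕ} :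
      e.val b s = 0 → WordRuns b q s s' t → WordRuns b (.ite e p q) s s' (e.cost + 1 + t)
  | loop_done {e : WordExpr} {p : WordProg} {s : WordState} :
      e.val b s = 0 → WordRuns b (.loop e p) s s (e.cost + 1)
  | loop_step {e : WordExpr} {p : WordProg} {s s' s'' : WordState} {t t' : ℕ} :
      e.val b s ≠ 0 → WordRuns b p s s' t → WordRuns b (.loop e p) s' s'' t' →
      WordRuns b (.loop e p) s s'' (e.cost + 1 + t + t')

/-! ### The minimum weight cycle problem in undirected graphs -/

/-- The weight of a walk: the sum of the weights of its edges. -/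
def walkWeight {V : Type} {G : SimpleGraph V} (wt : Sym2 V → ℕ) {u v : V} (c : G.Walk u v) : ℕ :=
  (c.edges.map wt).sum

/-- `c` is a minimum weight cycle. Cycles are simple and have at least three vertices. -/
def IsMinWeightCycle {V : Type} {G : SimpleGraph V} (wt : Sym2 V → ℕ) {v : V}
    (c : G.Walk v v) : Prop :=
  c.IsCycle ∧ ∀ (u : V) (c' : G.Walk u u), c'.IsCycle → walkWeight wt c ≤ walkWeight wt c'

open Classical in
/-- The input: register `0` holds `n`, register `1` holds `M`, and array `0` holds the weighted
adjacency matrix, row by row, with entry `0` for pairs that are not adjacent (edge weights are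
positive). Everything else is `0`. -/
noncomputable def cycleInput {n : ℕ} (G : SimpleGraph (Fin n)) (wt : Sym2 (Fin n) → ℕ) (M : ℕ) :
    WordState where
  reg x := if x = 0 then n else if x = 1 then M else 0
  arr a k :=
    if a = 0 then
      if h : k < n * n then
        let i : Fin n := (⟨k, h⟩ : Fin (n * n)).divNat
        let j : Fin n := (⟨k, h⟩ : Fin (n * n)).modNat
        if G.Adj i j then wt s(i, j) else 0
      else 0
    else 0

/-- The output: the first `ℓ` cells of array `1`, where `ℓ` is the content of register `0`. -/
def cycleOutput (s : WordState) : List ℕ :=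
  (List.range (s.reg 0)).map (s.arr 1)

/-- The output is correct: it lists the successive vertices of a minimum weight cycle, and it is
empty if there is no cycle. -/
def IsCorrectOutput {n : ℕ} (G : SimpleGraph (Fin n)) (wt : Sym2 (Fin n) → ℕ)
    (out : List ℕ) : Prop :=
  (G.IsAcyclic ∧ out = []) ∨
    ∃ (v : Fin n) (c : G.Walk v v), IsMinWeightCycle wt c ∧ out = c.support.dropLast.map Fin.val

/-! ### Exact semantics of word programs

Programs are analysed with exact natural number arithmetic, where every value that is written is
bounded by some `K`. If words are long compared with `K`, such a run is a run of the word RAM. -/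

/-! Labels are distances plus one, with `0` for unreached vertices. Shortest path trees are grown
from all sources at once, with a common radius `r`: an edge `u v` is due for the source `s` when
`lab s u + w u v = r + 1`. Growth stops as soon as a due edge joins two labelled vertices without
being a tree edge; such an edge is a chord. Until then all explored edges are tree edges, so only `2
n²` directed edges are explored (`ExploreInv.sum_ptr_le`). Each pair of a source and a vertex is
passed at most `M + 1` times in the queue (`VisitInv`). Hence this stage costs `O(M n²)`. If it
reaches radius `n M + 1` without a chord, the graph is acyclic (`IsExplored.isAcyclic`).

A chord closes up, through its tree, to a closed walk of weight `lab s u + w u v + lab s v - 2`. For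
the chord that ends the growth this is at most `2 r`. A cycle of weight less than `2 r`, seen from
one of its own vertices, has only vertices with labels at most `r`. It contains an edge outside the
tree, and that edge is a chord that is no heavier than the cycle (`IsExplored.exists_isChord`). So
the minimum weight of a cycle is the least value among the first chord and the chords whose ends
have labels at most `r`. The closed walk of the best chord is simple: otherwise a shortcut in it
would give a lighter cycle (`IsChord.exists_isMinWeightCycle`).

It remains to find the best chord. Its edge is unexplored from both sides, so both labels are at
least `r + 1 - M`, and only `M` labels matter. Take the `n × n` matrix with entries `x ^ (lab s u +
M - (r + 1))`, restricted to these labels, and multiply it by the matrix with entries `x ^ (w u v)`.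
The product counts, for each `s`, `v` and each value of `lab s u + w u v`, the possible `u`. Tree
edges from the parent of `v` have a value of at most `r` and are discarded. Those from children of
`v` are counted separately in `O(n²)` time. A discrepancy between the two counts means that there is
a chord (`card_ne_card_iff`). The best pair `s`, `v` is selected, and its `u` is found by trial
(`fastProg_spec`).

The matrix product has to be carried out by one fixed program. A straight-line program of length `R`
for `a × a` matrices, evaluated on suitable triangular `3 × 3` matrices, yields a bilinear scheme
with `R` products (`ComputesMatrixProduct.exists_isScheme`). For a large constant `a` its rank is at
most `a ^ (τ + δ)`. Likewise, interpolation multiplies polynomials of length `d` with `2 d - 1 ≤ d ^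
(1 + δ)` products. Kronecker powers of these two constant schemes, with `n ≤ a ^ k` and `M < d ^ l`,
are applied one digit at a time (`transformProg_spec`, `bilinearProg_spec`). The total rank is `O(M
n ^ (τ + 2 δ))` if `M ≤ n` (`tensor_rank_le`). If `M ≥ n`, testing all `n³` triples costs at most `M
n²`. Interpolation without division scales the counts by `D ^ l`; as counts are at most `n`, working
modulo `(n + 1) D ^ l` loses nothing. -/

instance : Add WordExpr := ⟨.op .add⟩
instance : Sub WordExpr := ⟨.op .sub⟩
instance : Mul WordExpr := ⟨.op .mul⟩
instance : Div WordExpr := ⟨.op .div⟩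
instance : Mod WordExpr := ⟨.op .mod⟩

/-- The expression that is `1` if the first value is smaller and `0` otherwise. -/
def WordExpr.lt (e f : WordExpr) : WordExpr := .op .lt e f

/-- The expression that is `1` if the values are equal and `0` otherwise. -/
def WordExpr.eq (e f : WordExpr) : WordExpr := .op .eq e f

/-- The expression that is `1` if the values differ and `0` otherwise. -/
def WordExpr.ne (e f : WordExpr) : WordExpr := .eq (.eq e f) (.const 0)

/-- The exact result of an operation. -/
def WordOp.eval (o : WordOp) (x y : ℕ) : ℕ :=
  match o with
  | .add => x + y
  | .sub => x - y
  | .mul => x * y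
  | .div => x / y
  | .mod => x % y
  | .lt => if x < y then 1 else 0
  | .eq => if x = y then 1 else 0

/-- The exact value of an expression. -/
def WordExpr.eval (s : WordState) : WordExpr → ℕ
  | .const c => c
  | .reg x => s.reg x
  | .load a e => s.arr a (e.eval s)
  | .op o e f => o.eval (e.eval s) (f.eval s)

/-- An exponent `k` such that all intermediate values are at most `K ^ k`, if the state is bounded
by `K`. -/
def WordExpr.size : WordExpr → ℕ
  | .const c => c + 1
  | .reg _ => 1
  | .load _ e => e.size
  | .op _ e f => e.size + f.size

/-- The total size of the expressions of a program. -/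
def WordProg.size : WordProg → ℕ
  | .skip => 0
  | .assign _ e => e.size
  | .store _ i e => i.size + e.size
  | .seq p q => p.size + q.size
  | .ite e p q => e.size + p.size + q.size
  | .loop e p => e.size + p.size

namespace WordState

/-- Overwrite a register. -/
def setReg (s : WordState) (x v : ℕ) : WordState := ⟨Function.update s.reg x v, s.arr⟩

/-- Overwrite an array cell. -/
def setArr (s : WordState) (a i v : ℕ) : WordState :=
  ⟨s.reg, Function.update s.arr a (Function.update (s.arr a) i v)⟩

@[simp] theorem setReg_arr (s : WordState) (x v : ℕ) : (s.setReg x v).arr = s.arr := rfl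
@[simp] theorem setArr_reg (s : WordState) (a i v : ℕ) : (s.setArr a i v).reg = s.reg := rfl

@[simp] theorem setReg_reg (s : WordState) (x v y : ℕ) :
    (s.setReg x v).reg y = if y = x then v else s.reg y := by
  simp [setReg, Function.update_apply]

theorem setArr_arr (s : WordState) (a i v a' j : ℕ) :
    (s.setArr a i v).arr a' j = if a' = a ∧ j = i then v else s.arr a' j := by
  by_cases h : a' = a
  · subst h
    simp [setArr, Function.update_apply]
  · simp [setArr, h]

@[simp] theorem setArr_arr_self (s : WordState) (a i v : ℕ) :
    (s.setArr a i v).arr a = Function.update (s.arr a) i v := by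
  simp [setArr]

@[simp] theorem setArr_arr_ne (s : WordState) (a i v a' : ℕ) (h : a' ≠ a) :
    (s.setArr a i v).arr a' = s.arr a' := by
  simp [setArr, h]

/-- All registers and array cells are at most `K`. -/
def Bounded (K : ℕ) (s : WordState) : Prop := (∀ x, s.reg x ≤ K) ∧ ∀ a i, s.arr a i ≤ K

theorem Bounded.setReg {K : ℕ} {s : WordState} (h : s.Bounded K) {x v : ℕ} (hv : v ≤ K) :
    (s.setReg x v).Bounded K :=
  ⟨fun y => by rw [setReg_reg]; split_ifs; exacts [hv, h.1 y], h.2⟩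

theorem Bounded.setArr {K : ℕ} {s : WordState} (h : s.Bounded K) {a i v : ℕ} (hv : v ≤ K) :
    (s.setArr a i v).Bounded K :=
  ⟨h.1, fun b j => by rw [setArr_arr]; split_ifs; exacts [hv, h.2 b j]⟩

end WordState

/-! ### Exact evaluation against evaluation modulo a power of two -/

namespace WordExpr

variable (s : WordState) (e f : WordExpr)

@[simp] theorem eval_const (c : ℕ) : (const c).eval s = c := rfl
@[simp] theorem eval_reg (x : ℕ) : (reg x).eval s = s.reg x := rfl
@[simp] theorem eval_load (a : ℕ) : (load a e).eval s = s.arr a (e.eval s) := rfl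
@[simp] theorem eval_add : (e + f).eval s = e.eval s + f.eval s := rfl
@[simp] theorem eval_sub : (e - f).eval s = e.eval s - f.eval s := rfl
@[simp] theorem eval_mul : (e * f).eval s = e.eval s * f.eval s := rfl
@[simp] theorem eval_div : (e / f).eval s = e.eval s / f.eval s := rfl
@[simp] theorem eval_mod : (e % f).eval s = e.eval s % f.eval s := rfl
@[simp] theorem eval_lt_eq_zero : (e.lt f).eval s = 0 ↔ f.eval s ≤ e.eval s := by
  simp [lt, eval, WordOp.eval]

@[simp] theorem eval_eq_eq_zero : (e.eq f).eval s = 0 ↔ e.eval s ≠ f.eval s := by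
  simp [eq, eval, WordOp.eval]

@[simp] theorem eval_ne_eq_zero : (e.ne f).eval s = 0 ↔ e.eval s = f.eval s := by
  simp only [ne, eval_eq_eq_zero, eval_const]
  simp

theorem size_pos : 0 < e.size := by
  induction e with
  | const c => simp [size]
  | reg x => simp [size]
  | load a e ih => simpa [size] using ih
  | op o e f ih₁ ih₂ => simp only [size]; omega

variable {s} {K : ℕ}

/-- Every operation yields at most the product of the bounds for its operands, and sizes add up
accordingly; a constant `c` is charged the exponent `c + 1` because `c ≤ 2 ^ (c + 1)`. -/
theorem eval_le (hK : 2 ≤ K) (hs : s.Bounded K) : e.eval s ≤ K ^ e.size := by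
  induction e with
  | const c =>
    calc c ≤ 2 ^ (c + 1) := (Nat.lt_two_pow_self.le).trans (Nat.pow_le_pow_right (by norm_num) (by omega))
      _ ≤ _ := Nat.pow_le_pow_left hK _
  | reg x => simpa [size] using hs.1 x
  | load a e ih =>
    exact (hs.2 _ _).trans (Nat.le_self_pow (size_pos e).ne' K)
  | op o e f ih₁ ih₂ =>
    have h₁ : K ≤ K ^ e.size := Nat.le_self_pow (size_pos e).ne' K
    have h₂ : K ≤ K ^ f.size := Nat.le_self_pow (size_pos f).ne' K
    have h₃ : K ^ (e.size + f.size) = K ^ e.size * K ^ f.size := pow_add ..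
    have h₄ : K ^ e.size ≤ K ^ e.size * K ^ f.size := Nat.le_mul_of_pos_right _ (by omega)
    -- A sum of two numbers that are at least `2` does not exceed their product.
    have h₅ : K ^ e.size + K ^ f.size ≤ K ^ e.size * K ^ f.size := by nlinarith
    simp only [eval, size, h₃]
    cases o <;> simp only [WordOp.eval]
    · omega
    · omega
    · exact Nat.mul_le_mul ih₁ ih₂
    · exact (Nat.div_le_self _ _).trans (by omega)
    · exact (Nat.mod_le _ _).trans (by omega)
    · split_ifs <;> omega
    · split_ifs <;> omega

theorem val_eq_eval {b : ℕ} (hK : 2 ≤ K) (hs : s.Bounded K) (h : K ^ e.size < 2 ^ b) :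
    e.val b s = e.eval s := by
  induction e with
  | const c => exact Nat.mod_eq_of_lt ((eval_le (.const c) hK hs).trans_lt h)
  | reg x => rfl
  | load a e ih => simp only [val, eval, ih h]
  | op o e f ih₁ ih₂ =>
    have h₁ := ih₁ ((Nat.pow_le_pow_right (by omega) (by simp [size])).trans_lt h)
    have h₂ := ih₂ ((Nat.pow_le_pow_right (by omega) (by simp [size])).trans_lt h)
    have h₃ := (eval_le (.op o e f) hK hs).trans_lt h
    simp only [eval, val, h₁, h₂] at h₃ ⊢
    cases o <;> simp only [WordOp.apply, WordOp.eval] at h₃ ⊢ <;> exact Nat.mod_eq_of_lt h₃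

end WordExpr

/-- Runs with exact arithmetic in which all values written are at most `K`. -/
inductive ExactRuns (K : ℕ) : WordProg → WordState → WordState → ℕ → Prop where
  | skip (s : WordState) : ExactRuns K .skip s s 1
  | assign (x : ℕ) (e : WordExpr) (s : WordState) (h : e.eval s ≤ K) :
      ExactRuns K (.assign x e) s (s.setReg x (e.eval s)) (e.cost + 1)
  | store (a : ℕ) (i e : WordExpr) (s : WordState) (h : e.eval s ≤ K) :
      ExactRuns K (.store a i e) s (s.setArr a (i.eval s) (e.eval s)) (i.cost + e.cost + 1)
  | seq {p q : WordProg} {s s' s'' : WordState} {t t' : ℕ} :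
      ExactRuns K p s s' t → ExactRuns K q s' s'' t' → ExactRuns K (.seq p q) s s'' (t + t')
  | ite_true {e : WordExpr} {p q : WordProg} {s s' : WordState} {t : ℕ} :
      e.eval s ≠ 0 → ExactRuns K p s s' t → ExactRuns K (.ite e p q) s s' (e.cost + 1 + t)
  | ite_false {e : WordExpr} {p q : WordProg} {s s' : WordState} {t : ℕ} :
      e.eval s = 0 → ExactRuns K q s s' t → ExactRuns K (.ite e p q) s s' (e.cost + 1 + t)
  | loop_done {e : WordExpr} {p : WordProg} {s : WordState} :
      e.eval s = 0 → ExactRuns K (.loop e p) s s (e.cost + 1)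
  | loop_step {e : WordExpr} {p : WordProg} {s s' s'' : WordState} {t t' : ℕ} :
      e.eval s ≠ 0 → ExactRuns K p s s' t → ExactRuns K (.loop e p) s' s'' t' →
      ExactRuns K (.loop e p) s s'' (e.cost + 1 + t + t')

/-- All written values stay at most `K`, so the bound for a single expression never compounds along
the run: one power of `K` below `2 ^ b` makes every reduction modulo `2 ^ b` vacuous, for addresses
and intermediate values too. -/
theorem ExactRuns.wordRuns {K b : ℕ} {P : WordProg} {s s' : WordState} {t : ℕ}
    (h : ExactRuns K P s s' t) (hK : 2 ≤ K) (hs : s.Bounded K) (hb : K ^ P.size < 2 ^ b) :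
    WordRuns b P s s' t ∧ s'.Bounded K := by
  have aux : ∀ {k l : ℕ}, K ^ k < 2 ^ b → l ≤ k → K ^ l < 2 ^ b := fun hk hl =>
    (Nat.pow_le_pow_right (by omega) hl).trans_lt hk
  induction h with
  | skip s => exact ⟨.skip s, hs⟩
  | assign x e s h =>
    refine ⟨?_, hs.setReg h⟩
    have := WordRuns.assign (b := b) x e s
    rwa [e.val_eq_eval hK hs hb] at this
  | store a i e s h =>
    refine ⟨?_, hs.setArr h⟩
    have := WordRuns.store (b := b) a i e s
    rwa [e.val_eq_eval hK hs (aux hb (by simp [WordProg.size])),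
      i.val_eq_eval hK hs (aux hb (by simp [WordProg.size]))] at this
  | seq _ _ ih₁ ih₂ =>
    obtain ⟨r₁, b₁⟩ := ih₁ hs (aux hb (by simp [WordProg.size]))
    obtain ⟨r₂, b₂⟩ := ih₂ b₁ (aux hb (by simp [WordProg.size]))
    exact ⟨.seq r₁ r₂, b₂⟩
  | @ite_true e _ _ _ _ _ he _ ih =>
    obtain ⟨r, b'⟩ := ih hs (aux hb (by simp [WordProg.size]; omega))
    exact ⟨.ite_true (by rwa [e.val_eq_eval hK hs (aux hb (by simp [WordProg.size]; omega))]) r, b'⟩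
  | @ite_false e _ _ _ _ _ he _ ih =>
    obtain ⟨r, b'⟩ := ih hs (aux hb (by simp [WordProg.size]))
    exact ⟨.ite_false (by rwa [e.val_eq_eval hK hs (aux hb (by simp [WordProg.size]; omega))]) r, b'⟩
  | @loop_done e _ _ he =>
    exact ⟨.loop_done (by rwa [e.val_eq_eval hK hs (aux hb (by simp [WordProg.size]))]), hs⟩
  | @loop_step e _ _ _ _ _ _ he _ _ ih₁ ih₂ =>
    obtain ⟨r₁, b₁⟩ := ih₁ hs (aux hb (by simp [WordProg.size]))
    obtain ⟨r₂, b₂⟩ := ih₂ b₁ hb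
    exact ⟨.loop_step (by rwa [e.val_eq_eval hK hs (aux hb (by simp [WordProg.size]))]) r₁ r₂, b₂⟩

/-! ### Frames and weakest preconditions -/

namespace WordProg

/-- Whether a program contains an assignment to a register. -/
def setsReg (x : ℕ) : WordProg → Bool
  | .skip => false
  | .assign y _ => x == y
  | .store _ _ _ => false
  | .seq p q => p.setsReg x || q.setsReg x
  | .ite _ p q => p.setsReg x || q.setsReg x
  | .loop _ p => p.setsReg x

/-- Whether a program contains a store to an array. -/
def setsArr (a : ℕ) : WordProg → Bool
  | .skip => false
  | .assign _ _ => false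
  | .store a' _ _ => a == a'
  | .seq p q => p.setsArr a || q.setsArr a
  | .ite _ p q => p.setsArr a || q.setsArr a
  | .loop _ p => p.setsArr a

/-- `s'` agrees with `s` on all registers and arrays that the program does not write to. -/
def Frame (p : WordProg) (s s' : WordState) : Prop :=
  (∀ x, p.setsReg x = false → s'.reg x = s.reg x) ∧ ∀ a, p.setsArr a = false → s'.arr a = s.arr a

theorem Frame.refl (p : WordProg) (s : WordState) : p.Frame s s := ⟨fun _ _ => rfl, fun _ _ => rfl⟩

theorem Frame.trans {p : WordProg} {s s' s'' : WordState} (h : p.Frame s s') (h' : p.Frame s' s'') :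
    p.Frame s s'' :=
  ⟨fun x hx => (h'.1 x hx).trans (h.1 x hx), fun a ha => (h'.2 a ha).trans (h.2 a ha)⟩

theorem Frame.mono {p q : WordProg} {s s' : WordState} (h : p.Frame s s')
    (hr : ∀ x, q.setsReg x = false → p.setsReg x = false)
    (ha : ∀ a, q.setsArr a = false → p.setsArr a = false) : q.Frame s s' :=
  ⟨fun x hx => h.1 x (hr x hx), fun a h' => h.2 a (ha a h')⟩

/-- A bound for the running time of a program without loops. -/
def cost : WordProg → ℕ
  | .skip => 1
  | .assign _ e => e.cost + 1
  | .store _ i e => i.cost + e.cost + 1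
  | .seq p q => p.cost + q.cost
  | .ite e p q => e.cost + 1 + (p.cost + q.cost)
  | .loop _ _ => 0

/-- The weakest precondition of a program without loops. -/
def wp (K : ℕ) : WordProg → (WordState → Prop) → WordState → Prop
  | .skip, Q, s => Q s
  | .assign x e, Q, s => e.eval s ≤ K ∧ Q (s.setReg x (e.eval s))
  | .store a i e, Q, s => e.eval s ≤ K ∧ Q (s.setArr a (i.eval s) (e.eval s))
  | .seq p q, Q, s => p.wp K (q.wp K Q) s
  | .ite e p q, Q, s => (e.eval s ≠ 0 → p.wp K Q s) ∧ (e.eval s = 0 → q.wp K Q s)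
  | .loop _ _, _, _ => False

end WordProg

/-- This transports everything that a program leaves alone: for a concrete program and a concrete
register or array, the side condition is settled by computation. -/
theorem ExactRuns.frame {K : ℕ} {P : WordProg} {s s' : WordState} {t : ℕ}
    (h : ExactRuns K P s s' t) : P.Frame s s' := by
  induction h with
  | skip s => exact .refl _ _
  | assign x e s h => exact ⟨fun y hy => by simp_all [WordProg.setsReg], fun a _ => rfl⟩
  | store a i e s h =>
    refine ⟨fun y hy => rfl, fun b hb => s.setArr_arr_ne _ _ _ _ (by simpa [WordProg.setsArr] using hb)⟩
  | seq _ _ ih₁ ih₂ =>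
    exact (ih₁.mono (by simp_all [WordProg.setsReg]) (by simp_all [WordProg.setsArr])).trans
      (ih₂.mono (by simp_all [WordProg.setsReg]) (by simp_all [WordProg.setsArr]))
  | ite_true _ _ ih => exact ih.mono (by simp_all [WordProg.setsReg]) (by simp_all [WordProg.setsArr])
  | ite_false _ _ ih => exact ih.mono (by simp_all [WordProg.setsReg]) (by simp_all [WordProg.setsArr])
  | loop_done _ => exact .refl _ _
  | loop_step _ _ _ ih₁ ih₂ =>
    exact (ih₁.mono (by simp_all [WordProg.setsReg]) (by simp_all [WordProg.setsArr])).trans ih₂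

/-- The program, started in `s`, halts after at most `T` steps in a state that satisfies `Q`. -/
def Ensures (K : ℕ) (P : WordProg) (s : WordState) (T : ℕ) (Q : WordState → Prop) : Prop :=
  ∃ s' t, ExactRuns K P s s' t ∧ t ≤ T ∧ Q s'

/-! ### Total correctness with time bounds -/

namespace Ensures

variable {K : ℕ} {P p q : WordProg} {e : WordExpr} {s : WordState} {T T' : ℕ}
  {Q Q' : WordState → Prop}

theorem mono (h : Ensures K P s T Q) (hT : T ≤ T') (hQ : ∀ s', P.Frame s s' → Q s' → Q' s') :
    Ensures K P s T' Q' := by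
  obtain ⟨s', t, hr, ht, hq⟩ := h
  exact ⟨s', t, hr, ht.trans hT, hQ s' hr.frame hq⟩

theorem seq (h : Ensures K p s T (fun s' => Ensures K q s' T' Q)) :
    Ensures K (.seq p q) s (T + T') Q := by
  obtain ⟨s', t, hr, ht, s'', t', hr', ht', hq⟩ := h
  exact ⟨s'', t + t', hr.seq hr', Nat.add_le_add ht ht', hq⟩

theorem seq_of {T₁ T₂ : ℕ} {R : WordState → Prop} (hp : Ensures K p s T₁ R)
    (hq : ∀ s', p.Frame s s' → R s' → Ensures K q s' T₂ Q) (hT : T₁ + T₂ ≤ T) :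
    Ensures K (.seq p q) s T Q :=
  (seq (hp.mono le_rfl hq)).mono hT fun _ _ h => h

theorem ite (h₁ : e.eval s ≠ 0 → Ensures K p s T Q) (h₂ : e.eval s = 0 → Ensures K q s T Q) :
    Ensures K (.ite e p q) s (e.cost + 1 + T) Q := by
  by_cases h : e.eval s = 0
  · obtain ⟨s', t, hr, ht, hq⟩ := h₂ h
    exact ⟨s', _, .ite_false h hr, by omega, hq⟩
  · obtain ⟨s', t, hr, ht, hq⟩ := h₁ h
    exact ⟨s', _, .ite_true h hr, by omega, hq⟩

theorem of_wp : ∀ {P : WordProg} {Q : WordState → Prop} {s : WordState},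
    P.wp K Q s → Ensures K P s P.cost Q
  | .skip, _, s, h => ⟨s, 1, .skip s, le_rfl, h⟩
  | .assign x e, _, s, h => ⟨_, _, .assign x e s h.1, le_rfl, h.2⟩
  | .store a i e, _, s, h => ⟨_, _, .store a i e s h.1, le_rfl, h.2⟩
  | .seq p q, _, s, h => by
    refine seq ((of_wp (P := p) h).mono le_rfl fun s' _ h' => of_wp h')
  | .ite e p q, _, s, h => by
    refine ite (fun he => ?_) (fun he => ?_)
    · exact (of_wp (h.1 he)).mono (by omega) fun _ _ h => h
    · exact (of_wp (h.2 he)).mono (by omega) fun _ _ h => h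

/-- The index `m` of the invariant is a variant. It may drop by any positive amount, so each round
is charged to one unit of the initial value. -/
theorem loop (I : ℕ → WordState → Prop) {m : ℕ} (h₀ : I m s)
    (step : ∀ m s', p.Frame s s' → I m s' → e.eval s' ≠ 0 →
      ∃ m' < m, Ensures K p s' T (I m')) :
    Ensures K (.loop e p) s (m * (e.cost + 1 + T) + (e.cost + 1))
      (fun s' => e.eval s' = 0 ∧ ∃ m, I m s') := by
  suffices H : ∀ m s', p.Frame s s' → I m s' →
      Ensures K (.loop e p) s' (m * (e.cost + 1 + T) + (e.cost + 1))
        (fun s' => e.eval s' = 0 ∧ ∃ m, I m s') from H m s (.refl _ _) h₀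
  intro m
  induction m using Nat.strong_induction_on with
  | _ m ih =>
    intro s' hf hI
    by_cases he : e.eval s' = 0
    · exact ⟨s', _, .loop_done he, by omega, he, m, hI⟩
    · obtain ⟨m', hm', s₁, t₁, hr₁, ht₁, hI₁⟩ := step m s' hf hI he
      obtain ⟨s₂, t₂, hr₂, ht₂, hQ⟩ := ih m' hm' s₁ (hf.trans hr₁.frame) hI₁
      refine ⟨s₂, _, .loop_step he hr₁ hr₂, ?_, hQ⟩
      have : (m' + 1) * (e.cost + 1 + T) ≤ m * (e.cost + 1 + T) := Nat.mul_le_mul_right _ hm'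
      linarith

theorem loop_count (I : ℕ → WordState → Prop) (N : ℕ) (h₀ : I 0 s)
    (he : ∀ j s', p.Frame s s' → I j s' → (e.eval s' ≠ 0 ↔ j < N))
    (step : ∀ j s', j < N → p.Frame s s' → I j s' → Ensures K p s' T (I (j + 1))) :
    Ensures K (.loop e p) s (N * (e.cost + 1 + T) + (e.cost + 1)) (I N) := by
  have := loop (K := K) (p := p) (e := e) (s := s) (T := T)
    (fun m s' => ∃ j, j + m = N ∧ p.Frame s s' ∧ I j s') (m := N) ⟨0, by simp, .refl _ _, h₀⟩ ?_
  · refine this.mono le_rfl ?_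
    rintro s' - ⟨h, m, j, hj, hf, hI⟩
    have := (he j s' hf hI).not.1 (by simp [h])
    obtain rfl : j = N := by omega
    exact hI
  · rintro m s' hf ⟨j, hj, -, hI⟩ h
    have hlt := (he j s' hf hI).1 h
    refine ⟨m - 1, by omega, (step j s' hlt hf hI).mono le_rfl fun s'' hf' hI' => ?_⟩
    exact ⟨j + 1, by omega, hf.trans hf', hI'⟩

end Ensures

/-- `for i in [0, bound) do body`. -/
def WordProg.forLoop (i : ℕ) (bound : WordExpr) (body : WordProg) : WordProg :=
  .seq (.assign i (.const 0))
    (.loop (.lt (.reg i) bound) (.seq body (.assign i (.reg i + .const 1))))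

/-- The counter is incremented after the body, and the invariant may mention it; therefore the body
has to establish `I (j + 1)` for the state in which the counter already equals `j + 1`. -/
theorem Ensures.forLoop {K i N T : ℕ} {bound : WordExpr} {body : WordProg} {s : WordState}
    (I : ℕ → WordState → Prop) (hK : N ≤ K) (hi : body.setsReg i = false)
    (hb : ∀ s', (WordProg.forLoop i bound body).Frame s s' → bound.eval s' = N)
    (h₀ : I 0 (s.setReg i 0))
    (step : ∀ j s', j < N → (WordProg.forLoop i bound body).Frame s s' → s'.reg i = j → I j s' →
      Ensures K body s' T (fun s'' => I (j + 1) (s''.setReg i (j + 1)))) :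
    Ensures K (.forLoop i bound body) s ((bound.cost + T + 12) * (N + 1)) (I N) := by
  have fr : ∀ s', (WordProg.seq body (.assign i (.reg i + .const 1))).Frame (s.setReg i 0) s' →
      (WordProg.forLoop i bound body).Frame s s' := by
    intro s' h
    refine ⟨fun x hx => ?_, fun a ha => ?_⟩
    · simp only [WordProg.forLoop, WordProg.setsReg, Bool.or_eq_false_iff, beq_eq_false_iff_ne] at hx
      rw [h.1 x (by simp [WordProg.setsReg, hx])]
      simp [hx.1]
    · simp only [WordProg.forLoop, WordProg.setsArr, Bool.or_false, Bool.false_or] at ha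
      rw [h.2 a (by simp [WordProg.setsArr, ha])]
      simp
  refine Ensures.seq_of (T₁ := 2) (T₂ := N * (bound.cost + 3 + (T + 4)) + (bound.cost + 3))
    (R := fun s' => s' = s.setReg i 0) ⟨_, _, .assign i _ s (Nat.zero_le _), le_rfl, rfl⟩ ?_
    (by nlinarith)
  rintro _ - rfl
  refine (Ensures.loop_count (fun j s' => s'.reg i = j ∧ I j s') N ⟨by simp, h₀⟩ ?_ ?_
    (T := T + 4)).mono ?_ fun s' _ h => h.2
  · rintro j s' hf ⟨hj, -⟩
    simp [hb s' (fr s' hf), hj]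
  · rintro j s' hlt hf ⟨hj, hI⟩
    refine Ensures.seq ((step j s' hlt (fr s' hf) hj hI).mono le_rfl fun s'' hf' hI' => ?_)
    have e : s''.reg i = j := (hf'.1 i hi).trans hj
    refine ⟨_, _, .assign i _ s'' (by simp [e]; omega), le_rfl, ?_⟩
    simp [e, hI']
  · simp [WordExpr.lt, WordExpr.cost]
    ring_nf
    omega

/-! ### Shortest path forests and minimum weight cycles

`w i j` is the weight of the edge between `i` and `j`, or `0` if there is none. For every source `s`
a tree of shortest paths has been explored: `lab s v` is the distance plus one, or `0` if `v` has not
been reached, `par s v` is the parent and `dep s v` the depth of `v`. -/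

/-- The data describe, for every source, a tree in which every vertex is labelled by its depth and
by one plus its weighted distance from the source. -/
structure IsForest (n : ℕ) (w lab par dep : ℕ → ℕ → ℕ) : Prop where
  lab_self : ∀ s < n, lab s s = 1
  par_self : ∀ s < n, par s s = s
  dep_self : ∀ s < n, dep s s = 0
  step : ∀ s < n, ∀ v < n, lab s v ≠ 0 → v ≠ s →
    par s v < n ∧ lab s (par s v) ≠ 0 ∧ w (par s v) v ≠ 0 ∧
      lab s v = lab s (par s v) + w (par s v) v ∧ dep s v = dep s (par s v) + 1

/-- One end is the parent of the other. -/
def IsTreeEdge (par : ℕ → ℕ → ℕ) (s u v : ℕ) : Prop := par s u = v ∨ par s v = u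

/-- All edges of length less than `r` from the source have been explored, and belong to the tree. -/
def IsExplored (n : ℕ) (w lab par : ℕ → ℕ → ℕ) (r : ℕ) : Prop :=
  ∀ s < n, ∀ u < n, ∀ v < n, lab s u ≠ 0 → w u v ≠ 0 → lab s u + w u v ≤ r →
    lab s v ≠ 0 ∧ lab s v ≤ lab s u + w u v ∧ IsTreeEdge par s u v

/-- An edge `u v` outside the tree of `s`, whose ends belong to the tree. -/
structure IsChord (n : ℕ) (w lab par : ℕ → ℕ → ℕ) (s u v : ℕ) : Prop where
  source_lt : s < n
  left_lt : u < n
  right_lt : v < n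
  left_lab : lab s u ≠ 0
  right_lab : lab s v ≠ 0
  weight : w u v ≠ 0
  not_tree : ¬ IsTreeEdge par s u v

/-! ### Weights of walks -/

theorem walkWeight_cons {V : Type} {G : SimpleGraph V} (wt : Sym2 V → ℕ) {u v x : V}
    (h : G.Adj u v) (p : G.Walk v x) :
    walkWeight wt (.cons h p) = wt s(u, v) + walkWeight wt p := by
  simp [walkWeight]

theorem walkWeight_append {V : Type} {G : SimpleGraph V} (wt : Sym2 V → ℕ) {u v x : V}
    (p : G.Walk u v) (q : G.Walk v x) :
    walkWeight wt (p.append q) = walkWeight wt p + walkWeight wt q := by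
  simp [walkWeight]

theorem walkWeight_reverse {V : Type} {G : SimpleGraph V} (wt : Sym2 V → ℕ) {u v : V}
    (p : G.Walk u v) : walkWeight wt p.reverse = walkWeight wt p := by
  simp [walkWeight]

/-- Cutting out a detour drops edges of positive weight. If bypassing loses no weight, it drops no
edge, and the walk was a path already. -/
theorem isPath_of_walkWeight_le {V : Type} [DecidableEq V] {G : SimpleGraph V} {wt : Sym2 V → ℕ}
    (hwt : ∀ e ∈ G.edgeSet, 1 ≤ wt e) {u v : V} (p : G.Walk u v)
    (h : walkWeight wt p ≤ walkWeight wt p.bypass) : p.IsPath := by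
  -- Every entry that is missing in the sublist costs at least one unit of weight.
  have key : ∀ l₁ l₂ : List (Sym2 V), l₁.Sublist l₂ → (∀ e ∈ l₂, 1 ≤ wt e) →
      (l₁.map wt).sum + l₂.length ≤ (l₂.map wt).sum + l₁.length := by
    intro l₁ l₂ hl
    induction hl with
    | slnil => simp
    | cons a _ ih =>
      intro h'
      have h₁ := ih fun e he => h' e (List.mem_cons_of_mem _ he)
      have h₂ := h' a List.mem_cons_self
      simp only [List.map_cons, List.sum_cons, List.length_cons]
      omega
    | cons_cons a _ ih =>
      intro h'
      have h₁ := ih fun e he => h' e (List.mem_cons_of_mem _ he)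
      simp only [List.map_cons, List.sum_cons, List.length_cons]
      omega
  have h₁ := key _ _ p.edges_bypass_sublist_edges fun e he => hwt e (p.edges_subset_edgeSet he)
  simp only [walkWeight] at h
  rw [SimpleGraph.Walk.length_edges, SimpleGraph.Walk.length_edges] at h₁
  rw [← p.bypass_eq_self_of_length_le_length_bypass (by omega)]
  exact p.bypass_isPath

theorem walkWeight_split {V : Type} {G : SimpleGraph V} (wt : Sym2 V → ℕ) {s t : V}
    (p : G.Walk s t) {e : Sym2 V} (he : e ∈ p.edges) :
    ∃ (u v : V) (p₁ : G.Walk s u) (p₂ : G.Walk v t), e = s(u, v) ∧ G.Adj u v ∧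
      walkWeight wt p = walkWeight wt p₁ + wt s(u, v) + walkWeight wt p₂ := by
  induction p with
  | nil => simp at he
  | @cons a b c h p ih =>
    rw [SimpleGraph.Walk.edges_cons, List.mem_cons] at he
    rcases he with rfl | he
    · exact ⟨a, b, .nil, p, rfl, h, by simp [walkWeight]⟩
    · obtain ⟨u, v, p₁, p₂, rfl, hadj, hw⟩ := ih he
      exact ⟨u, v, .cons h p₁, p₂, rfl, hadj, by rw [walkWeight_cons, walkWeight_cons, hw]; ring⟩

section Forest

variable {n : ℕ} {w lab par dep : ℕ → ℕ → ℕ} {G : SimpleGraph (Fin n)} {wt : Sym2 (Fin n) → ℕ}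

/-- The path from `u` to the root `s` of the tree. -/
theorem IsForest.exists_walk (hF : IsForest n w lab par dep)
    (hadj : ∀ i j : Fin n, w i j ≠ 0 → G.Adj i j ∧ wt s(i, j) = w i j) (s : Fin n) :
    ∀ (k : ℕ) (u : Fin n), lab s u ≤ k → lab s u ≠ 0 → ∃ p : G.Walk u s,
      p.support.map Fin.val = (List.range (dep s u + 1)).map (fun i => (par s)^[i] u) ∧
      walkWeight wt p + 1 = lab s u ∧
      ∀ e ∈ p.edges, ∃ a b : Fin n, e = s(a, b) ∧ IsTreeEdge par s a b := by
  intro k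
  induction k with
  | zero => intro u h h'; omega
  | succ k ih =>
    intro u hk hu
    by_cases hus : u = s
    · subst hus
      exact ⟨.nil, by simp [hF.dep_self u u.2], by simp [walkWeight, hF.lab_self u u.2], by simp⟩
    · obtain ⟨h₁, h₂, h₃, h₄, h₅⟩ := hF.step s s.2 u u.2 hu (fun h => hus (Fin.ext h))
      obtain ⟨hA, hW⟩ := hadj ⟨par s u, h₁⟩ u h₃
      obtain ⟨p, hp₁, hp₂, hp₃⟩ := ih ⟨par s u, h₁⟩ (by simp only; omega) h₂
      refine ⟨.cons hA.symm p, ?_, ?_, ?_⟩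
      · rw [SimpleGraph.Walk.support_cons, List.map_cons, hp₁, h₅, List.range_succ_eq_map (n := dep s (par s u) + 1)]
        simp [Function.iterate_succ_apply, Function.comp_def]
      · rw [walkWeight_cons, Sym2.eq_swap, hW, h₄]
        simp only at hp₂ ⊢
        omega
      · intro e he
        rw [SimpleGraph.Walk.edges_cons, List.mem_cons] at he
        rcases he with rfl | he
        · exact ⟨_, _, rfl, Or.inl rfl⟩
        · exact hp₃ e he

/-- The walk through the tree of `s` that connects the ends of a chord. -/
theorem IsChord.exists_walk (hF : IsForest n w lab par dep)
    (hadj : ∀ i j : Fin n, w i j ≠ 0 → G.Adj i j ∧ wt s(i, j) = w i j) {s u v : Fin n}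
    (h : IsChord n w lab par s u v) : ∃ p : G.Walk u v,
      p.support.map Fin.val = (List.range (dep s u + 1)).map (fun i => (par s)^[i] u) ++
        ((List.range (dep s v)).map (fun i => (par s)^[i] v)).reverse ∧
      walkWeight wt p + 2 = lab s u + lab s v ∧ s(v, u) ∉ p.edges := by
  obtain ⟨p, hp₁, hp₂, hp₃⟩ := hF.exists_walk hadj s _ u le_rfl h.left_lab
  obtain ⟨q, hq₁, hq₂, hq₃⟩ := hF.exists_walk hadj s _ v le_rfl h.right_lab
  refine ⟨p.append q.reverse, ?_, ?_, ?_⟩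
  · rw [SimpleGraph.Walk.support_append, List.map_append, hp₁, SimpleGraph.Walk.support_reverse,
      List.tail_reverse, List.map_reverse, List.map_dropLast, hq₁, List.range_succ (n := dep s v),
      List.map_append, List.map_singleton, List.dropLast_concat]
  · rw [walkWeight_append, walkWeight_reverse]
    omega
  · intro he
    rw [SimpleGraph.Walk.edges_append, List.mem_append, SimpleGraph.Walk.edges_reverse,
      List.mem_reverse] at he
    obtain ⟨a, b, hab, ht⟩ : ∃ a b : Fin n, s(v, u) = s(a, b) ∧ IsTreeEdge par s a b :=
      he.elim (hp₃ _) (hq₃ _)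
    rw [Sym2.eq_iff] at hab
    rcases hab with ⟨rfl, rfl⟩ | ⟨rfl, rfl⟩
    · exact h.not_tree ht.symm
    · exact h.not_tree ht

/-- If no cycle is lighter than the closed walk given by a chord, then this walk is a minimum weight
cycle. -/
theorem IsChord.exists_isMinWeightCycle (hF : IsForest n w lab par dep)
    (hwt : ∀ e ∈ G.edgeSet, 1 ≤ wt e)
    (hadj : ∀ i j : Fin n, w i j ≠ 0 → G.Adj i j ∧ wt s(i, j) = w i j) {s u v : ℕ}
    (h : IsChord n w lab par s u v)
    (hmin : ∀ (x : Fin n) (c : G.Walk x x), c.IsCycle →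
      lab s u + w u v + lab s v ≤ walkWeight wt c + 2) :
    ∃ (x : Fin n) (c : G.Walk x x), IsMinWeightCycle wt c ∧
      c.support.dropLast.map Fin.val = v :: ((List.range (dep s u + 1)).map (fun i => (par s)^[i] u) ++
        ((List.range (dep s v)).map (fun i => (par s)^[i] v)).reverse).dropLast := by
  obtain ⟨s, hs⟩ : ∃ s' : Fin n, (s' : ℕ) = s := ⟨⟨s, h.source_lt⟩, rfl⟩
  obtain ⟨u, hu⟩ : ∃ s' : Fin n, (s' : ℕ) = u := ⟨⟨u, h.left_lt⟩, rfl⟩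
  obtain ⟨v, hv⟩ : ∃ s' : Fin n, (s' : ℕ) = v := ⟨⟨v, h.right_lt⟩, rfl⟩
  subst hs hu hv
  obtain ⟨p, hp₁, hp₂, hp₃⟩ := h.exists_walk hF hadj
  obtain ⟨hA, hW⟩ := hadj u v h.weight
  have hc : (SimpleGraph.Walk.cons hA.symm p.bypass).IsCycle := by
    rw [SimpleGraph.Walk.cons_isCycle_iff]
    exact ⟨p.bypass_isPath, fun h' => hp₃ (p.edges_bypass_subset_edges h')⟩
  have h₁ := hmin _ _ hc
  rw [walkWeight_cons, Sym2.eq_swap, hW] at h₁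
  -- The cycle formed by the chord and `p.bypass` is not lighter than the closed walk, so bypassing
  -- has lost no weight.
  have hp : p.IsPath := isPath_of_walkWeight_le hwt p (by omega)
  refine ⟨v, .cons hA.symm p, ⟨?_, fun x c' hc' => ?_⟩, ?_⟩
  · rw [SimpleGraph.Walk.cons_isCycle_iff]
    exact ⟨hp, hp₃⟩
  · have := hmin x c' hc'
    rw [walkWeight_cons, Sym2.eq_swap, hW]
    omega
  · rw [SimpleGraph.Walk.support_cons, List.dropLast_cons_of_ne_nil (by simp), List.map_cons,
      List.map_dropLast, hp₁]

/-- Within the explored radius labels satisfy the triangle inequality along each edge; summation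
over the walk shows that they are bounded by true distances. -/
theorem IsExplored.lab_le {r : ℕ} (hE : IsExplored n w lab par r)
    (hadj : ∀ i j : Fin n, G.Adj i j → w i j ≠ 0 ∧ wt s(i, j) = w i j) (s : Fin n) {y x : Fin n}
    (p : G.Walk y x) (hy : lab s y ≠ 0) (hp : lab s y + walkWeight wt p ≤ r) :
    lab s x ≠ 0 ∧ lab s x ≤ lab s y + walkWeight wt p := by
  induction p with
  | nil => exact ⟨hy, by simp⟩
  | @cons a b c h p ih =>
    obtain ⟨h₁, h₂⟩ := hadj a b h
    rw [walkWeight_cons, h₂] at hp ⊢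
    obtain ⟨h₃, h₄, -⟩ := hE s s.2 a a.2 b b.2 hy h₁ (by omega)
    have := ih h₃ (by omega)
    omega

/-- A cycle contains an edge outside the tree of one of its vertices. -/
theorem IsForest.exists_not_isTreeEdge (hF : IsForest n w lab par dep) (s : Fin n)
    {z : Fin n} (c : G.Walk z z) (hc : c.IsCycle) (hlab : ∀ x ∈ c.support, lab s x ≠ 0) :
    ∃ e ∈ c.edges, ∀ u v : Fin n, e = s(u, v) → ¬ IsTreeEdge par s u v := by
  by_contra! hcon
  -- If all edges of the cycle were tree edges, both neighbours of a vertex with largest label would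
  -- be its parent, although they are distinct.
  obtain ⟨x, hx, hmax⟩ := c.support.toFinset.exists_max_image (fun x => lab s x)
    ⟨z, by simp⟩
  rw [List.mem_toFinset] at hx
  have hc' := hc.rotate hx
  have key : ∀ y : Fin n, s(x, y) ∈ (c.rotate x hx).edges → par s x = y := by
    intro y hy
    have hy' : s(x, y) ∈ c.edges := (c.rotate_edges x hx).mem_iff.1 hy
    have hA : G.Adj x y := c.adj_of_mem_edges hy'
    have hys : y ∈ c.support := c.snd_mem_support_of_mem_edges hy'
    obtain ⟨a, b, hab, ht⟩ := hcon _ hy'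
    have ht' : IsTreeEdge par s x y := by
      rw [Sym2.eq_iff] at hab
      rcases hab with ⟨rfl, rfl⟩ | ⟨rfl, rfl⟩
      exacts [ht, ht.symm]
    rcases ht' with h | h
    · exact h
    · exfalso
      -- The root counts as its own parent, which would make the edge a loop.
      have hne : (y : ℕ) ≠ s := by
        intro e
        rw [e, hF.par_self s s.2] at h
        exact hA.ne (Fin.ext (h ▸ e.symm))
      obtain ⟨-, -, h₃, h₄, -⟩ := hF.step s s.2 y y.2 (hlab y hys) hne
      rw [h] at h₃ h₄
      have := hmax y (by simpa using hys)
      omega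
  have hn := hc'.not_nil
  have h₁ := key _ (SimpleGraph.Walk.mk_start_snd_mem_edges hn)
  have h₂ := SimpleGraph.Walk.mk_penultimate_end_mem_edges hn
  rw [Sym2.eq_swap] at h₂
  exact hc'.snd_ne_penultimate (Fin.ext (h₁.symm.trans (key _ h₂)))

/-- A cycle that is not too heavy yields a chord that is at most as heavy. -/
theorem IsExplored.exists_isChord {r : ℕ} (hF : IsForest n w lab par dep)
    (hE : IsExplored n w lab par r)
    (hadj : ∀ i j : Fin n, G.Adj i j → w i j ≠ 0 ∧ wt s(i, j) = w i j)
    {s : Fin n} (c : G.Walk s s) (hc : c.IsCycle) (hr : walkWeight wt c + 1 ≤ 2 * r) :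
    ∃ s u v, IsChord n w lab par s u v ∧ lab s u + w u v + lab s v ≤ walkWeight wt c + 2 ∧
      lab s u ≤ r ∧ lab s v ≤ r := by
  have hs := hF.lab_self s s.2
  -- The lighter of the two arcs from `s` to `x` has at most half the weight of the cycle, hence at
  -- most `r - 1`, and the label exceeds it by at most one.
  have hlab : ∀ x ∈ c.support, lab s x ≠ 0 ∧ lab s x ≤ r := by
    intro x hx
    have h₁ : walkWeight wt c = walkWeight wt (c.takeUntil x hx) + walkWeight wt (c.dropUntil x hx).reverse := by
      rw [walkWeight_reverse, ← walkWeight_append, SimpleGraph.Walk.take_spec]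
    rcases le_total (walkWeight wt (c.takeUntil x hx)) (walkWeight wt (c.dropUntil x hx).reverse) with h | h
    · have := hE.lab_le hadj s (c.takeUntil x hx) (by omega) (by omega)
      omega
    · have := hE.lab_le hadj s (c.dropUntil x hx).reverse (by omega) (by omega)
      omega
  -- Walks of weight at least `r` need no argument, because the label is at most `r`.
  have hle : ∀ x ∈ c.support, ∀ p : G.Walk s x, lab s x ≤ 1 + walkWeight wt p := by
    intro x hx p
    by_cases h : walkWeight wt p + 1 ≤ r
    · have := hE.lab_le hadj s p (by omega) (by omega)
      omega
    · have := (hlab x hx).2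
      omega
  obtain ⟨e, he, hne⟩ := hF.exists_not_isTreeEdge s c hc fun x hx => (hlab x hx).1
  -- Without the edge outside the tree, the cycle consists of walks from `s` to its two ends; these
  -- bound the two labels.
  obtain ⟨u, v, p₁, p₂, rfl, hA, hW⟩ := walkWeight_split wt c he
  have hu := c.fst_mem_support_of_mem_edges he
  have hv := c.snd_mem_support_of_mem_edges he
  have h₁ := hle u hu p₁
  have h₂ := hle v hv p₂.reverse
  rw [walkWeight_reverse] at h₂
  rw [(hadj u v hA).2] at hW
  exact ⟨s, u, v, ⟨s.2, u.2, v.2, (hlab u hu).1, (hlab v hv).1, (hadj u v hA).1, hne u v rfl⟩,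
    by omega, (hlab u hu).2, (hlab v hv).2⟩

/-- The weight of a cycle is at most `n * M`. -/
theorem walkWeight_le_of_isCycle {M : ℕ} (hwt : ∀ e ∈ G.edgeSet, wt e ≤ M) {z : Fin n}
    (c : G.Walk z z) (hc : c.IsCycle) : walkWeight wt c ≤ n * M := by
  have h₁ : walkWeight wt c ≤ c.length * M := by
    rw [walkWeight, ← c.length_edges, ← List.length_map (f := wt), ← smul_eq_mul]
    refine List.sum_le_card_nsmul _ _ fun x hx => ?_
    obtain ⟨e, he, rfl⟩ := List.mem_map.1 hx
    exact hwt e (c.edges_subset_edgeSet he)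
  have h₂ : c.length ≤ n := by
    have := hc.support_nodup.length_le_card
    simpa using this
  exact h₁.trans (Nat.mul_le_mul_right _ h₂)

/-- A cycle weighs at most `n * M`, so it would yield a chord with `lab s u + w u v + lab s v ≤ n *
M + 2`. As `lab s v ≥ 1`, the edge is due within the radius, has been explored, and thus belongs to
the tree. -/
theorem IsExplored.isAcyclic {M r : ℕ} (hF : IsForest n w lab par dep)
    (hE : IsExplored n w lab par r) (hr : n * M + 1 ≤ r) (hwt : ∀ e ∈ G.edgeSet, wt e ≤ M)
    (hadj : ∀ i j : Fin n, G.Adj i j → w i j ≠ 0 ∧ wt s(i, j) = w i j) : G.IsAcyclic := by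
  intro z c hc
  have h := walkWeight_le_of_isCycle hwt c hc
  obtain ⟨s, u, v, h₁, h₂, h₃, h₄⟩ := hE.exists_isChord hF hadj c hc (by omega)
  have := h₁.right_lab
  exact h₁.not_tree (hE s h₁.source_lt u h₁.left_lt v h₁.right_lt h₁.left_lab h₁.weight (by omega)).2.2

end Forest

/-! ### From straight-line programs to bilinear schemes -/

section StraightLine

variable {n : ℕ}

theorem slRun_append {R : Type} [Ring R] (A B : Matrix (Fin n) (Fin n) R) (p q : List (SLInstr n))
    (past : List R) : slRun A B (p ++ q) past = slRun A B q (slRun A B p past) := by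
  induction p generalizing past with
  | nil => rfl
  | cons i p ih => exact ih _

theorem slRun_length {R : Type} [Ring R] (A B : Matrix (Fin n) (Fin n) R) (p : List (SLInstr n))
    (past : List R) : (slRun A B p past).length = past.length + p.length := by
  induction p generalizing past with
  | nil => rfl
  | cons i p ih => simp only [slRun, ih, List.length_append, List.length_cons, List.length_nil]; omega

theorem slRun_concat {R : Type} [Ring R] (A B : Matrix (Fin n) (Fin n) R) (p : List (SLInstr n))
    (i : SLInstr n) :
    slRun A B (p ++ [i]) [] = slRun A B p [] ++ [i.val A B (slRun A B p [])] := by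
  rw [slRun_append]; rfl

theorem slRun_concat_getD_of_lt {R : Type} [Ring R] (A B : Matrix (Fin n) (Fin n) R)
    (p : List (SLInstr n)) (i : SLInstr n) {k : ℕ} (hk : k < p.length) :
    (slRun A B (p ++ [i]) []).getD k 0 = (slRun A B p []).getD k 0 := by
  rw [slRun_concat, List.getD_append _ _ _ _ (by simpa [slRun_length] using hk)]

theorem slRun_concat_getD_self {R : Type} [Ring R] (A B : Matrix (Fin n) (Fin n) R)
    (p : List (SLInstr n)) (i : SLInstr n) :
    (slRun A B (p ++ [i]) []).getD p.length 0 = i.val A B (slRun A B p []) := by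
  rw [slRun_concat, List.getD_append_right _ _ _ _ (by simp [slRun_length])]
  simp [slRun_length]

/-- The program has an instruction that computes `f`. -/
def SLComputes (p : List (SLInstr n))
    (f : ∀ (R : Type) [Ring R], Matrix (Fin n) (Fin n) R → Matrix (Fin n) (Fin n) R → R) : Prop :=
  ∃ k < p.length, ∀ (R : Type) [Ring R] (A B : Matrix (Fin n) (Fin n) R),
    (slRun A B p []).getD k 0 = f R A B

theorem SLComputes.concat {p : List (SLInstr n)}
    {f : ∀ (R : Type) [Ring R], Matrix (Fin n) (Fin n) R → Matrix (Fin n) (Fin n) R → R}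
    (h : SLComputes p f) (i : SLInstr n) : SLComputes (p ++ [i]) f := by
  obtain ⟨k, hk, hf⟩ := h
  refine ⟨k, by simp; omega, fun R _ A B => ?_⟩
  rw [slRun_concat_getD_of_lt A B p i hk, hf]

theorem SLComputes.append {p : List (SLInstr n)}
    {f : ∀ (R : Type) [Ring R], Matrix (Fin n) (Fin n) R → Matrix (Fin n) (Fin n) R → R}
    (h : SLComputes p f) (q : List (SLInstr n)) : SLComputes (p ++ q) f := by
  induction q using List.reverseRecOn with
  | nil => simpa using h
  | append_singleton q i ih => rw [← List.append_assoc]; exact ih.concat i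

theorem exists_slComputes_sum (p : List (SLInstr n)) (i j : Fin n) (l : List (Fin n)) :
    ∃ q : List (SLInstr n), q.length = 2 * l.length + 1 ∧
      SLComputes (p ++ q) (fun _ _ A B => (l.map fun k => A i k * B k j).sum) := by
  induction l with
  | nil =>
    refine ⟨[.const 0], rfl, p.length, by simp, fun R _ A B => ?_⟩
    rw [slRun_concat_getD_self]
    simp [SLInstr.val]
  | cons k l ih =>
    obtain ⟨q, hq, k₀, hk₀, hf⟩ := ih
    refine ⟨q ++ [.mul (.left i k) (.right k j)] ++ [.add (.result (p ++ q).length) (.result k₀)],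
      by simp [hq]; ring, (p ++ q).length + 1, by simp [← add_assoc], fun R _ A B => ?_⟩
    have e : (p ++ q).length + 1 = ((p ++ q) ++ [SLInstr.mul (.left i k) (.right k j)]).length := by
      simp [add_assoc]
    rw [← List.append_assoc, ← List.append_assoc, e, slRun_concat_getD_self]
    simp only [SLInstr.val, SLOperand.val]
    rw [slRun_concat_getD_self, slRun_concat_getD_of_lt A B _ _ hk₀, hf]
    simp [SLInstr.val, SLOperand.val]

/-- The schoolbook method. It serves to make the set in the definition of `matMulExponent` nonempty,
so that its infimum is approached. -/
theorem exists_computesMatrixProduct (n : ℕ) :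
    ∃ p : List (SLInstr n), ComputesMatrixProduct p ∧ p.length = n * n * (2 * n + 1) := by
  have key : ∀ L : List (Fin n × Fin n), ∃ p : List (SLInstr n), p.length = L.length * (2 * n + 1) ∧
      ∀ ij ∈ L, SLComputes p (fun _ _ A B => (A * B) ij.1 ij.2) := by
    intro L
    induction L with
    | nil => exact ⟨[], by simp, by simp⟩
    | cons ij L ih =>
      obtain ⟨p, hp, hL⟩ := ih
      obtain ⟨q, hq, hs⟩ := exists_slComputes_sum p ij.1 ij.2 (List.finRange n)
      refine ⟨p ++ q, by simp [hp, hq]; ring, fun x hx => ?_⟩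
      rcases List.mem_cons.1 hx with rfl | hx
      · obtain ⟨k, hk, hf⟩ := hs
        refine ⟨k, hk, fun R _ A B => ?_⟩
        rw [hf]
        beta_reduce
        rw [Matrix.mul_apply, Fin.sum_univ_def]
      · exact (hL x hx).append q
  obtain ⟨p, hp, hL⟩ := key (Finset.univ : Finset (Fin n × Fin n)).toList
  choose k _ hf using fun i j => hL (i, j) (by simp)
  exact ⟨p, ⟨fun i j => .result (k i j), fun R _ A B i j => hf i j R A B⟩, by simpa using hp⟩

/-- Entries of the product cannot be input entries, and distinct entries cannot share an
instruction, since `1 * single i j 1` tells them apart. -/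
theorem ComputesMatrixProduct.sq_le_length {p : List (SLInstr n)} (h : ComputesMatrixProduct p) :
    n * n ≤ p.length := by
  obtain ⟨out, hout⟩ := h
  have key : ∀ i j : Fin n, ∃ k < p.length, out i j = .result k := by
    intro i j
    have h₁ := hout ℤ 1 (Matrix.single i j 1) i j
    rw [one_mul, Matrix.single_apply_same] at h₁
    -- An entry of the left factor is unaffected when the right factor is replaced by `0`, although
    -- the product vanishes; similarly for the right factor. A missing instruction would give the
    -- default value `0` instead of `1`.
    cases ho : out i j with
    | left a b =>
      have h₂ := hout ℤ 1 0 i j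
      rw [ho] at h₁ h₂
      simp only [SLOperand.val] at h₁ h₂
      simp [h₁] at h₂
    | right a b =>
      have h₂ := hout ℤ 0 (Matrix.single i j 1) i j
      rw [ho] at h₁ h₂
      simp only [SLOperand.val] at h₁ h₂
      simp [h₁] at h₂
    | result k =>
      refine ⟨k, ?_, rfl⟩
      by_contra hk
      rw [ho] at h₁
      simp only [SLOperand.val] at h₁
      rw [List.getD_eq_default _ _ (by simpa [slRun_length] using hk)] at h₁
      exact zero_ne_one h₁
  choose k hk hok using key
  have hinj : Function.Injective fun ij : Fin n × Fin n => k ij.1 ij.2 := by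
    rintro ⟨i, j⟩ ⟨i', j'⟩ hkk
    simp only at hkk
    have h₁ := hout ℤ 1 (Matrix.single i j 1) i j
    have h₂ := hout ℤ 1 (Matrix.single i j 1) i' j'
    rw [hok, ← hkk, ← hok, h₁, one_mul, Matrix.single_apply_same, Matrix.single_apply] at h₂
    by_contra hne
    rw [if_neg (fun h => hne (by simp [h.1, h.2]))] at h₂
    exact one_ne_zero h₂
  have := Finset.card_le_card_of_injOn (s := Finset.univ) (t := Finset.range p.length)
    (fun ij : Fin n × Fin n => k ij.1 ij.2) (fun ij _ => by simpa using hk ij.1 ij.2) hinj.injOn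
  simpa using this

/-- The bilinear forms spanned by products of linear forms. -/
def bilinearSpan (us : List ((Matrix (Fin n) (Fin n) ℤ →ₗ[ℤ] ℤ) × (Matrix (Fin n) (Fin n) ℤ →ₗ[ℤ] ℤ))) :
    Submodule ℤ (Matrix (Fin n) (Fin n) ℤ → Matrix (Fin n) (Fin n) ℤ → ℤ) :=
  Submodule.span ℤ {f | ∃ u ∈ us, f = fun A B => u.1 A * u.2 B}

theorem bilinearSpan_mono {us vs : List ((Matrix (Fin n) (Fin n) ℤ →ₗ[ℤ] ℤ) ×
    (Matrix (Fin n) (Fin n) ℤ →ₗ[ℤ] ℤ))} (h : us ⊆ vs) : bilinearSpan us ≤ bilinearSpan vs :=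
  Submodule.span_mono fun _ ⟨u, hu, hf⟩ => ⟨u, h hu, hf⟩

/-- The matrix-valued function is upper triangular with constant diagonal, with linear forms above
the diagonal and a bilinear form in the corner. -/
def HasBilinearForm (us : List ((Matrix (Fin n) (Fin n) ℤ →ₗ[ℤ] ℤ) × (Matrix (Fin n) (Fin n) ℤ →ₗ[ℤ] ℤ)))
    (v : Matrix (Fin n) (Fin n) ℤ → Matrix (Fin n) (Fin n) ℤ → Matrix (Fin 3) (Fin 3) ℤ) : Prop :=
  ∃ (c : ℤ) (α β : Matrix (Fin n) (Fin n) ℤ →ₗ[ℤ] ℤ),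
    ∃ γ ∈ bilinearSpan us, ∀ A B, v A B = !![c, α A, γ A B; 0, c, β B; 0, 0, c]

/-- The left input matrix, with its entries above the diagonal of a matrix. -/
def liftLeft (A : Matrix (Fin n) (Fin n) ℤ) : Matrix (Fin n) (Fin n) (Matrix (Fin 3) (Fin 3) ℤ) :=
  fun i j => !![0, A i j, 0; 0, 0, 0; 0, 0, 0]

/-- The right input matrix, with its entries above the diagonal of a matrix. -/
def liftRight (B : Matrix (Fin n) (Fin n) ℤ) : Matrix (Fin n) (Fin n) (Matrix (Fin 3) (Fin 3) ℤ) :=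
  fun i j => !![0, 0, 0; 0, 0, B i j; 0, 0, 0]

/-- Triangular matrices of this shape are closed under the ring operations. In a product the corner
is `c γ' + α β' + c' γ`, so a multiplication contributes one new product of a linear form in `A` by
one in `B`, and all other instructions contribute none. -/
theorem exists_hasBilinearForm_instr
    {us : List ((Matrix (Fin n) (Fin n) ℤ →ₗ[ℤ] ℤ) × (Matrix (Fin n) (Fin n) ℤ →ₗ[ℤ] ℤ))}
    {past : Matrix (Fin n) (Fin n) ℤ → Matrix (Fin n) (Fin n) ℤ → List (Matrix (Fin 3) (Fin 3) ℤ)}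
    (h : ∀ o : SLOperand n, HasBilinearForm us fun A B => o.val (liftLeft A) (liftRight B) (past A B))
    (i : SLInstr n) :
    ∃ vs, us ⊆ vs ∧ vs.length ≤ us.length + 1 ∧
      HasBilinearForm vs fun A B => i.val (liftLeft A) (liftRight B) (past A B) := by
  cases i with
  | const z =>
    refine ⟨us, List.Subset.refl _, by simp, z, 0, 0, 0, Submodule.zero_mem _, fun A B => ?_⟩
    ext a b
    fin_cases a <;> fin_cases b <;> simp [SLInstr.val, Matrix.intCast_apply]
  | add x y =>
    obtain ⟨c, α, β, γ, hγ, hx⟩ := h x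
    obtain ⟨c', α', β', γ', hγ', hy⟩ := h y
    refine ⟨us, List.Subset.refl _, by simp, c + c', α + α', β + β', γ + γ',
      Submodule.add_mem _ hγ hγ', fun A B => ?_⟩
    simp only [SLInstr.val, hx, hy]
    ext a b
    fin_cases a <;> fin_cases b <;> simp
  | sub x y =>
    obtain ⟨c, α, β, γ, hγ, hx⟩ := h x
    obtain ⟨c', α', β', γ', hγ', hy⟩ := h y
    refine ⟨us, List.Subset.refl _, by simp, c - c', α - α', β - β', γ - γ',
      Submodule.sub_mem _ hγ hγ', fun A B => ?_⟩
    simp only [SLInstr.val, hx, hy]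
    ext a b
    fin_cases a <;> fin_cases b <;> simp
  | mul x y =>
    obtain ⟨c, α, β, γ, hγ, hx⟩ := h x
    obtain ⟨c', α', β', γ', hγ', hy⟩ := h y
    have hs : us ⊆ (α, β') :: us := List.subset_cons_self _ _
    refine ⟨(α, β') :: us, hs, by simp, c * c', c • α' + c' • α, c • β' + c' • β,
      c • γ' + (fun A B => α A * β' B) + c' • γ, ?_, fun A B => ?_⟩
    · refine Submodule.add_mem _ (Submodule.add_mem _ (Submodule.smul_mem _ _ (bilinearSpan_mono hs hγ'))
        (Submodule.subset_span ⟨_, List.mem_cons_self, rfl⟩))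
        (Submodule.smul_mem _ _ (bilinearSpan_mono hs hγ))
    · simp only [SLInstr.val, hx, hy]
      ext a b
      fin_cases a <;> fin_cases b <;> simp [Matrix.mul_apply, Fin.sum_univ_three] <;> ring

theorem exists_hasBilinearForm (p : List (SLInstr n)) :
    ∃ us, us.length ≤ p.length ∧ ∀ o : SLOperand n,
      HasBilinearForm us fun A B => o.val (liftLeft A) (liftRight B) (slRun (liftLeft A) (liftRight B) p []) := by
  have zero : ∀ us : List ((Matrix (Fin n) (Fin n) ℤ →ₗ[ℤ] ℤ) × (Matrix (Fin n) (Fin n) ℤ →ₗ[ℤ] ℤ)),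
      HasBilinearForm us fun _ _ => 0 := fun us =>
    ⟨0, 0, 0, 0, Submodule.zero_mem _, fun A B => by
      ext a b; fin_cases a <;> fin_cases b <;> simp⟩
  have inputs : ∀ (us : List ((Matrix (Fin n) (Fin n) ℤ →ₗ[ℤ] ℤ) × (Matrix (Fin n) (Fin n) ℤ →ₗ[ℤ] ℤ)))
      (p : List (SLInstr n)), (∀ k, HasBilinearForm us fun A B =>
        (SLOperand.result k).val (liftLeft A) (liftRight B) (slRun (liftLeft A) (liftRight B) p [])) →
      ∀ o : SLOperand n, HasBilinearForm us fun A B =>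
        o.val (liftLeft A) (liftRight B) (slRun (liftLeft A) (liftRight B) p []) := by
    intro us p hr o
    cases o with
    | left i j =>
      refine ⟨0, Matrix.entryLinearMap ℤ ℤ i j, 0, 0, Submodule.zero_mem _, fun A B => ?_⟩
      ext a b
      fin_cases a <;> fin_cases b <;> simp [SLOperand.val, liftLeft]
    | right i j =>
      refine ⟨0, 0, Matrix.entryLinearMap ℤ ℤ i j, 0, Submodule.zero_mem _, fun A B => ?_⟩
      ext a b
      fin_cases a <;> fin_cases b <;> simp [SLOperand.val, liftRight]
    | result k => exact hr k
  induction p using List.reverseRecOn with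
  | nil => exact ⟨[], le_rfl, inputs _ _ fun k => by simpa [SLOperand.val, slRun] using zero []⟩
  | append_singleton p i ih =>
    obtain ⟨us, hus, h⟩ := ih
    obtain ⟨vs, hs, hl, hv⟩ := exists_hasBilinearForm_instr h i
    refine ⟨vs, by simp; omega, inputs _ _ fun k => ?_⟩
    simp only [SLOperand.val]
    -- A reference beyond the executed instructions has the default value `0`, which is of the
    -- required form.
    rcases lt_trichotomy k p.length with hk | rfl | hk
    · simp only [slRun_concat_getD_of_lt _ _ p i hk]
      obtain ⟨c, α, β, γ, hγ, hx⟩ := h (.result k)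
      exact ⟨c, α, β, γ, bilinearSpan_mono hs hγ, hx⟩
    · simpa only [slRun_concat_getD_self] using hv
    · have : ∀ A B : Matrix (Fin n) (Fin n) ℤ,
          (slRun (liftLeft A) (liftRight B) (p ++ [i]) []).getD k 0 = 0 := fun A B =>
        List.getD_eq_default _ _ (by simp [slRun_length]; omega)
      simpa only [this] using zero vs

end StraightLine

/-- The bilinear map with structure constants `T`, on inputs of length `X` and with outputs of length
`Z`, is computed by means of `r` products of linear forms. -/
def IsScheme (r X Z : ℕ) (T : ℕ → ℕ → ℕ → ℤ) (U V W : ℕ → ℕ → ℤ) : Prop :=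
  ∀ x < X, ∀ y < X, ∀ z < Z, ∑ p ∈ Finset.range r, W z p * U p x * V p y = T x y z

/-- The structure constants of the product of `n × n` matrices. -/
def matMulTensor (n x y z : ℕ) : ℤ := if x / n = z / n ∧ x % n = y / n ∧ y % n = z % n then 1 else 0

/-- Correctness over the noncommutative ring of `3 × 3` integer matrices is used. The corner of the
product of the lifted matrices is the true product, so each entry of `A * B` is an integer
combination of the collected products of forms. Evaluation at matrix units gives the coefficients.
-/
theorem ComputesMatrixProduct.exists_isScheme {n : ℕ} {p : List (SLInstr n)}
    (h : ComputesMatrixProduct p) :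
    ∃ U V W, IsScheme p.length (n * n) (n * n) (matMulTensor n) U V W := by
  obtain ⟨out, hout⟩ := h
  obtain ⟨us, hus, hf⟩ := exists_hasBilinearForm p
  have hspan : ∀ i j : Fin n, ∃ c : Fin us.length → ℤ, ∀ A B : Matrix (Fin n) (Fin n) ℤ,
      ∑ q, c q * ((us.get q).1 A * (us.get q).2 B) = (A * B) i j := by
    intro i j
    obtain ⟨c, α, β, γ, hγ, hx⟩ := hf (out i j)
    have hγ' : γ = fun A B => (A * B) i j := by
      funext A B
      have h₁ := congrFun (congrFun (hx A B) 0) 2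
      beta_reduce at h₁
      rw [hout, Matrix.mul_apply, Matrix.sum_apply] at h₁
      simpa [liftLeft, liftRight, Matrix.mul_apply, Fin.sum_univ_three] using h₁.symm
    have hset : {f : Matrix (Fin n) (Fin n) ℤ → Matrix (Fin n) (Fin n) ℤ → ℤ |
        ∃ u ∈ us, f = fun A B => u.1 A * u.2 B} =
        Set.range fun (q : Fin us.length) A B => (us.get q).1 A * (us.get q).2 B := by
      ext f
      constructor
      · rintro ⟨u, hu, rfl⟩
        obtain ⟨q, rfl⟩ := List.mem_iff_get.1 hu
        exact ⟨q, rfl⟩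
      · rintro ⟨q, rfl⟩
        exact ⟨_, List.get_mem us q, rfl⟩
    rw [bilinearSpan, hset, Submodule.mem_span_range_iff_exists_fun] at hγ
    obtain ⟨c, hc⟩ := hγ
    refine ⟨c, fun A B => ?_⟩
    have := congrFun (congrFun (hc.trans hγ') A) B
    simpa using this
  choose c hc using hspan
  classical
  -- The program may have fewer multiplications than instructions; the scheme is padded with zero
  -- forms up to the length of the program.
  refine ⟨fun q x => if hq : q < us.length ∧ x < n * n then
      (us.get ⟨q, hq.1⟩).1 (Matrix.single (⟨x, hq.2⟩ : Fin (n * n)).divNat (⟨x, hq.2⟩ : Fin (n * n)).modNat 1) else 0,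
    fun q y => if hq : q < us.length ∧ y < n * n then
      (us.get ⟨q, hq.1⟩).2 (Matrix.single (⟨y, hq.2⟩ : Fin (n * n)).divNat (⟨y, hq.2⟩ : Fin (n * n)).modNat 1) else 0,
    fun z q => if hq : q < us.length ∧ z < n * n then
      c (⟨z, hq.2⟩ : Fin (n * n)).divNat (⟨z, hq.2⟩ : Fin (n * n)).modNat ⟨q, hq.1⟩ else 0, ?_⟩
  intro x hx y hy z hz
  have h₁ := hc (⟨z, hz⟩ : Fin (n * n)).divNat (⟨z, hz⟩ : Fin (n * n)).modNat
    (Matrix.single (⟨x, hx⟩ : Fin (n * n)).divNat (⟨x, hx⟩ : Fin (n * n)).modNat 1)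
    (Matrix.single (⟨y, hy⟩ : Fin (n * n)).divNat (⟨y, hy⟩ : Fin (n * n)).modNat 1)
  rw [← Finset.sum_subset (Finset.range_subset_range.2 hus) (fun q _ hq => by
    beta_reduce
    rw [dif_neg (fun h => hq (Finset.mem_range.2 h.1))]; simp), Finset.sum_range]
  simp only [Fin.is_lt, hx, hy, hz, and_self, dif_pos]
  calc _ = _ := Finset.sum_congr rfl fun q _ => by simp only [Fin.eta, mul_assoc]
    _ = _ := h₁
    _ = _ := by
      rw [matMulTensor]
      by_cases hk : x % n = y / n
      · have hk' : (⟨x, hx⟩ : Fin (n * n)).modNat = (⟨y, hy⟩ : Fin (n * n)).divNat := Fin.ext hk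
        rw [hk', Matrix.single_mul_single_same, Matrix.single_apply]
        simp [Fin.ext_iff, hk]
      · rw [Matrix.single_mul_single_of_ne, if_neg (fun h => hk h.2.1)]
        · rfl
        · exact fun h => hk (congrArg Fin.val h)

/-- Programs have at least `n²` instructions, and `n ^ 2` outgrows `C * n ^ τ` if `τ < 2`. -/
theorem two_le_of_forall_slp {τ : ℝ} (h : ∃ C : ℝ, ∀ n : ℕ, 1 ≤ n →
    ∃ p : List (SLInstr n), ComputesMatrixProduct p ∧ (p.length : ℝ) ≤ C * (n : ℝ) ^ τ) : 2 ≤ τ := by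
  obtain ⟨C, hC⟩ := h
  by_contra! hτ
  have h₁ : Filter.Tendsto (fun n : ℕ => (n : ℝ) ^ (2 - τ)) Filter.atTop Filter.atTop :=
    (tendsto_rpow_atTop (by linarith)).comp tendsto_natCast_atTop_atTop
  obtain ⟨n, hn, hn₁⟩ := ((h₁.eventually_gt_atTop C).and (Filter.eventually_ge_atTop 1)).exists
  obtain ⟨p, hp, hl⟩ := hC n hn₁
  have h₂ : ((n * n : ℕ) : ℝ) ≤ p.length := by exact_mod_cast hp.sq_le_length
  have hn₀ : (0 : ℝ) < n := by exact_mod_cast hn₁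
  have h₃ : (n : ℝ) ^ (2 - τ) * (n : ℝ) ^ τ = n * n := by
    rw [← Real.rpow_add hn₀, sub_add_cancel, Real.rpow_two, sq]
  have h₄ : 0 < (n : ℝ) ^ τ := Real.rpow_pos_of_pos hn₀ _
  push_cast at h₂
  nlinarith

theorem exists_exponent_lt {σ : ℝ} (hσ : matMulExponent < σ) :
    ∃ τ < σ, 2 ≤ τ ∧ ∃ C : ℝ, ∀ n : ℕ, 1 ≤ n →
      ∃ p : List (SLInstr n), ComputesMatrixProduct p ∧ (p.length : ℝ) ≤ C * (n : ℝ) ^ τ := by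
  have hne : {τ : ℝ | ∃ C : ℝ, ∀ n : ℕ, 1 ≤ n → ∃ p : List (SLInstr n),
      ComputesMatrixProduct p ∧ (p.length : ℝ) ≤ C * (n : ℝ) ^ τ}.Nonempty := by
    refine ⟨3, 3, fun n hn => ?_⟩
    obtain ⟨p, hp, hl⟩ := exists_computesMatrixProduct n
    refine ⟨p, hp, ?_⟩
    have : p.length ≤ 3 * n ^ 3 := by
      rw [hl]
      nlinarith [Nat.mul_le_mul (Nat.mul_le_mul (le_refl n) (le_refl n)) hn]
    exact_mod_cast this
  obtain ⟨τ, hτ, hlt⟩ := exists_lt_of_csInf_lt hne hσ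
  exact ⟨τ, hlt, two_le_of_forall_slp hτ, hτ⟩

/-! ### Tensor powers of bilinear schemes -/

theorem Finset.sum_range_mul_eq {S : Type*} [AddCommMonoid S] (f : ℕ → S) (a b : ℕ) :
    ∑ x ∈ Finset.range (a * b), f x = ∑ i ∈ Finset.range a, ∑ j ∈ Finset.range b, f (i * b + j) := by
  induction a with
  | zero => simp
  | succ a ih => rw [add_mul, one_mul, Finset.sum_range_add, ih, Finset.sum_range_succ]

theorem mul_add_mod_of_lt_right {a b c : ℕ} (h : c < b) : (a * b + c) % b = c := by
  rw [mul_comm, Nat.mul_add_mod, Nat.mod_eq_of_lt h]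

theorem mul_add_div_of_lt_right {a b c : ℕ} (h : c < b) : (a * b + c) / b = a := by
  rw [mul_comm, Nat.mul_add_div (by omega), Nat.div_eq_of_lt h, add_zero]

section Tensor

variable {S : Type*} [CommRing S]

/-- The entries of the Kronecker powers of an `R × X` matrix. -/
def digitProd (Q : ℕ → ℕ → S) (R X : ℕ) : ℕ → ℕ → ℕ → S
  | 0, _, _ => 1
  | k + 1, P, I => Q (P % R) (I % X) * digitProd Q R X k (P / R) (I / X)

/-- The recursion splits off the lowest digits, whereas a pass of the transform produces a new top
digit; by this identity the kernel splits at the top as well. -/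
theorem digitProd_top (Q : ℕ → ℕ → S) (R X : ℕ) (k : ℕ) {p x P I : ℕ} (hp : p < R) (hx : x < X)
    (hP : P < R ^ k) (hI : I < X ^ k) :
    digitProd Q R X (k + 1) (p * R ^ k + P) (x * X ^ k + I) = Q p x * digitProd Q R X k P I := by
  induction k generalizing P I with
  | zero =>
    rw [pow_zero, Nat.lt_one_iff] at hP hI
    subst hP hI
    simp [digitProd, Nat.mod_eq_of_lt hp, Nat.mod_eq_of_lt hx]
  | succ k ih =>
    have e₁ : (p * R ^ (k + 1) + P) % R = P % R := by
      rw [pow_succ, ← mul_assoc, mul_comm _ R, Nat.mul_add_mod]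
    have e₂ : (x * X ^ (k + 1) + I) % X = I % X := by
      rw [pow_succ, ← mul_assoc, mul_comm _ X, Nat.mul_add_mod]
    have e₃ : (p * R ^ (k + 1) + P) / R = p * R ^ k + P / R := by
      rw [pow_succ, ← mul_assoc, mul_comm _ R, Nat.mul_add_div (by omega)]
    have e₄ : (x * X ^ (k + 1) + I) / X = x * X ^ k + I / X := by
      rw [pow_succ, ← mul_assoc, mul_comm _ X, Nat.mul_add_div (by omega)]
    rw [digitProd, e₁, e₂, e₃, e₄, ih, digitProd]
    · ring
    · exact Nat.div_lt_of_lt_mul (by rwa [pow_succ'] at hP)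
    · exact Nat.div_lt_of_lt_mul (by rwa [pow_succ'] at hI)

/-- The structure constants of the powers of a bilinear map. -/
def tensorPow (T : ℕ → ℕ → ℕ → S) (X Z : ℕ) : ℕ → ℕ → ℕ → ℕ → S
  | 0, _, _, _ => 1
  | k + 1, I, J, z => T (I % X) (J % X) (z % Z) * tensorPow T X Z k (I / X) (J / X) (z / Z)

/-- Powers of a scheme compute powers of the bilinear map: the sum over an index factors into a sum
over its lowest digit and one over the rest. -/
theorem sum_digitProd {r X Z : ℕ} (hX : 0 < X) (hZ : 0 < Z) {T : ℕ → ℕ → ℕ → S} {U V W : ℕ → ℕ → S}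
    (h : ∀ x < X, ∀ y < X, ∀ z < Z, ∑ p ∈ Finset.range r, W z p * U p x * V p y = T x y z)
    (k I J z : ℕ) :
    ∑ P ∈ Finset.range (r ^ k), digitProd W Z r k z P * digitProd U r X k P I * digitProd V r X k P J =
      tensorPow T X Z k I J z := by
  induction k generalizing I J z with
  | zero => simp [digitProd, tensorPow]
  | succ k ih =>
    rw [tensorPow, ← h _ (Nat.mod_lt _ hX) _ (Nat.mod_lt _ hX) _ (Nat.mod_lt _ hZ), ← ih, pow_succ,
      Finset.sum_range_mul_eq, Finset.sum_mul_sum, Finset.sum_comm]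
    refine Finset.sum_congr rfl fun p hp => Finset.sum_congr rfl fun P _ => ?_
    have hp' := Finset.mem_range.1 hp
    simp only [digitProd, mul_add_mod_of_lt_right hp', mul_add_div_of_lt_right hp']
    ring

/-- The kernel of the tensor product of a `k`-th power with an `l`-th power. -/
def prodKernel (Q : ℕ → ℕ → S) (R X k : ℕ) (Q' : ℕ → ℕ → S) (R' X' l P I : ℕ) : S :=
  digitProd Q R X k (P % R ^ k) (I % X ^ k) * digitProd Q' R' X' l (P / R ^ k) (I / X ^ k)

theorem sum_prodKernel {r X Z : ℕ} (hX : 0 < X) (hZ : 0 < Z) {T : ℕ → ℕ → ℕ → S} {U V W : ℕ → ℕ → S}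
    (h : ∀ x < X, ∀ y < X, ∀ z < Z, ∑ p ∈ Finset.range r, W z p * U p x * V p y = T x y z)
    {r' X' Z' : ℕ} (hX' : 0 < X') (hZ' : 0 < Z') {T' : ℕ → ℕ → ℕ → S} {U' V' W' : ℕ → ℕ → S}
    (h' : ∀ x < X', ∀ y < X', ∀ z < Z', ∑ p ∈ Finset.range r', W' z p * U' p x * V' p y = T' x y z)
    (k l I J z : ℕ) :
    ∑ P ∈ Finset.range (r' ^ l * r ^ k), prodKernel W Z r k W' Z' r' l z P *
      prodKernel U r X k U' r' X' l P I * prodKernel V r X k V' r' X' l P J =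
      tensorPow T X Z k (I % X ^ k) (J % X ^ k) (z % Z ^ k) *
        tensorPow T' X' Z' l (I / X ^ k) (J / X ^ k) (z / Z ^ k) := by
  rw [← sum_digitProd hX hZ h, ← sum_digitProd hX' hZ' h', Finset.sum_range_mul_eq,
    Finset.sum_mul_sum, Finset.sum_comm]
  refine Finset.sum_congr rfl fun p hp => Finset.sum_congr rfl fun P _ => ?_
  have hp' := Finset.mem_range.1 hp
  simp only [prodKernel, mul_add_mod_of_lt_right hp', mul_add_div_of_lt_right hp']
  ring

end Tensor

/-! ### Index encodings -/

/-- The interleaved base `a` digits of a pair. -/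
def pairCode (a : ℕ) : ℕ → ℕ → ℕ → ℕ
  | 0, _, _ => 0
  | k + 1, s, u => pairCode a k (s / a) (u / a) * (a * a) + (s % a * a + u % a)

/-- The number with the same digits in base `e` as the given number has in base `d`. -/
def rebase (d e : ℕ) : ℕ → ℕ → ℕ
  | 0, _ => 0
  | k + 1, y => rebase d e k (y / d) * e + y % d

theorem mod_mul_add_mod_lt {a : ℕ} (ha : 0 < a) (s u : ℕ) : s % a * a + u % a < a * a := by
  have h₁ := Nat.mod_lt s ha
  have h₂ := Nat.mod_lt u ha
  nlinarith

theorem pairCode_lt {a : ℕ} (ha : 0 < a) (k s u : ℕ) : pairCode a k s u < (a * a) ^ k := by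
  induction k generalizing s u with
  | zero => simp [pairCode]
  | succ k ih =>
    have := mod_mul_add_mod_lt ha s u
    have := ih (s / a) (u / a)
    rw [pairCode, pow_succ]
    nlinarith

theorem rebase_lt {d e : ℕ} (hd : 0 < d) (hde : d ≤ e) (k y : ℕ) : rebase d e k y < e ^ k := by
  induction k generalizing y with
  | zero => simp [rebase]
  | succ k ih =>
    have := Nat.mod_lt y hd
    have := ih (y / d)
    rw [rebase, pow_succ]
    nlinarith

/-- The interleaving of row and column digits makes the `k`-th power of the tensor for `a × a`
matrices the tensor for `a ^ k × a ^ k` matrices: equality of indices is equality of all digits. -/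
theorem tensorPow_matMulTensor {S : Type*} [CommRing S] {a : ℕ} (ha : 0 < a) (k : ℕ) {s u u' v s' v' : ℕ} (hs : s < a ^ k)
    (hu : u < a ^ k) (hu' : u' < a ^ k) (hv : v < a ^ k) (hs' : s' < a ^ k) (hv' : v' < a ^ k) :
    tensorPow (fun x y z => (matMulTensor a x y z : S)) (a * a) (a * a) k (pairCode a k s u) (pairCode a k u' v) (pairCode a k s' v') =
      if s = s' ∧ u = u' ∧ v = v' then 1 else 0 := by
  induction k generalizing s u u' v s' v' with
  | zero =>
    simp only [pow_zero, Nat.lt_one_iff] at *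
    simp [tensorPow, *]
  | succ k ih =>
    have hlt : ∀ {x : ℕ}, x < a ^ (k + 1) → x / a < a ^ k := fun hx =>
      Nat.div_lt_of_lt_mul (by rwa [pow_succ'] at hx)
    have hext : ∀ x y : ℕ, x = y ↔ x % a = y % a ∧ x / a = y / a := fun x y =>
      ⟨by rintro rfl; simp, fun h => by rw [← Nat.div_add_mod x a, ← Nat.div_add_mod y a, h.1, h.2]⟩
    rw [tensorPow, pairCode, pairCode, pairCode]
    simp only [mul_add_mod_of_lt_right (mod_mul_add_mod_lt ha _ _),
      mul_add_div_of_lt_right (mod_mul_add_mod_lt ha _ _)]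
    rw [ih (hlt hs) (hlt hu) (hlt hu') (hlt hv) (hlt hs') (hlt hv')]
    simp only [matMulTensor, mul_add_mod_of_lt_right (Nat.mod_lt _ ha),
      mul_add_div_of_lt_right (Nat.mod_lt _ ha)]
    have hiff : (s = s' ∧ u = u' ∧ v = v') ↔ (s % a = s' % a ∧ u % a = u' % a ∧ v % a = v' % a) ∧
        s / a = s' / a ∧ u / a = u' / a ∧ v / a = v' / a := by
      rw [hext s s', hext u u', hext v v']
      tauto
    simp only [hiff]
    by_cases h₁ : s % a = s' % a ∧ u % a = u' % a ∧ v % a = v' % a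
    · simp [h₁]
    · simp [h₁]

/-- The structure constants of the product of polynomials, scaled by `D`. -/
def polyMulTensor (D : ℤ) (x y z : ℕ) : ℤ := if x + y = z then D else 0

/-- The power multiplies polynomials in `k` variables, whose exponents are the digits. Sums of two
base `d` digits are less than `2 d - 1`, so in base `2 d - 1` exponents are added without carries.
-/
theorem tensorPow_polyMulTensor {S : Type*} [CommRing S] (D : ℤ) {d e : ℕ} (hd : 0 < d) (he : e = 2 * d - 1) (k : ℕ) {x y z : ℕ}
    (hx : x < d ^ k) (hy : y < d ^ k) (hz : z < e ^ k) :
    tensorPow (fun x y z => (polyMulTensor D x y z : S)) d e k x y z =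
      if rebase d e k x + rebase d e k y = z then (D : S) ^ k else 0 := by
  induction k generalizing x y z with
  | zero =>
    simp only [pow_zero, Nat.lt_one_iff] at *
    simp [tensorPow, rebase, *]
  | succ k ih =>
    have hlt : ∀ {c x : ℕ}, x < c ^ (k + 1) → x / c < c ^ k := fun hx =>
      Nat.div_lt_of_lt_mul (by rwa [pow_succ'] at hx)
    have h₁ := Nat.mod_lt x hd
    have h₂ := Nat.mod_lt y hd
    have h₃ : x % d + y % d < e := by omega
    rw [tensorPow, ih (hlt hx) (hlt hy) (hlt hz), rebase, rebase]
    have e₁ : rebase d e k (x / d) * e + x % d + (rebase d e k (y / d) * e + y % d) =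
      (rebase d e k (x / d) + rebase d e k (y / d)) * e + (x % d + y % d) := by ring
    rw [e₁, polyMulTensor]
    by_cases hz' : (rebase d e k (x / d) + rebase d e k (y / d)) * e + (x % d + y % d) = z
    · rw [if_pos hz']
      have h₄ := mul_add_mod_of_lt_right (a := rebase d e k (x / d) + rebase d e k (y / d)) h₃
      have h₅ := mul_add_div_of_lt_right (a := rebase d e k (x / d) + rebase d e k (y / d)) h₃
      rw [hz'] at h₄ h₅
      rw [if_pos h₄.symm, if_pos h₅.symm, pow_succ']
    · rw [if_neg hz']
      by_cases h₄ : x % d + y % d = z % e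
      · rw [if_neg (c := rebase d e k (x / d) + rebase d e k (y / d) = z / e), mul_zero]
        intro h₅
        apply hz'
        rw [h₄, h₅, mul_comm, Nat.div_add_mod]
      · simp [h₄]

/-- The value in base `d` of the digits in base `e` is additive on sums without carries. -/
theorem rebase_rebase_add {d e : ℕ} (hd : 0 < d) (he : e = 2 * d - 1) (k : ℕ) {x y : ℕ}
    (hx : x < d ^ k) (hy : y < d ^ k) :
    rebase e d k (rebase d e k x + rebase d e k y) = x + y := by
  induction k generalizing x y with
  | zero =>
    simp only [pow_zero, Nat.lt_one_iff] at *
    simp [rebase, *]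
  | succ k ih =>
    have hlt : ∀ {c x : ℕ}, x < c ^ (k + 1) → x / c < c ^ k := fun hx =>
      Nat.div_lt_of_lt_mul (by rwa [pow_succ'] at hx)
    have h₁ := Nat.mod_lt x hd
    have h₂ := Nat.mod_lt y hd
    have h₃ : x % d + y % d < e := by omega
    have e₁ : rebase d e (k + 1) x + rebase d e (k + 1) y =
      (rebase d e k (x / d) + rebase d e k (y / d)) * e + (x % d + y % d) := by
      simp only [rebase]; ring
    rw [e₁, rebase, mul_add_mod_of_lt_right h₃, mul_add_div_of_lt_right h₃, ih (hlt hx) (hlt hy)]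
    have h₄ := Nat.div_add_mod x d
    have h₅ := Nat.div_add_mod y d
    linarith

/-- Evaluation at `0, …, 2 d - 2`, pointwise multiplication, interpolation. The adjugate of the
Vandermonde matrix replaces the inverse in order to stay over `ℤ`; one more factor `A.det` makes the
scale the positive number `A.det ^ 2`. -/
theorem exists_polyMul_isScheme (d : ℕ) :
    ∃ D : ℕ, 0 < D ∧ ∃ U V W, IsScheme (2 * d - 1) d (2 * d - 1) (polyMulTensor D) U V W := by
  set e := 2 * d - 1 with he
  let A : Matrix (Fin e) (Fin e) ℤ := Matrix.vandermonde fun i => (i : ℤ)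
  have hA : A.det ≠ 0 := by
    rw [Matrix.det_vandermonde_ne_zero_iff]
    intro i j h
    simpa [Fin.ext_iff] using h
  refine ⟨(A.det ^ 2).natAbs, Int.natAbs_pos.2 (pow_ne_zero 2 hA), fun p x => (p : ℤ) ^ x, fun p x => (p : ℤ) ^ x,
    fun z p => if h : z < e ∧ p < e then A.det * A.adjugate ⟨z, h.1⟩ ⟨p, h.2⟩ else 0, ?_⟩
  intro x hx y hy z hz
  have h₁ := congrFun (congrFun A.adjugate_mul ⟨z, hz⟩) ⟨x + y, by omega⟩
  rw [Matrix.mul_apply, Matrix.smul_apply, Matrix.one_apply] at h₁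
  rw [polyMulTensor, Int.natAbs_of_nonneg (sq_nonneg _), Finset.sum_range]
  simp only [Fin.is_lt, hz, and_self, dif_pos, Fin.eta]
  calc _ = A.det * ∑ j, A.adjugate ⟨z, hz⟩ j * A j ⟨x + y, by omega⟩ := by
        rw [Finset.mul_sum]
        refine Finset.sum_congr rfl fun j _ => ?_
        simp only [A, Matrix.vandermonde_apply, pow_add]
        ring
    _ = _ := by
      rw [h₁]
      simp only [Fin.ext_iff, smul_eq_mul, eq_comm (a := z)]
      split_ifs <;> ring

/-! ### Sorted adjacency lists -/

/-- For every `u < n`, the cells `u * n + q` with `q < deg u` of `adj` list the neighbours of `u` by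
increasing weight of the edge. -/
structure IsSortedAdj (n : ℕ) (w : ℕ → ℕ → ℕ) (deg adj : ℕ → ℕ) : Prop where
  lt : ∀ u < n, ∀ q < deg u, adj (u * n + q) < n
  weight_ne : ∀ u < n, ∀ q < deg u, w u (adj (u * n + q)) ≠ 0
  mono : ∀ u < n, ∀ q q', q < q' → q' < deg u → w u (adj (u * n + q)) ≤ w u (adj (u * n + q'))
  inj : ∀ u < n, ∀ q < deg u, ∀ q' < deg u, adj (u * n + q) = adj (u * n + q') → q = q'
  surj : ∀ u < n, ∀ v < n, w u v ≠ 0 → ∃ q < deg u, adj (u * n + q) = v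

/-! ### Arithmetic of row-by-row indices -/

theorem mul_add_lt_sq {n u v : ℕ} (hu : u < n) (hv : v < n) : u * n + v < n * n := by nlinarith

theorem div_lt_of_lt_sq {n x : ℕ} (h : x < n * n) : x / n < n := Nat.div_lt_of_lt_mul h

theorem mod_lt_of_lt_sq {n x : ℕ} (h : x < n * n) : x % n < n :=
  Nat.mod_lt _ (Nat.pos_of_ne_zero (by rintro rfl; simp at h))

theorem div_mul_add_mod (n x : ℕ) : x / n * n + x % n = x := Nat.div_add_mod' x n

theorem mul_add_inj {n u v u' v' : ℕ} (hv : v < n) (hv' : v' < n) :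
    u * n + v = u' * n + v' ↔ u = u' ∧ v = v' := by
  constructor
  · intro h
    have h₁ := mul_add_div_of_lt_right (a := u) hv
    have h₂ := mul_add_mod_of_lt_right (a := u) hv
    rw [h, mul_add_div_of_lt_right hv'] at h₁
    rw [h, mul_add_mod_of_lt_right hv'] at h₂
    exact ⟨h₁.symm, h₂.symm⟩
  · rintro ⟨rfl, rfl⟩; rfl

/-- The position of an edge in the order by weight. -/
def edgeKey (n : ℕ) (w : ℕ → ℕ → ℕ) (u v : ℕ) : ℕ := (w u v - 1) * (n * n) + (u * n + v)

/-- The adjacency lists of the edges whose key is less than `j`. -/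
structure IsPartialAdj (n : ℕ) (w : ℕ → ℕ → ℕ) (deg adj : ℕ → ℕ) (j : ℕ) : Prop where
  lt : ∀ u < n, ∀ q < deg u, adj (u * n + q) < n ∧ w u (adj (u * n + q)) ≠ 0 ∧
    edgeKey n w u (adj (u * n + q)) < j
  mono : ∀ u < n, ∀ q q', q < q' → q' < deg u →
    edgeKey n w u (adj (u * n + q)) < edgeKey n w u (adj (u * n + q'))
  surj : ∀ u < n, ∀ v < n, w u v ≠ 0 → edgeKey n w u v < j → ∃ q < deg u, adj (u * n + q) = v

/-! ### Insertion of edges in the order of their keys -/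

namespace IsPartialAdj

variable {n : ℕ} {w : ℕ → ℕ → ℕ} {deg adj : ℕ → ℕ} {j : ℕ}

theorem inj (h : IsPartialAdj n w deg adj j) : ∀ u < n, ∀ q < deg u, ∀ q' < deg u,
    adj (u * n + q) = adj (u * n + q') → q = q' := by
  intro u hu q hq q' hq' he
  by_contra hne
  rcases lt_or_gt_of_ne hne with hlt | hlt
  · have := h.mono u hu q q' hlt hq'
    rw [he] at this
    omega
  · have := h.mono u hu q' q hlt hq
    rw [he] at this
    omega

/-- The neighbour `v`, whose key is `j`, has not been listed yet, so there is room for it in row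
`u`. -/
theorem deg_lt (h : IsPartialAdj n w deg adj j) {u v : ℕ} (hu : u < n) (hv : v < n)
    (hj : edgeKey n w u v = j) : deg u < n := by
  have h₁ := Finset.card_le_card_of_injOn (s := Finset.range (deg u)) (t := (Finset.range n).erase v)
    (fun q => adj (u * n + q)) (fun q hq => ?_) (fun q hq q' hq' he => ?_)
  · rw [Finset.card_erase_of_mem (by simpa using hv), Finset.card_range, Finset.card_range] at h₁
    omega
  · have h₂ := h.lt u hu q (by simpa using hq)
    simp only [Finset.coe_erase, Finset.coe_range, Set.mem_sdiff, Set.mem_Iio, Set.mem_singleton_iff]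
    refine ⟨h₂.1, fun he => ?_⟩
    rw [he] at h₂
    omega
  · exact h.inj u hu q (by simpa using hq) q' (by simpa using hq') he

theorem step (h : IsPartialAdj n w deg adj j) {u v : ℕ} (hu : u < n) (hv : v < n)
    (hw : w u v = j / (n * n) + 1) (hc : j % (n * n) = u * n + v) :
    IsPartialAdj n w (Function.update deg u (deg u + 1))
      (Function.update adj (u * n + deg u) v) (j + 1) := by
  have hj : edgeKey n w u v = j := by
    rw [edgeKey, hw, Nat.add_sub_cancel, ← hc, mul_comm, Nat.div_add_mod]
  have hd := h.deg_lt hu hv hj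
  have hadj : ∀ u' < n, ∀ q < deg u', q < n →
      Function.update adj (u * n + deg u) v (u' * n + q) = adj (u' * n + q) := by
    intro u' _ q hq hqn
    rw [Function.update_apply, if_neg]
    rw [mul_add_inj hqn hd]
    rintro ⟨rfl, rfl⟩
    omega
  have hdeg : ∀ u' < n, deg u' ≤ n := by
    intro u' hu'
    have h₁ := Finset.card_le_card_of_injOn (s := Finset.range (deg u')) (t := Finset.range n)
      (fun q => adj (u' * n + q)) (fun q hq => by simpa using (h.lt u' hu' q (by simpa using hq)).1)
      (fun q hq q' hq' he => h.inj u' hu' q (by simpa using hq) q' (by simpa using hq') he)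
    simpa using h₁
  refine ⟨fun u' hu' q hq => ?_, fun u' hu' q q' hlt hq' => ?_, fun u' hu' v' hv' hw' hk => ?_⟩
  · by_cases hnew : u' = u ∧ q = deg u
    · obtain ⟨h₁, h₂⟩ := hnew
      subst h₁ h₂
      rw [Function.update_self]
      exact ⟨hv, by rw [hw]; exact Nat.succ_ne_zero _, by rw [hj]; exact Nat.lt_succ_self j⟩
    · have hq₁ : q < deg u' := by
        rw [Function.update_apply] at hq
        split_ifs at hq with he
        · subst he; omega
        · exact hq
      rw [hadj u' hu' q hq₁ (hq₁.trans_le (hdeg u' hu'))]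
      have := h.lt u' hu' q hq₁
      omega
  · have hq₁ : q < deg u' := by
      rw [Function.update_apply] at hq'
      split_ifs at hq' with he
      · subst he; omega
      · omega
    rw [hadj u' hu' q hq₁ (hq₁.trans_le (hdeg u' hu'))]
    by_cases hnew : u' = u ∧ q' = deg u
    · obtain ⟨rfl, rfl⟩ := hnew
      rw [Function.update_self, hj]
      exact (h.lt u' hu' q hq₁).2.2
    · have hq₂ : q' < deg u' := by
        rw [Function.update_apply] at hq'
        split_ifs at hq' with he
        · subst he; omega
        · exact hq'
      rw [hadj u' hu' q' hq₂ (hq₂.trans_le (hdeg u' hu'))]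
      exact h.mono u' hu' q q' hlt hq₂
  · by_cases hnew : u' = u ∧ v' = v
    · obtain ⟨rfl, rfl⟩ := hnew
      exact ⟨deg u', by simp, by simp⟩
    · have hk' : edgeKey n w u' v' ≠ j := by
        intro he
        have h₁ : j % (n * n) = u' * n + v' := by
          rw [← he, edgeKey, mul_add_mod_of_lt_right (mul_add_lt_sq hu' hv')]
        rw [hc, mul_add_inj hv hv'] at h₁
        exact hnew ⟨h₁.1.symm, h₁.2.symm⟩
      obtain ⟨q, hq, he⟩ := h.surj u' hu' v' hv' hw' (by omega)
      refine ⟨q, ?_, ?_⟩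
      · rw [Function.update_apply]
        split_ifs with h'
        · subst h'; omega
        · exact hq
      · rw [hadj u' hu' q hq (hq.trans_le (hdeg u' hu')), he]

theorem step_of_ne (h : IsPartialAdj n w deg adj j) (hne : ∀ u < n, ∀ v < n, w u v ≠ 0 →
    edgeKey n w u v ≠ j) : IsPartialAdj n w deg adj (j + 1) := by
  refine ⟨fun u hu q hq => ?_, h.mono, fun u hu v hv hw hk => ?_⟩
  · have := h.lt u hu q hq
    omega
  · have := hne u hu v hv hw
    exact h.surj u hu v hv hw (by omega)

theorem isSortedAdj {M : ℕ} (h : IsPartialAdj n w deg adj (M * (n * n)))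
    (hM : ∀ u < n, ∀ v < n, w u v ≤ M) : IsSortedAdj n w deg adj := by
  refine ⟨fun u hu q hq => (h.lt u hu q hq).1, fun u hu q hq => (h.lt u hu q hq).2.1,
    fun u hu q q' hlt hq' => ?_, h.inj, fun u hu v hv hw => h.surj u hu v hv hw ?_⟩
  · have h₁ := h.mono u hu q q' hlt hq'
    have h₂ := h.lt u hu q' hq'
    have h₃ := h.lt u hu q (hlt.trans hq')
    by_contra! hcon
    -- A weight that is larger by one raises the key by `n * n`, which the cell number cannot make
    -- up for.
    have h₄ : w u (adj (u * n + q')) - 1 + 1 ≤ w u (adj (u * n + q)) - 1 := by omega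
    have h₅ := Nat.mul_le_mul_right (n * n) h₄
    have h₆ := mul_add_lt_sq hu h₂.1
    simp only [edgeKey] at h₁
    rw [add_mul, one_mul] at h₅
    omega
  · have h₁ := hM u hu v hv
    have h₂ := mul_add_lt_sq hu hv
    have h₃ : w u v - 1 + 1 ≤ M := by omega
    have h₄ := Nat.mul_le_mul_right (n * n) h₃
    rw [add_mul, one_mul] at h₄
    rw [edgeKey]
    omega

end IsPartialAdj

open WordExpr WordProg

/-- Append an edge to the adjacency lists, if its weight is the current one. -/
def sortAdjBody : WordProg :=
  let c := reg 2 % (reg 0 * reg 0)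
  let u := c / reg 0
  .ite ((load 0 c).eq (reg 2 / (reg 0 * reg 0) + const 1))
    (.seq (.store 2 (u * reg 0 + load 3 u) (c % reg 0)) (.store 3 u (load 3 u + const 1)))
    .skip

/-- Compute the sorted adjacency lists: array `2` holds the lists and array `3` the degrees. -/
def sortAdjProg : WordProg := forLoop 2 (reg 1 * (reg 0 * reg 0)) sortAdjBody

/-- A bucket sort that scans the matrix once for each weight: step `j` inspects cell `j % (n * n)`
for weight `j / (n * n) + 1`, so an edge is met exactly when `j` is its key. -/
theorem sortAdjProg_spec : ∃ c, ∀ {K n M : ℕ} {s : WordState}, s.reg 0 = n → s.reg 1 = M →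
    M * (n * n) ≤ K → n ≤ K → (s.arr 3 = fun _ => 0) →
    (∀ u < n, ∀ v < n, s.arr 0 (u * n + v) ≤ M) →
    Ensures K sortAdjProg s (c * (M * (n * n) + 1))
      (fun s' => IsSortedAdj n (fun u v => s.arr 0 (u * n + v)) (s'.arr 3) (s'.arr 2)) := by
  refine ⟨_, fun {K n M s} hn hM hK hnK hdeg hw => (Ensures.forLoop (T := sortAdjBody.cost) (fun j s' =>
    IsPartialAdj n (fun u v => s.arr 0 (u * n + v)) (s'.arr 3) (s'.arr 2) j) hK rfl
    ?_ ?_ ?_).mono le_rfl fun s' _ h => h.isSortedAdj hw⟩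
  · intro s' hf
    simp [hf.1 0 rfl, hf.1 1 rfl, hn, hM]
  · simp only [WordState.setReg_arr, hdeg]
    exact ⟨by simp, by simp, by simp⟩
  · intro j s' hj hf hi hI
    apply Ensures.of_wp
    have h0 : s'.reg 0 = n := (hf.1 0 rfl).trans hn
    have hA : s'.arr 0 = s.arr 0 := hf.2 0 rfl
    have hpos : 0 < n * n := Nat.pos_of_ne_zero (by rintro h; simp [h] at hj)
    have hc := Nat.mod_lt j hpos
    simp [sortAdjBody, wp, h0, hi, hA]
    have hn₀ : 0 < n := Nat.pos_of_mul_pos_left hpos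
    have hu := div_lt_of_lt_sq hc
    have hv := Nat.mod_lt j hn₀
    have hjv : j % (n * n) % n = j % n := Nat.mod_mod_of_dvd _ (Dvd.intro _ rfl)
    refine ⟨fun h => ?_, fun h => hI.step_of_ne fun u hu v hv hw' he => h ?_⟩
    · have hcell : j % (n * n) = j % (n * n) / n * n + j % n := by
        rw [← hjv, div_mul_add_mod]
      have hW : s.arr 0 (j % (n * n) / n * n + j % n) = j / (n * n) + 1 := by rw [← hcell, h]
      refine ⟨by omega, ?_, hI.step hu hv hW hcell⟩
      have hkey : edgeKey n (fun u v => s.arr 0 (u * n + v)) (j % (n * n) / n) (j % n) = j := by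
        rw [edgeKey, hW, Nat.add_sub_cancel, ← hcell, Nat.div_add_mod']
      exact (hI.deg_lt hu hv hkey).trans_le hnK
    · rw [edgeKey] at he
      have h₁ := mul_add_mod_of_lt_right (a := s.arr 0 (u * n + v) - 1) (mul_add_lt_sq hu hv)
      have h₂ := mul_add_div_of_lt_right (a := s.arr 0 (u * n + v) - 1) (mul_add_lt_sq hu hv)
      rw [he] at h₁ h₂
      rw [h₁, h₂]
      omega

/-! ### Simultaneous exploration from all sources

The pair of a source `s` and a vertex `v` is encoded as `s * n + v`. The queue `Q` lists the labelled
pairs in the order of their labels. At radius `r`, the edges of length `r` from the source are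
explored, by going through the part of the queue from position `lo`, where `idx` is the current
position; `ptr` points to the next edge to be explored. -/

/-- The function of two arguments that is stored row by row. -/
def tableOf (n : ℕ) (f : ℕ → ℕ) (s v : ℕ) : ℕ := f (s * n + v)

/-- The invariant of the exploration. -/
structure ExploreInv (n M : ℕ) (w : ℕ → ℕ → ℕ) (deg adj lab par dep ptr Q : ℕ → ℕ)
    (r idx lo hi : ℕ) : Prop where
  queue_lt : ∀ j < hi, Q j < n * n ∧ lab (Q j) ≠ 0
  queue_surj : ∀ x < n * n, lab x ≠ 0 → ∃ j < hi, Q j = x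
  queue_inj : ∀ j < hi, ∀ j' < hi, Q j = Q j' → j = j'
  lab_le : ∀ x < n * n, lab x ≤ r + 1
  queue_mono : ∀ j j', j < j' → j' < hi → lab (Q j) ≤ lab (Q j')
  forest : IsForest n w (tableOf n lab) (tableOf n par) (tableOf n dep)
  explored : ∀ s < n, ∀ u < n, ∀ q < ptr (s * n + u), q < deg u ∧
    lab (s * n + adj (u * n + q)) ≠ 0 ∧
    lab (s * n + adj (u * n + q)) ≤ lab (s * n + u) + w u (adj (u * n + q)) ∧
    IsTreeEdge (tableOf n par) s u (adj (u * n + q))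
  ptr_eq_zero : ∀ x < n * n, lab x = 0 → ptr x = 0
  pending : ∀ j < hi, ∀ q, ptr (Q j) ≤ q → q < deg (Q j % n) →
    r + 1 ≤ lab (Q j) + w (Q j % n) (adj (Q j % n * n + q)) ∧
    (j < idx → r + 1 < lab (Q j) + w (Q j % n) (adj (Q j % n * n + q)))
  lo_le : lo ≤ idx
  idx_le : idx ≤ hi
  window : ∀ j < hi, lo ≤ j → r + 1 ≤ lab (Q j) + M ∧ (j < idx → r + 1 < lab (Q j) + M)
  finished : ∀ j < lo, deg (Q j % n) ≤ ptr (Q j)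

/-- `vis x` bounds the number of times that the pair `x` has been passed in the queue. -/
structure VisitInv (n M : ℕ) (lab Q : ℕ → ℕ) (r idx hi : ℕ) (vis : ℕ → ℕ) : Prop where
  le : ∀ x < n * n, vis x ≤ M + 1
  add_le : ∀ j < hi, vis (Q j) + lab (Q j) ≤ r + 1 + if j < idx then 1 else 0
  eq_zero : ∀ x < n * n, lab x = 0 → vis x = 0

theorem sum_range_update_succ {N x : ℕ} (f : ℕ → ℕ) (hx : x < N) :
    ∑ y ∈ Finset.range N, Function.update f x (f x + 1) y = ∑ y ∈ Finset.range N, f y + 1 := by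
  rw [Finset.sum_update_of_mem (Finset.mem_range.2 hx),
    ← Finset.add_sum_erase _ _ (Finset.mem_range.2 hx), Finset.sdiff_singleton_eq_erase]
  ring

/-! ### Preservation of the exploration invariant -/

namespace ExploreInv

variable {n M : ℕ} {w : ℕ → ℕ → ℕ} {deg adj lab par dep ptr Q : ℕ → ℕ} {r idx lo hi : ℕ}
  {vis : ℕ → ℕ}

theorem hi_le (h : ExploreInv n M w deg adj lab par dep ptr Q r idx lo hi) : hi ≤ n * n := by
  have := Finset.card_le_card_of_injOn (s := Finset.range hi) (t := Finset.range (n * n)) Q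
    (fun j hj => by simpa using (h.queue_lt j (by simpa using hj)).1)
    (fun j hj j' hj' he => h.queue_inj j (by simpa using hj) j' (by simpa using hj') he)
  simpa using this

/-- Explored edges are tree edges. One that leads to a child is encoded by the cell of the child
(even codes), one that leads to the parent by the cell it starts from (odd codes). As parents are
unique, this is injective. -/
theorem sum_ptr_le (h : ExploreInv n M w deg adj lab par dep ptr Q r idx lo hi)
    (hA : IsSortedAdj n w deg adj) : ∑ x ∈ Finset.range (n * n), ptr x ≤ 2 * (n * n) := by
  have h₁ := Finset.card_le_card_of_injOn
    (s := (Finset.range (n * n)).sigma fun x => Finset.range (ptr x))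
    (t := Finset.range (2 * (n * n)))
    (fun y => if par (y.1 / n * n + adj (y.1 % n * n + y.2)) = y.1 % n then
      2 * (y.1 / n * n + adj (y.1 % n * n + y.2)) else 2 * y.1 + 1) ?_ ?_
  · simpa [Finset.card_sigma] using h₁
  · rintro ⟨x, q⟩ hx
    simp only [Finset.coe_sigma, Finset.coe_range, Set.mem_sigma_iff, Set.mem_Iio] at hx ⊢
    have hx₁ := div_lt_of_lt_sq hx.1
    have hx₂ := mod_lt_of_lt_sq hx.1
    have h₂ := h.explored _ hx₁ _ hx₂ q (by rw [div_mul_add_mod]; exact hx.2)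
    have h₃ := hA.lt _ hx₂ q h₂.1
    have h₄ := mul_add_lt_sq hx₁ h₃
    split_ifs <;> omega
  · rintro ⟨x, q⟩ hx ⟨x', q'⟩ hx' he
    simp only [Finset.coe_sigma, Finset.coe_range, Set.mem_sigma_iff, Set.mem_Iio] at hx hx' he
    have a₁ := div_lt_of_lt_sq hx.1
    have a₂ := mod_lt_of_lt_sq hx.1
    have b₁ := div_lt_of_lt_sq hx'.1
    have b₂ := mod_lt_of_lt_sq hx'.1
    obtain ⟨a₃, -, -, a₄⟩ := h.explored _ a₁ _ a₂ q (by rw [div_mul_add_mod]; exact hx.2)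
    obtain ⟨b₃, -, -, b₄⟩ := h.explored _ b₁ _ b₂ q' (by rw [div_mul_add_mod]; exact hx'.2)
    have a₅ := hA.lt _ a₂ q a₃
    have b₅ := hA.lt _ b₂ q' b₃
    simp only [IsTreeEdge, tableOf, div_mul_add_mod] at a₄ b₄
    have key : x = x' ∧ adj (x % n * n + q) = adj (x' % n * n + q') := by
      split_ifs at he with h₁ h₂ h₂
      · have h₃ := (mul_add_inj (u := x / n) (u' := x' / n) a₅ b₅).1 (by omega)
        refine ⟨?_, h₃.2⟩
        rw [← div_mul_add_mod n x, ← div_mul_add_mod n x', h₃.1, ← h₁, ← h₂, h₃.1, h₃.2]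
      · omega
      · omega
      · have h₃ : x = x' := by omega
        subst h₃
        refine ⟨rfl, ?_⟩
        rw [← a₄.resolve_right h₁, ← b₄.resolve_right h₂]
    obtain ⟨rfl, h₂⟩ := key
    have := hA.inj _ a₂ q a₃ q' b₃ h₂
    subst this
    rfl

theorem isExplored (h : ExploreInv n M w deg adj lab par dep ptr Q r idx lo hi)
    (hA : IsSortedAdj n w deg adj) : IsExplored n w (tableOf n lab) (tableOf n par) r := by
  intro s hs u hu v hv hl hw hr
  obtain ⟨q, hq, rfl⟩ := hA.surj u hu v hv hw
  refine (h.explored s hs u hu q ?_).2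
  by_contra hcon
  obtain ⟨j, hj, hx⟩ := h.queue_surj _ (mul_add_lt_sq hs hu) hl
  have hmod := mul_add_mod_of_lt_right (a := s) hu
  have := (h.pending j hj q (by rw [hx]; omega) (by rwa [hx, hmod])).1
  rw [hx, hmod] at this
  simp only [tableOf] at hr
  omega

/-- At the end of the queue every pair has been passed, so pending edges are longer than `r + 1`.
Pairs before `lo` have exhausted their lists and need not be visited again. -/
theorem nextRadius (h : ExploreInv n M w deg adj lab par dep ptr Q r hi lo hi) :
    ExploreInv n M w deg adj lab par dep ptr Q (r + 1) lo lo hi where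
  __ := h
  lab_le x hx := (h.lab_le x hx).trans (by omega)
  pending j hj q h₁ h₂ := by
    have h₃ := (h.pending j hj q h₁ h₂).2 hj
    refine ⟨h₃, fun h₄ => ?_⟩
    have := h.finished j h₄
    omega
  lo_le := le_rfl
  idx_le := h.lo_le
  window j hj h₁ := ⟨(h.window j hj h₁).2 hj, fun h₂ => by omega⟩

/-- Lists are sorted by weight, so if the next edge is not due, none is. Once `lab + M ≤ r + 1` for
the current pair, any edge left would have been due by now; the same holds for all earlier pairs,
whose labels are no larger, so `lo` can move past them. -/
theorem advance (h : ExploreInv n M w deg adj lab par dep ptr Q r idx lo hi)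
    (hA : IsSortedAdj n w deg adj) (hM : ∀ u < n, ∀ v < n, w u v ≤ M) (hi' : idx < hi)
    (hne : ptr (Q idx) < deg (Q idx % n) →
      lab (Q idx) + w (Q idx % n) (adj (Q idx % n * n + ptr (Q idx))) ≠ r + 1) :
    ExploreInv n M w deg adj lab par dep ptr Q r (idx + 1)
      (if lab (Q idx) + M < r + 2 then idx + 1 else lo) hi := by
  have hu := mod_lt_of_lt_sq (h.queue_lt idx hi').1
  have hgt : ∀ q, ptr (Q idx) ≤ q → q < deg (Q idx % n) →
      r + 1 < lab (Q idx) + w (Q idx % n) (adj (Q idx % n * n + q)) := by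
    intro q h₁ h₂
    have h₃ := (h.pending idx hi' _ le_rfl (h₁.trans_lt h₂)).1
    have h₄ := hne (h₁.trans_lt h₂)
    rcases h₁.eq_or_lt with rfl | h₁
    · omega
    · have := hA.mono _ hu _ q h₁ h₂
      omega
  have hwin := h.window
  have hlo := h.lo_le
  exact
  { h with
    pending := fun j hj q h₁ h₂ => by
      have h₃ := h.pending j hj q h₁ h₂
      refine ⟨h₃.1, fun h₄ => ?_⟩
      rcases Nat.lt_succ_iff_lt_or_eq.1 h₄ with h₅ | rfl
      · exact h₃.2 h₅
      · exact hgt q h₁ h₂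
    lo_le := by split_ifs <;> omega
    idx_le := hi'
    window := fun j hj h₁ => by
      split_ifs at h₁ with h₂
      · exact ⟨(hwin j hj (by omega)).1, fun h₃ => by omega⟩
      · refine ⟨(hwin j hj h₁).1, fun h₃ => ?_⟩
        rcases Nat.lt_succ_iff_lt_or_eq.1 h₃ with h₅ | rfl
        · exact (hwin j hj h₁).2 h₅
        · omega
    finished := fun j hj => by
      split_ifs at hj with h₂
      · by_contra! hcon
        have h₃ := h.queue_lt j (by omega)
        have h₄ := mod_lt_of_lt_sq h₃.1
        have h₅ := hM _ h₄ _ (hA.lt _ h₄ _ hcon)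
        have h₆ : lab (Q j) ≤ lab (Q idx) := by
          rcases Nat.lt_succ_iff_lt_or_eq.1 hj with h₆ | rfl
          · exact h.queue_mono j idx h₆ hi'
          · exact le_rfl
        rcases Nat.lt_succ_iff_lt_or_eq.1 hj with h₇ | rfl
        · have := (h.pending j (by omega) _ le_rfl hcon).2 h₇
          omega
        · have := hgt _ le_rfl hcon
          omega
      · exact h.finished j hj }

/-- A pair is passed at most once per radius, and only at radii from its label minus one up to its
label plus `M - 1`. -/
theorem visit (h : ExploreInv n M w deg adj lab par dep ptr Q r idx lo hi)
    (hv : VisitInv n M lab Q r idx hi vis) (hi' : idx < hi) :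
    VisitInv n M lab Q r (idx + 1) hi (Function.update vis (Q idx) (vis (Q idx) + 1)) := by
  have h₁ := hv.add_le idx hi'
  have h₂ := (h.window idx hi' h.lo_le).1
  rw [if_neg (by omega)] at h₁
  refine ⟨fun x hx => ?_, fun j hj => ?_, fun x hx hl => ?_⟩
  · rw [Function.update_apply]
    split_ifs with h₃
    · omega
    · exact hv.le x hx
  · rw [Function.update_apply]
    split_ifs with h₃ h₄ h₄
    · have := h.queue_inj j hj idx hi' h₃
      subst this
      omega
    · have := h.queue_inj j hj idx hi' h₃
      omega
    · have := hv.add_le j hj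
      split_ifs at this <;> omega
    · have := hv.add_le j hj
      rw [if_neg (by omega)] at this
      omega
  · rw [Function.update_apply, if_neg, hv.eq_zero x hx hl]
    rintro rfl
    exact (h.queue_lt idx hi').2 hl

/-- The due edge is a tree edge between labelled vertices. The bound for the label at its far end
holds because no label exceeds `r + 1`. -/
theorem pass (h : ExploreInv n M w deg adj lab par dep ptr Q r idx lo hi) (hi' : idx < hi)
    (hq : ptr (Q idx) < deg (Q idx % n))
    (hr : lab (Q idx) + w (Q idx % n) (adj (Q idx % n * n + ptr (Q idx))) = r + 1)
    (hz : lab (Q idx / n * n + adj (Q idx % n * n + ptr (Q idx))) ≠ 0)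
    (hzn : adj (Q idx % n * n + ptr (Q idx)) < n)
    (ht : IsTreeEdge (tableOf n par) (Q idx / n) (Q idx % n) (adj (Q idx % n * n + ptr (Q idx)))) :
    ExploreInv n M w deg adj lab par dep (Function.update ptr (Q idx) (ptr (Q idx) + 1)) Q
      r idx lo hi := by
  obtain ⟨hx, hl⟩ := h.queue_lt idx hi'
  have hs := div_lt_of_lt_sq hx
  have hu := mod_lt_of_lt_sq hx
  have hlo := h.lo_le
  exact
  { h with
    explored := fun s' hs' u' hu' q hq' => by
      by_cases hnew : s' * n + u' = Q idx ∧ q = ptr (Q idx)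
      · obtain ⟨h₁, rfl⟩ := hnew
        obtain ⟨rfl, rfl⟩ := (mul_add_inj hu' hu).1 (h₁.trans (div_mul_add_mod n (Q idx)).symm)
        refine ⟨hq, hz, ?_, ht⟩
        rw [div_mul_add_mod, hr]
        exact h.lab_le _ (mul_add_lt_sq hs hzn)
      · refine h.explored s' hs' u' hu' q ?_
        rw [Function.update_apply] at hq'
        split_ifs at hq' with h₁
        · rw [h₁]; omega
        · exact hq'
    ptr_eq_zero := fun x' hx' hl' => by
      rw [Function.update_apply, if_neg]
      · exact h.ptr_eq_zero x' hx' hl'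
      · rintro rfl; exact hl hl'
    pending := fun j hj q h₁ h₂ => by
      refine h.pending j hj q (le_trans ?_ h₁) h₂
      rw [Function.update_apply]
      split_ifs with h₃
      · rw [h₃]; omega
      · exact le_rfl
    finished := fun j hj => by
      refine (h.finished j hj).trans ?_
      rw [Function.update_apply]
      split_ifs with h₃
      · rw [h₃]; omega
      · exact le_rfl }

/-- The new label `r + 1` is the largest so far, so appending the pair keeps the queue sorted; the
position `idx` has not reached the new entry, so nothing strict is required of its edges. -/
theorem label (h : ExploreInv n M w deg adj lab par dep ptr Q r idx lo hi) (hi' : idx < hi)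
    {x u v z : ℕ} (hx : x = Q idx) (hu : u = x % n) (hz : z = x / n * n + v) (hv : v < n)
    (hq : ptr x < deg u) (hav : adj (u * n + ptr x) = v) (hw : w u v ≠ 0)
    (hr : lab x + w u v = r + 1) (hl : lab z = 0) :
    ExploreInv n M w deg adj (Function.update lab z (r + 1)) (Function.update par z u)
      (Function.update dep z (dep x + 1)) (Function.update ptr x (ptr x + 1))
      (Function.update Q hi z) r idx lo (hi + 1) := by
  obtain ⟨hxn, hxl⟩ := h.queue_lt idx hi'
  rw [← hx] at hxn hxl
  have hs := div_lt_of_lt_sq hxn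
  have hun : u < n := hu ▸ mod_lt_of_lt_sq hxn
  have hzn : z < n * n := hz ▸ mul_add_lt_sq hs hv
  have hxz : x ≠ z := by rintro rfl; exact hxl hl
  have hxe : x = x / n * n + u := by rw [hu, div_mul_add_mod]
  have hlab : ∀ y, lab y ≠ 0 → Function.update lab z (r + 1) y = lab y := fun y hy =>
    Function.update_of_ne (by rintro rfl; exact hy hl) _ _
  have hpar : ∀ y, lab y ≠ 0 → Function.update par z u y = par y := fun y hy =>
    Function.update_of_ne (by rintro rfl; exact hy hl) _ _
  have hdep : ∀ y, lab y ≠ 0 → Function.update dep z (dep x + 1) y = dep y := fun y hy =>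
    Function.update_of_ne (by rintro rfl; exact hy hl) _ _
  have hQ : ∀ j < hi, Function.update Q hi z j = Q j := fun j hj =>
    Function.update_of_ne hj.ne _ _
  have hptr : ∀ j < hi, Q j ≠ x → Function.update ptr x (ptr x + 1) (Q j) = ptr (Q j) := fun j hj hne =>
    Function.update_of_ne hne _ _
  have hself : ∀ s < n, lab (s * n + s) ≠ 0 := fun s hs => by
    have := h.forest.lab_self s hs
    simp only [tableOf] at this
    omega
  have hlo := h.lo_le
  have hptr_le : ∀ y, ptr y ≤ Function.update ptr x (ptr x + 1) y := fun y => by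
    rw [Function.update_apply]
    split_ifs with h₃
    · rw [h₃]; omega
    · exact le_rfl
  refine
  { queue_lt := fun j hj => ?_
    queue_surj := fun y hy hy' => ?_
    queue_inj := fun j hj j' hj' he => ?_
    lab_le := fun y hy => ?_
    queue_mono := fun j j' hlt hj' => ?_
    forest := ⟨fun s hs => ?_, fun s hs => ?_, fun s hs => ?_, fun s' hs' v' hv' hl' hne => ?_⟩
    explored := fun s' hs' u' hu' q hq' => ?_
    ptr_eq_zero := fun y hy hy' => ?_
    pending := fun j hj q h₁ h₂ => ?_
    lo_le := h.lo_le
    idx_le := by omega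
    window := fun j hj h₁ => ?_
    finished := fun j hj => ?_ }
  · rcases Nat.lt_succ_iff_lt_or_eq.1 hj with hj | rfl
    · have := h.queue_lt j hj
      rw [hQ j hj, hlab _ this.2]
      exact this
    · rw [Function.update_self, Function.update_self]
      exact ⟨hzn, by omega⟩
  · by_cases hyz : y = z
    · exact ⟨hi, by omega, by rw [Function.update_self, hyz]⟩
    · rw [Function.update_of_ne hyz] at hy'
      obtain ⟨j, hj, rfl⟩ := h.queue_surj y hy hy'
      exact ⟨j, by omega, hQ j hj⟩
  · rcases Nat.lt_succ_iff_lt_or_eq.1 hj with hj | rfl <;>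
      rcases Nat.lt_succ_iff_lt_or_eq.1 hj' with hj' | rfl
    · rw [hQ j hj, hQ j' hj'] at he
      exact h.queue_inj j hj j' hj' he
    · rw [hQ j hj, Function.update_self] at he
      exact absurd (he ▸ hl) (h.queue_lt j hj).2
    · rw [hQ j' hj', Function.update_self] at he
      exact absurd (he ▸ hl) (h.queue_lt j' hj').2
    · rfl
  · rw [Function.update_apply]
    split_ifs
    · exact le_rfl
    · exact h.lab_le y hy
  · have hj : j < hi := by omega
    rw [hQ j hj, hlab _ (h.queue_lt j hj).2]
    rcases Nat.lt_succ_iff_lt_or_eq.1 hj' with hj' | rfl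
    · rw [hQ j' hj', hlab _ (h.queue_lt j' hj').2]
      exact h.queue_mono j j' hlt hj'
    · rw [Function.update_self, Function.update_self]
      exact h.lab_le _ (h.queue_lt j hj).1
  · exact (hlab _ (hself s hs)).trans (h.forest.lab_self s hs)
  · exact (hpar _ (hself s hs)).trans (h.forest.par_self s hs)
  · exact (hdep _ (hself s hs)).trans (h.forest.dep_self s hs)
  · simp only [tableOf] at hl' ⊢
    by_cases hnew : s' * n + v' = z
    · obtain ⟨rfl, rfl⟩ := (mul_add_inj hv' hv).1 (hnew.trans hz)
      rw [hnew, Function.update_self, Function.update_self, Function.update_self, ← hxe, hlab x hxl,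
        hdep x hxl]
      exact ⟨hun, hxl, hw, hr.symm, rfl⟩
    · rw [Function.update_of_ne hnew] at hl'
      obtain ⟨h₁, h₂, h₃, h₄, h₅⟩ := h.forest.step s' hs' v' hv' hl' hne
      simp only [tableOf] at h₁ h₂ h₃ h₄ h₅
      rw [Function.update_of_ne hnew, Function.update_of_ne hnew, Function.update_of_ne hnew,
        hlab _ h₂, hdep _ h₂]
      exact ⟨h₁, h₂, h₃, h₄, h₅⟩
  · by_cases hnew : s' * n + u' = x ∧ q = ptr x
    · obtain ⟨h₁, rfl⟩ := hnew
      obtain ⟨rfl, rfl⟩ := (mul_add_inj hu' hun).1 (h₁.trans hxe)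
      rw [hav, ← hz, h₁, Function.update_self, hlab x hxl, hr]
      refine ⟨hq, by omega, le_rfl, Or.inr ?_⟩
      rw [tableOf, ← hz, Function.update_self]
    · have hq'' : q < ptr (s' * n + u') := by
        rw [Function.update_apply] at hq'
        split_ifs at hq' with h₁
        · rw [h₁]; omega
        · exact hq'
      obtain ⟨h₁, h₂, h₃, h₄⟩ := h.explored s' hs' u' hu' q hq''
      have h₅ : lab (s' * n + u') ≠ 0 := fun h₀ => by
        rw [h.ptr_eq_zero _ (mul_add_lt_sq hs' hu') h₀] at hq''
        omega
      rw [hlab _ h₂, hlab _ h₅]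
      refine ⟨h₁, h₂, h₃, ?_⟩
      simp only [IsTreeEdge, tableOf] at h₄ ⊢
      rwa [hpar _ h₂, hpar _ h₅]
  · have hyz : y ≠ z := by rintro rfl; simp at hy'
    rw [Function.update_of_ne hyz] at hy'
    rw [Function.update_of_ne (by rintro rfl; exact hxl hy')]
    exact h.ptr_eq_zero y hy hy'
  · rcases Nat.lt_succ_iff_lt_or_eq.1 hj with hj | rfl
    · rw [hQ j hj] at h₁ h₂ ⊢
      rw [hlab _ (h.queue_lt j hj).2]
      exact h.pending j hj q ((hptr_le _).trans h₁) h₂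
    · rw [Function.update_self, Function.update_self]
      exact ⟨by omega, fun h₃ => by omega⟩
  · rcases Nat.lt_succ_iff_lt_or_eq.1 hj with hj | rfl
    · rw [hQ j hj, hlab _ (h.queue_lt j hj).2]
      exact h.window j hj h₁
    · rw [Function.update_self, Function.update_self]
      exact ⟨by omega, fun h₃ => by omega⟩
  · rw [hQ j (by omega)]
    exact (h.finished j hj).trans (hptr_le _)

theorem visit_label (h : ExploreInv n M w deg adj lab par dep ptr Q r idx lo hi)
    (hv : VisitInv n M lab Q r idx hi vis) {z : ℕ} (hz : z < n * n) (hl : lab z = 0) :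
    VisitInv n M (Function.update lab z (r + 1)) (Function.update Q hi z) r idx (hi + 1) vis := by
  refine ⟨hv.le, fun j hj => ?_, fun x hx hl' => ?_⟩
  · rcases Nat.lt_succ_iff_lt_or_eq.1 hj with hj | rfl
    · rw [Function.update_of_ne hj.ne, Function.update_of_ne]
      · exact hv.add_le j hj
      · intro he
        exact (h.queue_lt j hj).2 (he ▸ hl)
    · rw [Function.update_self, Function.update_self, hv.eq_zero z hz hl]
      omega
  · have hxz : x ≠ z := by rintro rfl; simp at hl'
    rw [Function.update_of_ne hxz] at hl'
    exact hv.eq_zero x hx hl'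

end ExploreInv

theorem VisitInv.nextRadius {n M : ℕ} {lab Q : ℕ → ℕ} {r lo hi : ℕ} {vis : ℕ → ℕ}
    (hv : VisitInv n M lab Q r hi hi vis) : VisitInv n M lab Q (r + 1) lo hi vis := by
  refine ⟨hv.le, fun j hj => ?_, hv.eq_zero⟩
  have := hv.add_le j hj
  rw [if_pos hj] at this
  omega

/-- Execute a list of programs one after the other. -/
def WordProg.block : List WordProg → WordProg
  | [] => .skip
  | [p] => p
  | p :: q :: l => .seq p (block (q :: l))

/-- Every tree edge adds one to the depth and at least one to the label. This bounds depths, which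
are stored in words. -/
theorem IsForest.dep_lt_lab {n : ℕ} {w lab par dep : ℕ → ℕ → ℕ} (hF : IsForest n w lab par dep)
    {s : ℕ} (hs : s < n) : ∀ (k : ℕ), ∀ v < n, lab s v ≤ k → lab s v ≠ 0 → dep s v < lab s v := by
  intro k
  induction k with
  | zero => intro v _ h h'; omega
  | succ k ih =>
    intro v hv hk hl
    by_cases h : v = s
    · subst h
      rw [hF.dep_self v hs]
      omega
    · obtain ⟨h₁, h₂, h₃, h₄, h₅⟩ := hF.step s hs v hv hl h
      have := ih _ h₁ (by omega) h₂
      omega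

theorem IsSortedAdj.deg_le {n : ℕ} {w : ℕ → ℕ → ℕ} {deg adj : ℕ → ℕ} (h : IsSortedAdj n w deg adj)
    {u : ℕ} (hu : u < n) : deg u ≤ n := by
  have h₁ := Finset.card_le_card_of_injOn (s := Finset.range (deg u)) (t := Finset.range n)
    (fun q => adj (u * n + q)) (fun q hq => by simpa using h.lt u hu q (by simpa using hq))
    (fun q hq q' hq' he => h.inj u hu q (by simpa using hq) q' (by simpa using hq') he)
  simpa using h₁

/-- Label every source. Array `4` is the queue, array `5` holds the labels, array `6` the parents. -/
def exploreInitBody : WordProg :=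
  block [.store 5 (reg 2 * reg 0 + reg 2) (const 1), .store 6 (reg 2 * reg 0 + reg 2) (reg 2),
    .store 4 (reg 2) (reg 2 * reg 0 + reg 2)]

/-- Prepare the exploration: register `3` is the radius, `4` the position in the queue, `5` the start
and `6` the end of the active part of the queue, `7` indicates that a chord has been found. -/
def exploreInit : WordProg :=
  block [forLoop 2 (reg 0) exploreInitBody, .assign 3 (const 0), .assign 4 (const 0),
    .assign 5 (const 0), .assign 6 (reg 0), .assign 7 (const 0)]

/-- Explore the next edge, advance in the queue, or increase the radius. Array `7` holds the depths
and array `8` the pointers into the adjacency lists. Registers `8`, `9` and `10` receive a chord. -/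
def exploreBody : WordProg :=
  .ite ((reg 4).lt (reg 6))
    (block [.assign 11 (load 4 (reg 4)), .assign 12 (reg 11 % reg 0), .assign 13 (load 8 (reg 11)),
      .ite (((reg 13).lt (load 3 (reg 12))) *
          ((load 5 (reg 11) + load 0 (reg 12 * reg 0 + load 2 (reg 12 * reg 0 + reg 13))).eq
            (reg 3 + const 1)))
        (block [.assign 14 (load 2 (reg 12 * reg 0 + reg 13)),
          .assign 15 (reg 11 / reg 0 * reg 0 + reg 14),
          .ite ((load 5 (reg 15)).eq (const 0))
            (block [.store 7 (reg 15) (load 7 (reg 11) + const 1), .store 5 (reg 15) (reg 3 + const 1),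
              .store 6 (reg 15) (reg 12), .store 4 (reg 6) (reg 15), .assign 6 (reg 6 + const 1),
              .store 8 (reg 11) (reg 13 + const 1)])
            (.ite ((load 6 (reg 11)).ne (reg 14) * (load 6 (reg 15)).ne (reg 12))
              (block [.assign 7 (const 1), .assign 8 (reg 11 / reg 0), .assign 9 (reg 12),
                .assign 10 (reg 14)])
              (.store 8 (reg 11) (reg 13 + const 1)))])
        (block [.ite ((load 5 (reg 11) + reg 1).lt (reg 3 + const 2))
            (.assign 5 (reg 4 + const 1)) .skip,
          .assign 4 (reg 4 + const 1)])])
    (block [.assign 3 (reg 3 + const 1), .assign 4 (reg 5)])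

/-- The exploration stops when a chord has been found, or when the radius exceeds `n * M`. -/
def exploreCond : WordExpr := (reg 7).eq (const 0) * (reg 3).lt (reg 0 * reg 1 + const 1)

/-- The exploration. -/
def exploreProg : WordProg := .seq exploreInit (.loop exploreCond exploreBody)

/-- The invariant of the exploration, in terms of the state of the machine. -/
def ExploreStateInv (n M : ℕ) (w : ℕ → ℕ → ℕ) (deg adj : ℕ → ℕ) (m : ℕ) (s : WordState) : Prop :=
  ExploreInv n M w deg adj (s.arr 5) (s.arr 6) (s.arr 7) (s.arr 8) (s.arr 4) (s.reg 3) (s.reg 4)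
      (s.reg 5) (s.reg 6) ∧
    s.reg 3 ≤ n * M + 1 ∧
    (s.reg 7 = 0 ∨ s.reg 7 = 1 ∧
      IsChord n w (tableOf n (s.arr 5)) (tableOf n (s.arr 6)) (s.reg 8) (s.reg 9) (s.reg 10) ∧
      tableOf n (s.arr 5) (s.reg 8) (s.reg 9) + w (s.reg 9) (s.reg 10) = s.reg 3 + 1 ∧
      tableOf n (s.arr 5) (s.reg 8) (s.reg 10) ≤ s.reg 3 + 1) ∧
    ∃ vis, VisitInv n M (s.arr 5) (s.arr 4) (s.reg 3) (s.reg 4) (s.reg 6) vis ∧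
      s.reg 3 + ∑ x ∈ Finset.range (n * n), vis x + ∑ x ∈ Finset.range (n * n), s.arr 8 x +
        s.reg 7 + m = n * M + 2 + n * n * (M + 3)

/-- Termination by a potential: each round raises by one exactly one of the radius, the number of
visits, the sum of the edge pointers and the flag for a chord. Their maxima `n M + 1`, `n² (M + 1)`,
`2 n²` and `1` add up to the constant in `ExploreStateInv`. -/
theorem exploreBody_step {K n M : ℕ} {w : ℕ → ℕ → ℕ} {deg adj : ℕ → ℕ} {m : ℕ} {s : WordState}
    (hA : IsSortedAdj n w deg adj) (hM : ∀ u < n, ∀ v < n, w u v ≤ M) (h0 : s.reg 0 = n)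
    (h1 : s.reg 1 = M) (hw : tableOf n (s.arr 0) = w) (h2 : s.arr 2 = adj) (h3 : s.arr 3 = deg)
    (hK : n * M + n * n + 3 ≤ K) (hI : ExploreStateInv n M w deg adj m s)
    (hc : exploreCond.eval s ≠ 0) :
    ∃ m' < m, Ensures K exploreBody s exploreBody.cost (ExploreStateInv n M w deg adj m') := by
  obtain ⟨hE, hr, hfound, vis, hV, hm⟩ := hI
  have hc' : s.reg 7 = 0 ∧ s.reg 3 < n * M + 1 := by
    simp [exploreCond, h0, h1] at hc
    omega
  have hidx := hE.idx_le
  have hhi := hE.hi_le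
  have hsum₁ : ∑ x ∈ Finset.range (n * n), vis x ≤ n * n * (M + 1) := by
    simpa using Finset.sum_le_card_nsmul (Finset.range (n * n)) vis (M + 1)
      fun x hx => hV.le x (Finset.mem_range.1 hx)
  have hsum₂ := hE.sum_ptr_le hA
  have hsum₃ : n * n * (M + 3) = n * n * (M + 1) + 2 * (n * n) := by ring
  have hm₁ : 1 ≤ m := by rw [hc'.1] at hm; clear hfound; omega
  refine ⟨m - 1, by omega, Ensures.of_wp ?_⟩
  simp only [exploreBody, block, wp, eval_reg, eval_const, eval_load, eval_mod, eval_add, eval_mul,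
    eval_div, WordState.setReg_reg, WordState.setReg_arr, WordState.setArr_reg, h0, h2]
  refine ⟨fun hlt => ?_, fun hge => ?_⟩
  · have hlt' : s.reg 4 < s.reg 6 := by simpa using hlt
    obtain ⟨hx₁, hx₂⟩ := hE.queue_lt _ hlt'
    have hsx := div_lt_of_lt_sq hx₁
    have hux := mod_lt_of_lt_sq hx₁
    have hwx : ∀ a b, s.arr 0 (a * n + b) = w a b := fun a b => by rw [← hw, tableOf]
    have hnn : n ≤ n * n := Nat.le_mul_of_pos_left n (by omega)
    -- The pointer counts explored neighbours; the bound is needed for the values written.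
    have hqn : s.arr 8 (s.arr 4 (s.reg 4)) ≤ n := by
      by_contra! hcon
      have := hE.explored _ hsx _ hux n (by rwa [div_mul_add_mod])
      have := hA.deg_le hux
      omega
    have hadv := hE.advance hA hM hlt'
    have hvis := hE.visit hV hlt'
    have hpass := hE.pass hlt'
    have hlab := @ExploreInv.label _ _ _ _ _ _ _ _ _ _ _ _ _ _ hE hlt'
    have hsv := sum_range_update_succ vis hx₁
    have hsp := sum_range_update_succ (s.arr 8) hx₁
    have hd := hE.forest.dep_lt_lab hsx _ _ hux le_rfl (by rwa [tableOf, div_mul_add_mod])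
    have hl := hE.lab_le _ hx₁
    rw [tableOf, tableOf, div_mul_add_mod] at hd
    generalize hxe : s.arr 4 (s.reg 4) = x at *
    simp [hwx, h0, h1, h2, h3]
    refine ⟨by omega, by omega, by omega, fun hq hr' => ?_, fun hne => ?_⟩
    · have hv := hA.lt _ hux _ hq
      have hwv := hA.weight_ne _ hux _ hq
      have hz := mul_add_lt_sq hsx hv
      generalize hve : adj (x % n * n + s.arr 8 x) = v at *
      refine ⟨by omega, by omega, fun hz₀ => ?_, fun hz₀ => ⟨fun ht₁ ht₂ => ?_, fun ht => ?_⟩⟩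
      · refine ⟨by omega, by omega, by omega, by omega, by omega, by omega, ?_⟩
        have hE' := hlab (x := x) rfl rfl rfl hv hq hve hwv hr' hz₀
        have hV' := hE.visit_label hV hz hz₀
        simp only [ExploreStateInv, WordState.setReg_reg, WordState.setReg_arr, WordState.setArr_reg,
          WordState.setArr_arr_self, WordState.setArr_arr_ne, ne_eq, Nat.reduceEqDiff, reduceIte,
          not_false_eq_true, hc'.1]
        exact ⟨hE', hr, Or.inl trivial, vis, hV', by omega⟩
      · refine ⟨by omega, by omega, by omega, by omega, ?_⟩
        simp only [ExploreStateInv, WordState.setReg_reg, WordState.setReg_arr,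
          Nat.reduceEqDiff, reduceIte]
        refine ⟨hE, hr, Or.inr ⟨trivial, ⟨hsx, hux, hv, ?_, hz₀, hwv, ?_⟩, ?_, hE.lab_le _ hz⟩, vis, hV,
          by omega⟩
        · rwa [tableOf, div_mul_add_mod]
        · rw [IsTreeEdge, tableOf, tableOf, div_mul_add_mod]
          tauto
        · rwa [tableOf, div_mul_add_mod]
      · refine ⟨by omega, ?_⟩
        have hE' := hpass hq hr' hz₀ hv (by
          rw [IsTreeEdge, tableOf, tableOf, div_mul_add_mod]
          tauto)
        simp only [ExploreStateInv, WordState.setReg_reg, WordState.setReg_arr, WordState.setArr_reg,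
          WordState.setArr_arr_self, WordState.setArr_arr_ne, ne_eq, Nat.reduceEqDiff, reduceIte,
          not_false_eq_true, hc'.1]
        exact ⟨hE', hr, Or.inl trivial, vis, hV, by rw [hsp]; omega⟩
    · have hadv' := hadv fun h₁ h₂ =>
        hne.elim (fun h => by omega) (fun h => h h₂)
      refine ⟨fun h₁ => ⟨by omega, ?_⟩, fun h₁ => ⟨by omega, ?_⟩⟩
      · rw [if_pos h₁] at hadv'
        simp only [ExploreStateInv, WordState.setReg_reg, WordState.setReg_arr,
          Nat.reduceEqDiff, reduceIte, hc'.1]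
        exact ⟨hadv', hr, Or.inl trivial, _, hvis, by rw [hsv]; omega⟩
      · rw [if_neg (by omega)] at hadv'
        simp only [ExploreStateInv, WordState.setReg_reg, WordState.setReg_arr,
          Nat.reduceEqDiff, reduceIte, hc'.1]
        exact ⟨hadv', hr, Or.inl trivial, _, hvis, by rw [hsv]; omega⟩
  · have hge' : s.reg 4 = s.reg 6 := by
      have : ¬ s.reg 4 < s.reg 6 := by simpa using hge
      omega
    have hlo := hE.lo_le
    rw [hge'] at hE hV
    refine ⟨by omega, by simp; omega, ?_⟩
    simp only [ExploreStateInv, WordState.setReg_reg, WordState.setReg_arr,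
      Nat.reduceEqDiff, reduceIte, hc'.1]
    exact ⟨hE.nextRadius, by omega, Or.inl trivial, vis, hV.nextRadius, by omega⟩

theorem exploreInit_spec : ∃ c, ∀ {K n M : ℕ} {w : ℕ → ℕ → ℕ} {deg adj : ℕ → ℕ} {s : WordState},
    s.reg 0 = n → n * n + 1 ≤ K → (s.arr 5 = fun _ => 0) → (s.arr 7 = fun _ => 0) →
    (s.arr 8 = fun _ => 0) → Ensures K exploreInit s (c * (n + 1))
      (ExploreStateInv n M w deg adj (n * M + 2 + n * n * (M + 3))) := by
  refine ⟨(reg 0).cost + exploreInitBody.cost + 12 + 20, fun {K n M w deg adj s} h0 hK h5 h7 h8 => ?_⟩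
  refine Ensures.seq_of (Ensures.forLoop (N := n) (T := exploreInitBody.cost) (fun j s' =>
      (∀ i, s'.arr 5 i = if ∃ k < j, i = k * n + k then 1 else 0) ∧
      (∀ k < j, s'.arr 6 (k * n + k) = k) ∧ ∀ k < j, s'.arr 4 k = k * n + k) ?_ rfl ?_ ?_ ?_)
    (fun s' hf hI => Ensures.of_wp ?_) ?_
  · nlinarith
  · intro s' hf
    simp [hf.1 0 rfl, h0]
  · simp [h5]
  · rintro j s' hj hf hi ⟨i5, i6, i4⟩
    apply Ensures.of_wp
    have h0' : s'.reg 0 = n := (hf.1 0 rfl).trans h0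
    have h₁ := mul_add_lt_sq hj hj
    have hinj : ∀ k < n, k * n + k = j * n + j ↔ k = j := fun k hk => by
      rw [mul_add_inj hk hj, and_self]
    simp [exploreInitBody, block, wp, h0', hi]
    refine ⟨by omega, by nlinarith, by omega, fun i => ?_, fun k hk => ?_, fun k hk => ?_⟩
    · rw [Function.update_apply, i5]
      by_cases hij : i = j * n + j
      · rw [if_pos hij, if_pos ⟨j, by omega, hij⟩]
      · rw [if_neg hij]
        congr 1
        refine propext ⟨fun ⟨k, hk, he⟩ => ⟨k, by omega, he⟩,
          fun ⟨k, hk, he⟩ => ⟨k, ?_, he⟩⟩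
        rcases Nat.lt_or_eq_of_le hk with hk | rfl
        · exact hk
        · exact absurd he hij
    · rw [Function.update_apply]
      split_ifs with h₂
      · exact ((hinj k (by omega)).1 h₂).symm
      · refine i6 k (lt_of_le_of_ne (by omega) ?_)
        rintro rfl; exact h₂ rfl
    · rw [Function.update_apply]
      split_ifs with h₂
      · rw [h₂]
      · exact i4 k (by omega)
  · obtain ⟨i5, i6, i4⟩ := hI
    have h0' : s'.reg 0 = n := (hf.1 0 rfl).trans h0
    have h7' : s'.arr 7 = fun _ => 0 := (hf.2 7 rfl).trans h7
    have h8' : s'.arr 8 = fun _ => 0 := (hf.2 8 rfl).trans h8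
    have hnn : n ≤ n * n := Nat.le_mul_self n
    have hdiag : ∀ k < n, s'.arr 5 (k * n + k) = 1 := fun k hk => by
      rw [i5, if_pos ⟨k, hk, rfl⟩]
    have hne : ∀ x, s'.arr 5 x ≠ 0 → ∃ k < n, x = k * n + k := fun x hx => by
      rw [i5] at hx
      by_contra hcon
      exact hx (if_neg hcon)
    simp [block, wp, h0']
    refine ⟨by omega, ?_⟩
    simp only [ExploreStateInv, WordState.setReg_reg, WordState.setReg_arr, Nat.reduceEqDiff, reduceIte,
      h7', h8']
    refine ⟨⟨fun j hj => ?_, fun x hx hx' => ?_, fun j hj j' hj' he => ?_, fun x hx => ?_,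
      fun j j' hlt hj' => ?_, ⟨hdiag, i6, fun _ _ => rfl, fun s'' hs v hv hl hsv => ?_⟩, by simp, by simp,
      fun j hj q _ _ => ?_, le_rfl, by omega, fun j hj _ => ?_, by simp⟩, by omega, Or.inl trivial,
      fun _ => 0, ⟨by simp, fun j hj => ?_, by simp⟩, by simp⟩
    · rw [i4 j hj, hdiag j hj]
      exact ⟨mul_add_lt_sq hj hj, one_ne_zero⟩
    · obtain ⟨k, hk, rfl⟩ := hne x hx'
      exact ⟨k, hk, i4 k hk⟩
    · rw [i4 j hj, i4 j' hj', mul_add_inj hj hj'] at he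
      exact he.1
    · rw [i5]
      split_ifs <;> omega
    · rw [i4 j (by omega), i4 j' hj', hdiag j (by omega), hdiag j' hj']
    · exfalso
      obtain ⟨k, hk, he⟩ := hne _ hl
      rw [mul_add_inj hv hk] at he
      omega
    · rw [i4 j hj, hdiag j hj]
      omega
    · rw [i4 j hj, hdiag j hj]
      omega
    · rw [i4 j hj, hdiag j hj]
      omega
  · have : (block [assign 3 (const 0), assign 4 (const 0), assign 5 (const 0), assign 6 (reg 0),
      assign 7 (const 0)]).cost = 10 := rfl
    nlinarith

/-- The exploration yields trees of shortest paths, which are complete up to a certain radius; either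
that radius is large, or a chord has been found at that radius. -/
theorem exploreProg_spec : ∃ c, ∀ {K n M : ℕ} {w : ℕ → ℕ → ℕ} {s : WordState},
    s.reg 0 = n → s.reg 1 = M → n * M + n * n + 3 ≤ K → (s.arr 5 = fun _ => 0) →
    (s.arr 7 = fun _ => 0) → (s.arr 8 = fun _ => 0) → tableOf n (s.arr 0) = w →
    IsSortedAdj n w (s.arr 3) (s.arr 2) → (∀ u < n, ∀ v < n, w u v ≤ M) →
    Ensures K exploreProg s (c * (n * M + n * n * (M + 3) + n + 3)) (fun s' =>
      IsForest n w (tableOf n (s'.arr 5)) (tableOf n (s'.arr 6)) (tableOf n (s'.arr 7)) ∧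
      IsExplored n w (tableOf n (s'.arr 5)) (tableOf n (s'.arr 6)) (s'.reg 3) ∧
      (∀ u < n, ∀ v < n, tableOf n (s'.arr 5) u v ≤ s'.reg 3 + 1) ∧
      s'.reg 3 ≤ n * M + 1 ∧
      (s'.reg 7 = 0 ∧ n * M + 1 ≤ s'.reg 3 ∨ s'.reg 7 = 1 ∧
        IsChord n w (tableOf n (s'.arr 5)) (tableOf n (s'.arr 6)) (s'.reg 8) (s'.reg 9) (s'.reg 10) ∧
        tableOf n (s'.arr 5) (s'.reg 8) (s'.reg 9) + w (s'.reg 9) (s'.reg 10) = s'.reg 3 + 1 ∧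
        tableOf n (s'.arr 5) (s'.reg 8) (s'.reg 10) ≤ s'.reg 3 + 1)) := by
  obtain ⟨c, hc⟩ := exploreInit_spec
  refine ⟨c + (exploreCond.cost + 1 + exploreBody.cost), fun {K n M w s} h0 h1 hK h5 h7 h8 hw hA hM => ?_⟩
  refine Ensures.seq_of (hc (M := M) (w := w) (deg := s.arr 3) (adj := s.arr 2) h0 (by omega) h5 h7 h8)
    (fun s₁ hf₁ hI => (Ensures.loop (T := exploreBody.cost) _ hI ?_).mono le_rfl ?_) ?_
  · intro m s₂ hf₂ hI₂ he
    exact exploreBody_step hA hM ((hf₂.1 0 rfl).trans ((hf₁.1 0 rfl).trans h0))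
      ((hf₂.1 1 rfl).trans ((hf₁.1 1 rfl).trans h1))
      (by rw [hf₂.2 0 rfl, hf₁.2 0 rfl, hw]) ((hf₂.2 2 rfl).trans (hf₁.2 2 rfl))
      ((hf₂.2 3 rfl).trans (hf₁.2 3 rfl)) hK hI₂ he
  · rintro s₂ hf₂ ⟨he, m, hE, hr, hfound, -⟩
    refine ⟨hE.forest, hE.isExplored hA, fun u hu v hv => hE.lab_le _ (mul_add_lt_sq hu hv), hr, ?_⟩
    rcases hfound with h | h
    -- Without a chord, the loop can only have ended because the radius exceeds `n * M`.
    · refine Or.inl ⟨h, ?_⟩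
      have h0' : s₂.reg 0 = n := (hf₂.1 0 rfl).trans ((hf₁.1 0 rfl).trans h0)
      have h1' : s₂.reg 1 = M := (hf₂.1 1 rfl).trans ((hf₁.1 1 rfl).trans h1)
      simpa [exploreCond, h, h0', h1', Nat.lt_succ_iff] using he
    · exact Or.inr h
  · have h₁ : c * (n + 1) ≤ c * (n * M + n * n * (M + 3) + n + 3) := Nat.mul_le_mul_left _ (by omega)
    have h₂ : (n * M + 2 + n * n * (M + 3) + 1) * (exploreCond.cost + 1 + exploreBody.cost) ≤
        (n * M + n * n * (M + 3) + n + 3) * (exploreCond.cost + 1 + exploreBody.cost) :=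
      Nat.mul_le_mul_right _ (by omega)
    linarith

/-! ### Tables and histograms -/

/-- Fill a segment of an array. -/
def WordProg.fill (i : ℕ) (bound : WordExpr) (a : ℕ) (ad e : WordExpr) : WordProg :=
  forLoop i bound (.store a ad e)

/-- The hypothesis `he` may use the part of the segment that is already filled, which allows tables
defined by recursion on the index. -/
theorem Ensures.fill {K i a N off : ℕ} {bound ad e : WordExpr} {s : WordState} {F : ℕ → ℕ} (hK : N ≤ K)
    (hb : ∀ s', (WordProg.fill i bound a ad e).Frame s s' → bound.eval s' = N)
    (hF : ∀ j < N, F j ≤ K)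
    (he : ∀ j s', j < N → (WordProg.fill i bound a ad e).Frame s s' → s'.reg i = j →
      (∀ x, s'.arr a x = if off ≤ x ∧ x < off + j then F (x - off) else s.arr a x) →
      ad.eval s' = off + j ∧ e.eval s' = F j) :
    Ensures K (.fill i bound a ad e) s ((bound.cost + (ad.cost + e.cost + 1) + 12) * (N + 1))
      (fun s' => ∀ x, s'.arr a x = if off ≤ x ∧ x < off + N then F (x - off) else s.arr a x) := by
  refine Ensures.forLoop (fun j s' => ∀ x, s'.arr a x =
    if off ≤ x ∧ x < off + j then F (x - off) else s.arr a x) hK rfl hb ?_ ?_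
  · intro x
    rw [if_neg (by omega), WordState.setReg_arr]
  · intro j s' hj hf hi hI
    obtain ⟨h₁, h₂⟩ := he j s' hj hf hi hI
    refine ⟨_, _, .store a ad e s' (h₂.trans_le (hF j hj)), le_rfl, fun x => ?_⟩
    rw [h₁, h₂, WordState.setReg_arr, WordState.setArr_arr_self, Function.update_apply, hI]
    by_cases hx : x = off + j
    · rw [if_pos hx, if_pos (by omega), hx, Nat.add_sub_cancel_left]
    · rw [if_neg hx]
      exact if_congr (by omega) rfl rfl

/-- Count the indices that satisfy a condition, according to a key. -/
def WordProg.histogram (i : ℕ) (bound : WordExpr) (a : ℕ) (c key : WordExpr) : WordProg :=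
  forLoop i bound (.ite c (.store a key (load a key + const 1)) .skip)

theorem Ensures.histogram {K i a N : ℕ} {bound c key : WordExpr} {s : WordState} {κ : ℕ → ℕ}
    {p : ℕ → Prop} [DecidablePred p] (hK : N ≤ K)
    (hb : ∀ s', (WordProg.histogram i bound a c key).Frame s s' → bound.eval s' = N)
    (h₀ : s.arr a = fun _ => 0)
    (hc : ∀ j s', j < N → (WordProg.histogram i bound a c key).Frame s s' → s'.reg i = j →
      (c.eval s' ≠ 0 ↔ p j) ∧ (p j → key.eval s' = κ j)) :
    Ensures K (.histogram i bound a c key) s ((bound.cost +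
        (WordProg.ite c (.store a key (load a key + const 1)) .skip).cost + 12) * (N + 1))
      (fun s' => ∀ x, s'.arr a x = ((Finset.range N).filter fun j => p j ∧ κ j = x).card) := by
  refine Ensures.forLoop (fun j s' => ∀ x, s'.arr a x =
    ((Finset.range j).filter fun j => p j ∧ κ j = x).card) hK rfl hb ?_ ?_
  · simp [h₀]
  · intro j s' hj hf hi hI
    obtain ⟨h₁, h₂⟩ := hc j s' hj hf hi
    have hs : ∀ x, ((Finset.range (j + 1)).filter fun j => p j ∧ κ j = x).card =
        ((Finset.range j).filter fun j => p j ∧ κ j = x).card + if p j ∧ κ j = x then 1 else 0 := by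
      intro x
      rw [Finset.range_add_one, Finset.filter_insert]
      split_ifs
      · rw [Finset.card_insert_of_notMem (by simp)]
      · rfl
    refine Ensures.of_wp ⟨fun he => ?_, fun he => ?_⟩
    · have hp := h₁.1 he
      simp only [wp, eval_add, eval_load, eval_const, h₂ hp, WordState.setReg_arr,
        WordState.setArr_arr_self, Function.update_apply, hs, hp, true_and, hI]
      refine ⟨?_, fun x => ?_⟩
      · have := Finset.card_filter_le (Finset.range j) fun i => p i ∧ κ i = κ j
        rw [Finset.card_range] at this
        omega
      · by_cases hx : x = κ j
        · simp [hx]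
        · rw [if_neg hx, if_neg (Ne.symm hx), add_zero]
    · have hp : ¬ p j := fun h => h₁.2 h he
      simp only [wp, WordState.setReg_arr, hs, hI, hp, false_and, if_false, add_zero, implies_true]

/-- A sum of expressions. -/
def WordExpr.sum (f : ℕ → WordExpr) : ℕ → WordExpr
  | 0 => const 0
  | k + 1 => sum f k + f k

@[simp] theorem WordExpr.eval_sum (s : WordState) (f : ℕ → WordExpr) (k : ℕ) :
    (WordExpr.sum f k).eval s = ∑ j ∈ Finset.range k, (f j).eval s := by
  induction k with
  | zero => rfl
  | succ k ih => rw [Finset.sum_range_succ, WordExpr.sum, eval_add, ih]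

theorem WordExpr.eval_eq (s : WordState) (e f : WordExpr) :
    (e.eq f).eval s = if e.eval s = f.eval s then 1 else 0 := rfl

/-! ### The best chord -/

/-- Replace the best chord, of value register `16`, by the edge between the registers `12` and `14` with
source register `11`, if that is a better chord. -/
def tryProg : WordProg :=
  let u := reg 11 * reg 0 + reg 12
  let v := reg 11 * reg 0 + reg 14
  let w := load 0 (reg 12 * reg 0 + reg 14)
  .ite ((load 5 u).ne (const 0) * (load 5 v).ne (const 0) * w.ne (const 0) *
      (load 6 u).ne (reg 14) * (load 6 v).ne (reg 12) * (load 5 u + w + load 5 v).lt (reg 16))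
    (block [.assign 8 (reg 11), .assign 9 (reg 12), .assign 10 (reg 14),
      .assign 16 (load 5 u + w + load 5 v)])
    .skip

/-- The registers `8`, `9` and `10` hold a chord, and register `16` its value. -/
def HoldsChord (n : ℕ) (w lab par : ℕ → ℕ → ℕ) (s : WordState) : Prop :=
  IsChord n w lab par (s.reg 8) (s.reg 9) (s.reg 10) ∧
    s.reg 16 = lab (s.reg 8) (s.reg 9) + w (s.reg 9) (s.reg 10) + lab (s.reg 8) (s.reg 10)

/-- The state stores the graph and the forests. -/
structure StoresForest (n M : ℕ) (w lab par : ℕ → ℕ → ℕ) (r : ℕ) (s : WordState) : Prop where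
  size : s.reg 0 = n
  maxWeight : s.reg 1 = M
  radius : s.reg 3 = r
  weight : tableOf n (s.arr 0) = w
  lab : tableOf n (s.arr 5) = lab
  par : tableOf n (s.arr 6) = par

theorem StoresForest.frame {n M : ℕ} {w lab par : ℕ → ℕ → ℕ} {r : ℕ} {s s' : WordState} {p : WordProg}
    (h : StoresForest n M w lab par r s) (hf : p.Frame s s') (h0 : p.setsReg 0 = false)
    (h1 : p.setsReg 1 = false) (h3 : p.setsReg 3 = false) (a0 : p.setsArr 0 = false)
    (a5 : p.setsArr 5 = false) (a6 : p.setsArr 6 = false) : StoresForest n M w lab par r s' := by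
  refine ⟨(hf.1 0 h0).trans h.size, (hf.1 1 h1).trans h.maxWeight, (hf.1 3 h3).trans h.radius, ?_, ?_, ?_⟩
  · rw [hf.2 0 a0, h.weight]
  · rw [hf.2 5 a5, h.lab]
  · rw [hf.2 6 a6, h.par]

/-- If the replacement is refused, one of the tests has failed; for a true chord only the comparison
of values can fail. -/
theorem tryProg_spec {K n M : ℕ} {w lab par : ℕ → ℕ → ℕ} {r : ℕ} {s : WordState}
    (hs : StoresForest n M w lab par r s) (hc : HoldsChord n w lab par s) (hK : n ≤ K)
    (hb : s.reg 16 ≤ K) (h11 : s.reg 11 < n) (h12 : s.reg 12 < n) (h14 : s.reg 14 < n) :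
    Ensures K tryProg s tryProg.cost (fun s' => HoldsChord n w lab par s' ∧ s'.reg 16 ≤ s.reg 16 ∧
      (IsChord n w lab par (s.reg 11) (s.reg 12) (s.reg 14) →
        s'.reg 16 ≤ lab (s.reg 11) (s.reg 12) + w (s.reg 12) (s.reg 14) +
          lab (s.reg 11) (s.reg 14))) := by
  have e0 : ∀ a b, s.arr 0 (a * n + b) = w a b := fun a b => by rw [← hs.weight, tableOf]
  have e5 : ∀ a b, s.arr 5 (a * n + b) = lab a b := fun a b => by rw [← hs.lab, tableOf]
  have e6 : ∀ a b, s.arr 6 (a * n + b) = par a b := fun a b => by rw [← hs.par, tableOf]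
  apply Ensures.of_wp
  simp [tryProg, block, wp, hs.size, e0, e5, e6]
  refine ⟨fun h₁ h₂ h₃ h₄ h₅ h₆ => ⟨by omega, by omega, by omega, by omega, ⟨⟨h11, h12, h14, h₁, h₂, h₃, ?_⟩, ?_⟩,
    h₆.le⟩, fun h => ⟨hc, fun hch => ?_⟩⟩
  · simp [IsTreeEdge, h₄, h₅]
  · simp
  · by_contra! hlt
    have := hch.not_tree
    simp only [IsTreeEdge, not_or] at this
    have h₁ := hch.left_lab
    have h₂ := hch.right_lab
    have h₃ := hch.weight
    rcases h with ((((h | h) | h) | h) | h) | h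
    · exact h₁ h
    · exact h₂ h
    · exact h₃ h
    · exact this.1 h
    · exact this.2 h
    · omega

/-- Examine all triples. -/
def bruteForceProg : WordProg :=
  forLoop 2 (reg 0 * reg 0 * reg 0) (block [.assign 11 (reg 2 / (reg 0 * reg 0)),
    .assign 12 (reg 2 / reg 0 % reg 0), .assign 14 (reg 2 % reg 0), tryProg])

theorem bruteForceProg_spec : ∃ c, ∀ {K n M : ℕ} {w lab par : ℕ → ℕ → ℕ} {r : ℕ} {s : WordState},
    StoresForest n M w lab par r s → HoldsChord n w lab par s → n * n * n ≤ K → s.reg 16 ≤ K →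
    Ensures K bruteForceProg s (c * (n * n * n + 1)) (fun s' => HoldsChord n w lab par s' ∧
      s'.reg 16 ≤ s.reg 16 ∧ ∀ x u v, IsChord n w lab par x u v →
        s'.reg 16 ≤ lab x u + w u v + lab x v) := by
  refine ⟨_, fun {K n M w lab par r s} hs hc hK hb => (Ensures.forLoop (T := 16 + tryProg.cost)
    (fun j s' => HoldsChord n w lab par s' ∧ s'.reg 16 ≤ s.reg 16 ∧ ∀ x u v,
      IsChord n w lab par x u v → x * (n * n) + (u * n + v) < j →
      s'.reg 16 ≤ lab x u + w u v + lab x v) hK rfl ?_ ?_ ?_).mono le_rfl fun s' _ h =>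
    ⟨h.1, h.2.1, fun x u v hch => h.2.2 x u v hch ?_⟩⟩
  · intro s' hf
    simp [hf.1 0 rfl, hs.size]
  · refine ⟨by simpa [HoldsChord] using hc, by simp, by simp⟩
  · intro j s' hj hf hi ⟨hc', hle, hI⟩
    have hs' := hs.frame hf rfl rfl rfl rfl rfl rfl
    have hn : 0 < n := Nat.pos_of_ne_zero (by rintro rfl; simp at hj)
    -- The counter enumerates triples as three base `n` digits: source, first end, second end.
    have hj₁ : j / (n * n) < n := Nat.div_lt_of_lt_mul (by linarith)
    have hj₂ : j / n % n < n := Nat.mod_lt _ hn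
    have hj₃ : j % n < n := Nat.mod_lt _ hn
    have hnK : n ≤ K := by nlinarith [Nat.mul_le_mul hn hn, Nat.mul_le_mul_left n (Nat.mul_le_mul hn hn)]
    refine Ensures.mono (T := 6 + (6 + (4 + tryProg.cost))) ?_ (by omega) fun _ _ h => h
    refine Ensures.seq ⟨_, _, .assign 11 _ s' ?_, le_rfl, Ensures.seq ⟨_, _, .assign 12 _ _ ?_, le_rfl,
      Ensures.seq ⟨_, _, .assign 14 _ _ ?_, le_rfl, (tryProg_spec (s := _) (n := n) (M := M) (w := w) (lab := lab)
        (par := par) (r := r) ?_ ?_ hnK ?_ ?_ ?_ ?_).mono le_rfl ?_⟩⟩⟩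
    · simp [hs'.size, hi]; omega
    · simp [hs'.size, hi]; omega
    · simp [hs'.size, hi]; omega
    · exact ⟨by simp [hs'.size], by simp [hs'.maxWeight], by simp [hs'.radius], by simp [hs'.weight],
        by simp [hs'.lab], by simp [hs'.par]⟩
    · simpa [HoldsChord] using hc'
    · simp; omega
    · simpa [hs'.size, hi] using hj₁
    · simpa [hs'.size, hi] using hj₂
    · simpa [hs'.size, hi] using hj₃
    · rintro s'' - ⟨h₁, h₂, h₃⟩
      simp [hs'.size, hi] at h₂ h₃
      refine ⟨by simpa [HoldsChord] using h₁, by simp; omega, fun x u v hch hlt => ?_⟩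
      rw [WordState.setReg_reg, if_neg (by norm_num)]
      rcases Nat.lt_or_eq_of_le (Nat.le_of_lt_succ hlt) with h | h
      · exact h₂.trans (hI x u v hch h)
      · have hu := hch.left_lt
        have hv := hch.right_lt
        have e₁ : j / (n * n) = x := by
          rw [← h, mul_add_div_of_lt_right (mul_add_lt_sq hu hv)]
        have e₂ : j % n = v := by
          rw [← h, ← mul_assoc, ← add_assoc, ← add_mul, mul_add_mod_of_lt_right hv]
        have e₃ : j / n % n = u := by
          rw [← h, ← mul_assoc, ← add_assoc, ← add_mul, mul_add_div_of_lt_right hv,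
            mul_add_mod_of_lt_right hu]
        rw [e₁, e₂, e₃] at h₃
        exact h₃ hch
  · have h₁ := Nat.mul_le_mul_right (n * n) hch.source_lt
    have h₂ := mul_add_lt_sq hch.left_lt hch.right_lt
    nlinarith

/-! ### Linear transforms with Kronecker powers -/

theorem mul_add_lt_mul {p R h H : ℕ} (hp : p < R) (hh : h < H) : p * H + h < R * H := by
  have := Nat.mul_le_mul_right H hp
  rw [Nat.succ_mul] at this
  omega

/-- A natural number that is congruent to the given integer. -/
def intResidue (m : ℕ) (z : ℤ) : ℕ := if 0 ≤ z then z.toNat else z.natAbs * (m - 1)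

/-- Negative integers are represented through `m - 1`, which is congruent to `-1`, because words are
unsigned. -/
theorem intResidue_cast {m : ℕ} (hm : 0 < m) (z : ℤ) : (intResidue m z : ZMod m) = z := by
  have hz : ∀ a : ℕ, ((a : ℤ) : ZMod m) = (a : ZMod m) := fun a => Int.cast_natCast a
  rw [intResidue]
  split_ifs with h
  · rw [← hz, Int.toNat_of_nonneg h]
  · have h₁ : (z.natAbs : ℤ) = -z := by omega
    rw [Nat.cast_mul, Nat.cast_sub hm, ZMod.natCast_self, ← hz, h₁]
    simp

/-- A constant modulo register `23`. -/
def intConst (z : ℤ) : WordExpr :=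
  if 0 ≤ z then const z.toNat else const z.natAbs * (reg 23 - const 1)

theorem eval_intConst (s : WordState) (z : ℤ) : (intConst z).eval s = intResidue (s.reg 23) z := by
  rw [intConst, intResidue]
  split_ifs <;> simp

/-- An entry of the transformed array, whose index is register `2`. -/
def passExpr (a : ℕ) (U : ℕ → ℕ → ℤ) (R X : ℕ) : WordExpr :=
  WordExpr.sum (fun x => WordExpr.sum (fun p => (reg 2 / reg 26).eq (const p) * intConst (U p x)) R *
    load a (reg 24 + (reg 2 % reg 26 * const X + const x))) X % reg 23

/-- Apply an `R × X` matrix to every digit of the index of the segment of array `a` that starts at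
register `24` and has the length register `25`; register `kr` holds the number of digits. -/
def transformProg (a kr : ℕ) (U : ℕ → ℕ → ℤ) (R X : ℕ) : WordProg :=
  forLoop 27 (reg kr) (block [.assign 26 (reg 25 / const X),
    fill 2 (const R * reg 26) a (reg 24 + reg 25 + reg 2) (passExpr a U R X),
    .assign 24 (reg 24 + reg 25), .assign 25 (const R * reg 26)])

/-- The result of one pass. -/
def passValue (m : ℕ) (U : ℕ → ℕ → ℤ) (R X H : ℕ) (f : ℕ → ℕ) (i : ℕ) : ℕ :=
  (∑ x ∈ Finset.range X, (∑ p ∈ Finset.range R, (if i / H = p then 1 else 0) * intResidue m (U p x)) *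
    f (i % H * X + x)) % m

/-- The inner sum is a table lookup: matrix entries are constants of the program, so the row is
selected by comparing the top digit with every `p`. -/
theorem passValue_cast {m : ℕ} (hm : 0 < m) (U : ℕ → ℕ → ℤ) {R X H : ℕ} (f : ℕ → ℕ) {p h : ℕ}
    (hp : p < R) (hh : h < H) : (passValue m U R X H f (p * H + h) : ZMod m) =
      ∑ x ∈ Finset.range X, (U p x : ZMod m) * (f (h * X + x) : ZMod m) := by
  rw [passValue, ZMod.natCast_mod, Nat.cast_sum]
  refine Finset.sum_congr rfl fun x _ => ?_
  rw [mul_add_mod_of_lt_right hh, mul_add_div_of_lt_right hh, Nat.cast_mul, Nat.cast_sum]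
  congr 1
  simp [intResidue_cast hm, hp]

/-- A pass removes the lowest base `X` digit of the index and puts a base `R` digit on top. After
`j` passes the top `j` digits are transformed, and the lower part still awaits its turn. -/
theorem transform_step {S : Type*} [CommRing S] (U : ℕ → ℕ → S) {R X G j : ℕ} {f g f' : ℕ → S}
    (hf : ∀ P < R ^ j, ∀ h < G * X, f (P * (G * X) + h) =
      ∑ I ∈ Finset.range (X ^ j), digitProd U R X j P I * g (h * X ^ j + I))
    (hf' : ∀ p < R, ∀ h < R ^ j * G, f' (p * (R ^ j * G) + h) =
      ∑ x ∈ Finset.range X, U p x * f (h * X + x))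
    {P : ℕ} (hP : P < R ^ (j + 1)) {h : ℕ} (hh : h < G) :
    f' (P * G + h) = ∑ I ∈ Finset.range (X ^ (j + 1)), digitProd U R X (j + 1) P I *
      g (h * X ^ (j + 1) + I) := by
  have hR : 0 < R ^ j := by
    rcases Nat.eq_zero_or_pos R with rfl | h
    · simp at hP
    · exact Nat.pow_pos h
  obtain ⟨p, P', hp, hP', rfl⟩ : ∃ p P', p < R ∧ P' < R ^ j ∧ P = p * R ^ j + P' :=
    ⟨P / R ^ j, P % R ^ j, Nat.div_lt_of_lt_mul (by rwa [pow_succ] at hP), Nat.mod_lt _ hR,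
      (Nat.div_add_mod' _ _).symm⟩
  have h₁ : P' * G + h < R ^ j * G := mul_add_lt_mul hP' hh
  rw [add_mul, mul_assoc, add_assoc, hf' p hp _ h₁, pow_succ', Finset.sum_range_mul_eq]
  refine Finset.sum_congr rfl fun x hx => ?_
  have hx' := Finset.mem_range.1 hx
  rw [show (P' * G + h) * X + x = P' * (G * X) + (h * X + x) by ring, hf P' hP' _ (mul_add_lt_mul hh hx'),
    Finset.mul_sum]
  refine Finset.sum_congr rfl fun I hI => ?_
  rw [digitProd_top U R X j hp hx' hP' (Finset.mem_range.1 hI), mul_assoc]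
  congr 3
  ring

/-- A Kronecker power is the composition of `k` maps that each act on one digit, and a pass costs a
constant times the size of the array. Here `B` bounds all intermediate sizes, and each result is put
behind the previous one, whence the bound on the final offset. -/
theorem transformProg_spec (a kr : ℕ) (U : ℕ → ℕ → ℤ) (R X : ℕ) (hX : 0 < X)
    (hkr : (transformProg a kr U R X).setsReg kr = false) :
    ∃ c, ∀ {K k m B H : ℕ} {s : WordState}, s.reg kr = k → s.reg 23 = m → 0 < m → m ≤ K →
      s.reg 25 = H * X ^ k → (∀ j ≤ k, R ^ j * (H * X ^ (k - j)) ≤ B) →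
      s.reg 24 + (k + 1) * (B + 1) ≤ K →
      Ensures K (transformProg a kr U R X) s (c * (B + 1) * (k + 1)) (fun s' =>
        s'.reg 25 = R ^ k * H ∧
        s'.reg 24 = s.reg 24 + ∑ j ∈ Finset.range k, R ^ j * (H * X ^ (k - j)) ∧
        ∀ P < R ^ k, ∀ h < H, (s'.arr a (s'.reg 24 + (P * H + h)) : ZMod m) =
          ∑ I ∈ Finset.range (X ^ k), digitProd (fun p x => (U p x : ZMod m)) R X k P I *
            (s.arr a (s.reg 24 + (h * X ^ k + I)) : ZMod m)) := by
  refine ⟨(reg kr).cost + 12 + ((const R * reg 26).cost + ((reg 24 + reg 25 + reg 2).cost +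
    (passExpr a U R X).cost + 1) + 12) + 12, fun {K k m B H s} hk h23 hm hmK h25 hB hK => ?_⟩
  set T₁ := (const R * reg 26).cost + ((reg 24 + reg 25 + reg 2).cost +
    (passExpr a U R X).cost + 1) + 12 with hT₁
  refine (Ensures.forLoop (T := 4 + (T₁ * (B + 1) + (4 + 4))) (fun j s' =>
      s'.reg 25 = R ^ j * (H * X ^ (k - j)) ∧
      s'.reg 24 = s.reg 24 + ∑ i ∈ Finset.range j, R ^ i * (H * X ^ (k - i)) ∧
      ∀ P < R ^ j, ∀ h < H * X ^ (k - j),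
        (s'.arr a (s'.reg 24 + (P * (H * X ^ (k - j)) + h)) : ZMod m) =
          ∑ I ∈ Finset.range (X ^ j), digitProd (fun p x => (U p x : ZMod m)) R X j P I *
            (s.arr a (s.reg 24 + (h * X ^ j + I)) : ZMod m)) (N := k) ?_ rfl ?_ ?_ ?_).mono ?_ ?_
  · nlinarith
  · intro s' hf
    exact (hf.1 kr hkr).trans hk
  · simp [h25, digitProd]
  · rintro j s' hj hf hi ⟨e25, e24, hI⟩
    obtain ⟨G, hG⟩ : ∃ G, G = H * X ^ (k - (j + 1)) := ⟨_, rfl⟩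
    have hGX : H * X ^ (k - j) = G * X := by
      rw [hG, mul_assoc, ← pow_succ]
      congr 2
      omega
    have e23 : s'.reg 23 = m := (hf.1 23 rfl).trans h23
    have hs : ∀ i ≤ j, ∑ i ∈ Finset.range i, R ^ i * (H * X ^ (k - i)) ≤ k * B := fun i hi =>
      calc _ ≤ ∑ i ∈ Finset.range i, B := Finset.sum_le_sum fun x hx =>
            hB x (by have := Finset.mem_range.1 hx; omega)
        _ ≤ k * B := by simpa using Nat.mul_le_mul_right B (by omega)
    have hB₁ := hB j (by omega)
    have hB₂ := hB (j + 1) (by omega)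
    rw [← hG, pow_succ'] at hB₂
    rw [hGX] at hI e25 hB₁
    have hsj := hs j le_rfl
    rw [add_mul, mul_add] at hK
    have hdiv : R ^ j * (G * X) / X = R ^ j * G := by rw [← mul_assoc, Nat.mul_div_cancel _ hX]
    refine Ensures.seq ⟨_, _, .assign 26 _ s' ?_, le_rfl, Ensures.seq ((Ensures.fill (N := R * (R ^ j * G))
      (off := s'.reg 24 + s'.reg 25) (F := passValue m U R X (R ^ j * G) fun i => s'.arr a (s'.reg 24 + i))
      ?_ ?_ ?_ ?_).mono ?_ fun s₂ hf₂ h₂ => Ensures.seq ⟨_, _, .assign 24 _ s₂ ?_, le_rfl,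
        _, _, .assign 25 _ _ ?_, le_rfl, ?_⟩)⟩
    · simp only [eval_div, eval_reg, eval_const, e25, hdiv]
      exact (Nat.le_mul_of_pos_right _ hX).trans (by rw [mul_assoc]; omega)
    · rw [← mul_assoc]; omega
    · intro s₂ hf₂
      simp [hf₂.1 26 rfl, e25, hdiv]
    · exact fun i _ => (Nat.mod_lt _ hm).le.trans hmK
    · intro i s₂ hi₂ hf₂ hr₂ ha₂
      have r23 : s₂.reg 23 = m := (hf₂.1 23 rfl).trans (by simp [e23])
      have r24 : s₂.reg 24 = s'.reg 24 := (hf₂.1 24 rfl).trans (by simp)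
      have r25 : s₂.reg 25 = s'.reg 25 := (hf₂.1 25 rfl).trans (by simp)
      have r26 : s₂.reg 26 = R ^ j * G := (hf₂.1 26 rfl).trans (by simp [e25, hdiv])
      refine ⟨by simp [r24, r25, hr₂], ?_⟩
      simp only [passExpr, eval_mod, eval_sum, eval_mul, eval_load, eval_add, eval_reg, eval_const,
        eval_eq, eval_div, eval_intConst, r23, r24, r26, hr₂, passValue]
      congr 1
      refine Finset.sum_congr rfl fun x hx => ?_
      have hx' := Finset.mem_range.1 hx
      have hH : 0 < R ^ j * G := by
        rcases Nat.eq_zero_or_pos (R ^ j * G) with h | h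
        · simp [h] at hi₂
        · exact h
      have hi₃ := Nat.mod_lt i hH
      have h₃ : i % (R ^ j * G) * X + x < R ^ j * (G * X) := by rw [← mul_assoc]; exact mul_add_lt_mul hi₃ hx'
      -- The cells that are read precede the segment being written.
      rw [ha₂, if_neg (by omega), WordState.setReg_arr]
    · simp only [← hT₁]
      refine Nat.mul_le_mul_left _ ?_
      rw [← mul_assoc]; omega
    · have r24 : s₂.reg 24 = s'.reg 24 := (hf₂.1 24 rfl).trans (by simp)
      have r25 : s₂.reg 25 = s'.reg 25 := (hf₂.1 25 rfl).trans (by simp)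
      simp only [eval_add, eval_reg, r24, r25, e24, e25]
      omega
    · have r26 : s₂.reg 26 = R ^ j * G := (hf₂.1 26 rfl).trans (by simp [e25, hdiv])
      simp only [eval_mul, eval_const, eval_reg, WordState.setReg_reg, r26, Nat.reduceEqDiff, if_false]
      rw [← mul_assoc]; omega
    · have r24 : s₂.reg 24 = s'.reg 24 := (hf₂.1 24 rfl).trans (by simp)
      have r25 : s₂.reg 25 = s'.reg 25 := (hf₂.1 25 rfl).trans (by simp)
      have r26 : s₂.reg 26 = R ^ j * G := (hf₂.1 26 rfl).trans (by simp [e25, hdiv])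
      simp only [eval_mul, eval_add, eval_const, eval_reg, WordState.setReg_reg, WordState.setReg_arr, r24,
        r25, r26, Nat.reduceEqDiff, if_false, if_true, ← hG]
      refine ⟨by rw [pow_succ']; ring, by rw [e24, e25, Finset.sum_range_succ, hGX]; ring, ?_⟩
      intro P hP h hh
      refine transform_step (fun p x => (U p x : ZMod m)) (f := fun i => (s'.arr a (s'.reg 24 + i) : ZMod m))
        (g := fun i => (s.arr a (s.reg 24 + i) : ZMod m))
        (f' := fun i => (s₂.arr a (s'.reg 24 + s'.reg 25 + i) : ZMod m)) hI ?_ hP hh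
      intro p hp h hh
      have hlt := mul_add_lt_mul hp hh
      rw [h₂, if_pos ⟨by omega, by omega⟩, Nat.add_sub_cancel_left, passValue_cast hm U _ hp hh]
  · have : (reg kr).cost = 1 := rfl
    rw [this]
    refine Nat.mul_le_mul_right _ ?_
    nlinarith
  · rintro s' - ⟨h₁, h₂, h₃⟩
    simp only [Nat.sub_self, pow_zero, mul_one] at h₁ h₃
    exact ⟨h₁, h₂, h₃⟩

/-- For a transform that enlarges the data, the final size bounds all intermediate ones; for one
that shrinks them, the next lemma gives the initial size. -/
theorem pow_mul_pow_sub_le {R X k j : ℕ} (h : X ≤ R) (hj : j ≤ k) : R ^ j * X ^ (k - j) ≤ R ^ k :=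
  calc R ^ j * X ^ (k - j) ≤ R ^ j * R ^ (k - j) := Nat.mul_le_mul_left _ (Nat.pow_le_pow_left h _)
    _ = R ^ k := by rw [← pow_add, Nat.add_sub_cancel' hj]

theorem pow_mul_pow_sub_le' {R X k j : ℕ} (h : R ≤ X) (hj : j ≤ k) : R ^ j * X ^ (k - j) ≤ X ^ k :=
  calc R ^ j * X ^ (k - j) ≤ X ^ j * X ^ (k - j) := Nat.mul_le_mul_right _ (Nat.pow_le_pow_left h _)
    _ = X ^ k := by rw [← pow_add, Nat.add_sub_cancel' hj]

/-- The total size of the intermediate results of a transform. -/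
def segOffset (R X k H : ℕ) : ℕ := ∑ j ∈ Finset.range k, R ^ j * (H * X ^ (k - j))

/-- Apply the tensor product of the powers of two matrices, with exponents in the registers `18` and
`20`. -/
def tensorTransform (a : ℕ) (U : ℕ → ℕ → ℤ) (R X : ℕ) (U' : ℕ → ℕ → ℤ) (R' X' : ℕ) : WordProg :=
  .seq (transformProg a 18 U R X) (transformProg a 20 U' R' X')

/-- The first transform moves its digits to the top and leaves those of the second at the bottom.
The second transform moves these to the top, which restores the order. -/
theorem tensorTransform_spec (a : ℕ) (U : ℕ → ℕ → ℤ) (R X : ℕ) (U' : ℕ → ℕ → ℤ) (R' X' : ℕ)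
    (hX : 0 < X) (hX' : 0 < X') :
    ∃ c, ∀ {K k l m B : ℕ} {s : WordState}, s.reg 18 = k → s.reg 20 = l → s.reg 23 = m → 0 < m →
      m ≤ K → s.reg 25 = X' ^ l * X ^ k → (∀ j ≤ k, R ^ j * (X' ^ l * X ^ (k - j)) ≤ B) →
      (∀ j ≤ l, R' ^ j * (R ^ k * X' ^ (l - j)) ≤ B) → s.reg 24 + (k + l + 1) * (B + 1) ≤ K →
      Ensures K (tensorTransform a U R X U' R' X') s (c * (B + 1) * (k + l + 1)) (fun s' =>
        s'.reg 25 = R' ^ l * R ^ k ∧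
        s'.reg 24 = s.reg 24 + (segOffset R X k (X' ^ l) + segOffset R' X' l (R ^ k)) ∧
        ∀ i < R' ^ l * R ^ k, (s'.arr a (s'.reg 24 + i) : ZMod m) =
          ∑ I ∈ Finset.range (X' ^ l * X ^ k), prodKernel (fun p x => (U p x : ZMod m)) R X k
            (fun p x => (U' p x : ZMod m)) R' X' l i I * (s.arr a (s.reg 24 + I) : ZMod m)) := by
  obtain ⟨c, hc⟩ := transformProg_spec a 18 U R X hX rfl
  obtain ⟨c', hc'⟩ := transformProg_spec a 20 U' R' X' hX' rfl
  refine ⟨c + c', fun {K k l m B s} h18 h20 h23 hm hmK h25 hB hB' hK => ?_⟩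
  refine Ensures.seq_of (hc h18 h23 hm hmK h25 hB (by nlinarith)) (fun s₁ hf₁ ⟨e25, e24, h₁⟩ =>
    (hc' ((hf₁.1 20 rfl).trans h20) ((hf₁.1 23 rfl).trans h23) hm hmK (e25.trans rfl) hB' ?_).mono
      le_rfl fun s₂ hf₂ ⟨f25, f24, h₂⟩ => ?_) ?_
  · have : ∑ j ∈ Finset.range k, R ^ j * (X' ^ l * X ^ (k - j)) ≤ k * B := by
      simpa using Finset.sum_le_card_nsmul (Finset.range k) _ B
        fun j hj => hB j (Finset.mem_range.1 hj).le
    nlinarith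
  · refine ⟨f25, by rw [f24, e24, add_assoc]; rfl, fun i hi => ?_⟩
    have hR : 0 < R ^ k := by
      rcases Nat.eq_zero_or_pos (R ^ k) with h | h
      · simp [h] at hi
      · exact h
    have hP' : i / R ^ k < R' ^ l := Nat.div_lt_of_lt_mul (by rwa [mul_comm] at hi)
    have hP := Nat.mod_lt i hR
    have h₃ := h₂ _ hP' _ hP
    rw [div_mul_add_mod] at h₃
    rw [h₃, Finset.sum_range_mul_eq]
    refine Finset.sum_congr rfl fun h hh => ?_
    rw [h₁ _ hP _ (Finset.mem_range.1 hh), Finset.mul_sum]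
    refine Finset.sum_congr rfl fun I hI => ?_
    have hI' := Finset.mem_range.1 hI
    rw [prodKernel, mul_add_mod_of_lt_right hI', mul_add_div_of_lt_right hI']
    ring
  · have h₁ : c * (B + 1) * (k + 1) ≤ c * (B + 1) * (k + l + 1) := Nat.mul_le_mul_left _ (by omega)
    have h₂ : c' * (B + 1) * (l + 1) ≤ c' * (B + 1) * (k + l + 1) := Nat.mul_le_mul_left _ (by omega)
    linarith

theorem sum_bilinear {S : Type*} [CommRing S] (A B C : ℕ → ℕ → S) (f g : ℕ → S) (z r X Y : ℕ) :
    ∑ P ∈ Finset.range r, C z P * ((∑ I ∈ Finset.range X, A P I * f I) *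
        ∑ J ∈ Finset.range Y, B P J * g J) =
      ∑ I ∈ Finset.range X, ∑ J ∈ Finset.range Y,
        (∑ P ∈ Finset.range r, C z P * A P I * B P J) * (f I * g J) := by
  simp only [Finset.sum_mul_sum]
  simp only [Finset.mul_sum, Finset.sum_mul]
  rw [Finset.sum_comm]
  refine Finset.sum_congr rfl fun I _ => ?_
  rw [Finset.sum_comm]
  refine Finset.sum_congr rfl fun J _ => Finset.sum_congr rfl fun P _ => ?_
  ring

/-- Multiply the arrays `12` and `13` with respect to the tensor product of powers of two bilinear maps,
given by schemes of ranks `r` and `r'`. Register `22` holds the size of the arrays. The result is stored in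
array `14`, from the index register `24` on. -/
def bilinearProg (r X Z : ℕ) (U V W : ℕ → ℕ → ℤ) (r' X' Z' : ℕ) (U' V' W' : ℕ → ℕ → ℤ) : WordProg :=
  block [.assign 24 (const 0), .assign 25 (reg 17 * reg 17 * reg 19), tensorTransform 12 U r X U' r' X',
    .assign 24 (const 0), .assign 25 (reg 17 * reg 17 * reg 19), tensorTransform 13 V r X V' r' X',
    fill 2 (reg 25) 14 (reg 2) (load 12 (reg 24 + reg 2) * load 13 (reg 24 + reg 2) % reg 23),
    .assign 24 (const 0), tensorTransform 14 W Z r W' Z' r']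

/-- Both inputs are transformed into the linear forms, multiplied pointwise modulo `m`, and
transformed back. The rank bounds all intermediate sizes because `X ≤ r`, `Z ≤ r`, `X' ≤ r'` and `Z'
≤ r'`. -/
theorem bilinearProg_spec {r X Z : ℕ} {T : ℕ → ℕ → ℕ → ℤ} {U V W : ℕ → ℕ → ℤ} (h : IsScheme r X Z T U V W)
    {r' X' Z' : ℕ} {T' : ℕ → ℕ → ℕ → ℤ} {U' V' W' : ℕ → ℕ → ℤ} (h' : IsScheme r' X' Z' T' U' V' W')
    (hX : 0 < X) (hZ : 0 < Z) (hX' : 0 < X') (hZ' : 0 < Z') (hXr : X ≤ r) (hZr : Z ≤ r) (hXr' : X' ≤ r')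
    (hZr' : Z' ≤ r') :
    ∃ c, ∀ {K k l m : ℕ} {s : WordState}, s.reg 18 = k → s.reg 20 = l → s.reg 23 = m → 0 < m →
      m ≤ K → s.reg 17 * s.reg 17 = X ^ k → s.reg 19 = X' ^ l →
      (k + l + 2) * (r' ^ l * r ^ k + 1) ≤ K →
      Ensures K (bilinearProg r X Z U V W r' X' Z' U' V' W') s (c * (r' ^ l * r ^ k + 1) * (k + l + 1))
        (fun s' => ∀ z < Z' ^ l * Z ^ k, (s'.arr 14 (s'.reg 24 + z) : ZMod m) =
          ∑ I ∈ Finset.range (X' ^ l * X ^ k), ∑ J ∈ Finset.range (X' ^ l * X ^ k),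
            tensorPow (fun x y z => (T x y z : ZMod m)) X Z k (I % X ^ k) (J % X ^ k) (z % Z ^ k) *
            tensorPow (fun x y z => (T' x y z : ZMod m)) X' Z' l (I / X ^ k) (J / X ^ k) (z / Z ^ k) *
              ((s.arr 12 I : ZMod m) * (s.arr 13 J : ZMod m))) := by
  have hr : 0 < r := by omega
  have hr' : 0 < r' := by omega
  obtain ⟨c₁, hc₁⟩ := tensorTransform_spec 12 U r X U' r' X' hX hX'
  obtain ⟨c₂, hc₂⟩ := tensorTransform_spec 13 V r X V' r' X' hX hX'
  obtain ⟨c₃, hc₃⟩ := tensorTransform_spec 14 W Z r W' Z' r' hr hr'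
  obtain ⟨c₄, hc₄⟩ : ∃ c, c = (reg 25).cost + ((reg 2).cost +
    (load 12 (reg 24 + reg 2) * load 13 (reg 24 + reg 2) % reg 23).cost + 1) + 12 := ⟨_, rfl⟩
  refine ⟨20 + c₁ + c₂ + c₃ + c₄, fun {K k l m s} h18 h20 h23 hm hmK h17 h19 hK => ?_⟩
  obtain ⟨B, hB⟩ : ∃ B, B = r' ^ l * r ^ k := ⟨_, rfl⟩
  rw [← hB] at hK ⊢
  have hsize : X' ^ l * X ^ k ≤ B := by
    rw [hB]; exact Nat.mul_le_mul (Nat.pow_le_pow_left hXr' _) (Nat.pow_le_pow_left hXr _)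
  have hB₁ : ∀ j ≤ k, r ^ j * (X' ^ l * X ^ (k - j)) ≤ B := fun j hj => by
    rw [mul_left_comm, hB]
    exact Nat.mul_le_mul (Nat.pow_le_pow_left hXr' _) (pow_mul_pow_sub_le hXr hj)
  have hB₂ : ∀ j ≤ l, r' ^ j * (r ^ k * X' ^ (l - j)) ≤ B := fun j hj => by
    rw [mul_left_comm, hB, mul_comm (r' ^ l)]
    exact Nat.mul_le_mul_left _ (pow_mul_pow_sub_le hXr' hj)
  have hB₃ : ∀ j ≤ k, Z ^ j * (r' ^ l * r ^ (k - j)) ≤ B := fun j hj => by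
    rw [mul_left_comm, hB]
    exact Nat.mul_le_mul_left _ (pow_mul_pow_sub_le' hZr hj)
  have hB₄ : ∀ j ≤ l, Z' ^ j * (Z ^ k * r' ^ (l - j)) ≤ B := fun j hj => by
    rw [mul_left_comm, hB, mul_comm (r' ^ l)]
    exact Nat.mul_le_mul (Nat.pow_le_pow_left hZr _) (pow_mul_pow_sub_le' hZr' hj)
  have hBK : B ≤ K := by nlinarith
  have hK' : 0 + (k + l + 1) * (B + 1) ≤ K := by nlinarith
  have s25 : s.reg 17 * s.reg 17 * s.reg 19 = X' ^ l * X ^ k := by rw [h17, h19, mul_comm]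
  refine Ensures.mono (T := 2 + (6 + (c₁ * (B + 1) * (k + l + 1) + (2 + (6 + (c₂ * (B + 1) * (k + l + 1) +
    (c₄ * (B + 1) + (2 + c₃ * (B + 1) * (k + l + 1))))))))) ?_ ?_ fun _ _ h => h
  · refine Ensures.seq ⟨_, _, .assign 24 _ s (Nat.zero_le _), le_rfl, Ensures.seq ⟨_, _, .assign 25 _ _ ?_,
      le_rfl, Ensures.seq ((hc₁ (K := K) (k := k) (l := l) (m := m) (B := B) ?_ ?_ ?_ hm hmK ?_ hB₁ hB₂ ?_).mono
        le_rfl ?_)⟩⟩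
    · simp [s25]; omega
    · simp [h18]
    · simp [h20]
    · simp [h23]
    · simp [s25]
    · simpa using hK'
    rintro s₁ hf₁ ⟨e25, e24, ha₁⟩
    have f17 : s₁.reg 17 = s.reg 17 := (hf₁.1 17 rfl).trans (by simp)
    have f19 : s₁.reg 19 = s.reg 19 := (hf₁.1 19 rfl).trans (by simp)
    have f18 : s₁.reg 18 = k := (hf₁.1 18 rfl).trans (by simp [h18])
    have f20 : s₁.reg 20 = l := (hf₁.1 20 rfl).trans (by simp [h20])
    have f23 : s₁.reg 23 = m := (hf₁.1 23 rfl).trans (by simp [h23])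
    have f13 : s₁.arr 13 = s.arr 13 := (hf₁.2 13 rfl).trans (by simp)
    simp only [WordState.setReg_reg, WordState.setReg_arr, eval_const, Nat.reduceEqDiff, if_false, if_true, zero_add]
      at ha₁ e24
    refine Ensures.seq ⟨_, _, .assign 24 _ s₁ (Nat.zero_le _), le_rfl, Ensures.seq ⟨_, _, .assign 25 _ _ ?_,
      le_rfl, Ensures.seq ((hc₂ (K := K) (k := k) (l := l) (m := m) (B := B) ?_ ?_ ?_ hm hmK ?_ hB₁ hB₂ ?_).mono
        le_rfl ?_)⟩⟩
    · simp [f17, f19, s25]; omega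
    · simp [f18]
    · simp [f20]
    · simp [f23]
    · simp [f17, f19, s25]
    · simpa using hK'
    rintro s₂ hf₂ ⟨g25, g24, ha₂⟩
    have g18 : s₂.reg 18 = k := (hf₂.1 18 rfl).trans (by simp [f18])
    have g20 : s₂.reg 20 = l := (hf₂.1 20 rfl).trans (by simp [f20])
    have g23 : s₂.reg 23 = m := (hf₂.1 23 rfl).trans (by simp [f23])
    have g12 : s₂.arr 12 = s₁.arr 12 := (hf₂.2 12 rfl).trans (by simp)
    simp only [WordState.setReg_reg, WordState.setReg_arr, eval_const, Nat.reduceEqDiff, if_false, if_true, zero_add,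
      f13] at ha₂ g24
    -- The final offset depends only on the sizes, so both transformed inputs start at the same
    -- index.
    rw [← e24] at g24
    refine Ensures.seq ((Ensures.fill (N := B) (off := 0) (F := fun i =>
      s₁.arr 12 (s₁.reg 24 + i) * s₂.arr 13 (s₁.reg 24 + i) % m) hBK ?_ ?_ ?_).mono ?_ ?_)
    · intro s₃ hf₃
      simp [hf₃.1 25 rfl, g25, hB]
    · exact fun i _ => (Nat.mod_lt _ hm).le.trans hmK
    · intro i s₃ _ hf₃ hr₃ _
      simp [hf₃.1 24 rfl, hf₃.1 23 rfl, hf₃.2 12 rfl, hf₃.2 13 rfl, hr₃, g24, g23, g12]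
    · simp only [hc₄]; exact le_rfl
    rintro s₃ hf₃ ha₃
    have i18 : s₃.reg 18 = k := (hf₃.1 18 rfl).trans g18
    have i20 : s₃.reg 20 = l := (hf₃.1 20 rfl).trans g20
    have i23 : s₃.reg 23 = m := (hf₃.1 23 rfl).trans g23
    have i25 : s₃.reg 25 = r' ^ l * r ^ k := (hf₃.1 25 rfl).trans g25
    refine Ensures.seq ⟨_, _, .assign 24 _ s₃ (Nat.zero_le _), le_rfl,
      (hc₃ (K := K) (k := k) (l := l) (m := m) (B := B) ?_ ?_ ?_ hm hmK ?_ hB₃ hB₄ ?_).mono le_rfl ?_⟩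
    · simp [i18]
    · simp [i20]
    · simp [i23]
    · simp [i25]
    · simpa using hK'
    rintro s₄ hf₄ ⟨-, -, ha₄⟩ z hz
    simp only [WordState.setReg_reg, WordState.setReg_arr, eval_const, if_true, zero_add] at ha₄
    rw [ha₄ z hz]
    have hcast : ∀ {r X Z : ℕ} {T : ℕ → ℕ → ℕ → ℤ} {U V W : ℕ → ℕ → ℤ}, IsScheme r X Z T U V W →
        ∀ x < X, ∀ y < X, ∀ z < Z, ∑ p ∈ Finset.range r, (W z p : ZMod m) * (U p x : ZMod m) * (V p y : ZMod m) =
          (T x y z : ZMod m) := fun h x hx y hy z hz => by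
      rw [← h x hx y hy z hz]; push_cast; rfl
    simp only [← sum_prodKernel hX hZ (hcast h) hX' hZ' (hcast h')]
    rw [← sum_bilinear]
    refine Finset.sum_congr rfl fun P hP => ?_
    have hP' := Finset.mem_range.1 hP
    rw [ha₃, if_pos ⟨Nat.zero_le _, by omega⟩, Nat.sub_zero, ZMod.natCast_mod, Nat.cast_mul, ha₁ P hP',
      ← g24, ha₂ P hP']
  · have h₁ : 20 + c₄ * (B + 1) ≤ (20 + c₄) * (B + 1) * (k + l + 1) := by
      calc 20 + c₄ * (B + 1) ≤ (20 + c₄) * (B + 1) * 1 := by nlinarith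
        _ ≤ _ := Nat.mul_le_mul_left _ (by omega)
    linarith

/-! ### Counting two-edge extensions with the tensor product -/

/-- A histogram is a sum of unit vectors at the keys, so pairing it with `φ` adds up `φ` over the
keys. -/
theorem sum_card_fiber_mul {S : Type*} [CommRing S] (N B : ℕ) (p : ℕ → Prop) [DecidablePred p] (κ : ℕ → ℕ)
    (hκ : ∀ x < N, p x → κ x < B) (φ : ℕ → S) :
    ∑ I ∈ Finset.range B, φ I * (((Finset.range N).filter fun x => p x ∧ κ x = I).card : S) =
      ∑ x ∈ Finset.range N, if p x then φ (κ x) else 0 := by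
  simp only [Finset.card_filter, Nat.cast_sum, Finset.mul_sum]
  rw [Finset.sum_comm]
  refine Finset.sum_congr rfl fun x hx => ?_
  by_cases h : p x
  · rw [Finset.sum_eq_single (κ x)]
    · simp [h]
    · intro I _ hI
      simp [Ne.symm hI]
    · intro hI
      exact absurd (Finset.mem_range.2 (hκ x (Finset.mem_range.1 hx) h)) hI
  · simp [h]

theorem sum_sum_card_fiber_mul {S : Type*} [CommRing S] (N B : ℕ) (p q : ℕ → Prop) [DecidablePred p]
    [DecidablePred q] (κ μ : ℕ → ℕ) (hκ : ∀ x < N, p x → κ x < B) (hμ : ∀ x < N, q x → μ x < B)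
    (φ : ℕ → ℕ → S) :
    ∑ I ∈ Finset.range B, ∑ J ∈ Finset.range B, φ I J *
        ((((Finset.range N).filter fun x => p x ∧ κ x = I).card : S) *
          (((Finset.range N).filter fun x => q x ∧ μ x = J).card : S)) =
      ∑ x ∈ Finset.range N, ∑ y ∈ Finset.range N, if p x ∧ q y then φ (κ x) (μ y) else 0 := by
  have h : ∀ I, ∑ J ∈ Finset.range B, φ I J *
        ((((Finset.range N).filter fun x => p x ∧ κ x = I).card : S) *
          (((Finset.range N).filter fun x => q x ∧ μ x = J).card : S)) =
      (∑ y ∈ Finset.range N, if q y then φ I (μ y) else 0) *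
        (((Finset.range N).filter fun x => p x ∧ κ x = I).card : S) := by
    intro I
    rw [← sum_card_fiber_mul N B q μ hμ (φ I), Finset.sum_mul]
    exact Finset.sum_congr rfl fun J _ => by ring
  simp only [h]
  rw [sum_card_fiber_mul N B p κ hκ fun I => ∑ y ∈ Finset.range N, if q y then φ I (μ y) else 0]
  refine Finset.sum_congr rfl fun x _ => ?_
  by_cases hp : p x
  · simp [hp]
  · simp [hp]

/-- The product of the two histograms at position `(z; s, v)` collects pairs of cells `(s, u)` and
`(u, v)` whose recoded exponents add up to `z`. The matrix factor contributes `1` to each such pair,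
the polynomial factor `D ^ l`. -/
theorem sum_tensorPow_eq_card {S : Type*} [CommRing S] {n a k d e l : ℕ} (D : ℕ) (ha : 0 < a) (hd : 0 < d)
    (he : e = 2 * d - 1) (hn : n ≤ a ^ k) (p q : ℕ → Prop) [DecidablePred p] [DecidablePred q] (Y w : ℕ → ℕ)
    (hY : ∀ x < n * n, p x → Y x < d ^ l) (hw : ∀ x < n * n, q x → w x < d ^ l) {s v z : ℕ} (hs : s < n)
    (hv : v < n) (hz : z < e ^ l) :
    ∑ I ∈ Finset.range (d ^ l * (a * a) ^ k), ∑ J ∈ Finset.range (d ^ l * (a * a) ^ k),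
        tensorPow (fun x y z => (matMulTensor a x y z : S)) (a * a) (a * a) k (I % (a * a) ^ k)
            (J % (a * a) ^ k) ((z * (a * a) ^ k + pairCode a k s v) % (a * a) ^ k) *
          tensorPow (fun x y z => (polyMulTensor D x y z : S)) d e l (I / (a * a) ^ k) (J / (a * a) ^ k)
            ((z * (a * a) ^ k + pairCode a k s v) / (a * a) ^ k) *
          ((((Finset.range (n * n)).filter fun x => p x ∧
              Y x * (a * a) ^ k + pairCode a k (x / n) (x % n) = I).card : S) *
            (((Finset.range (n * n)).filter fun x => q x ∧
              w x * (a * a) ^ k + pairCode a k (x / n) (x % n) = J).card : S)) =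
      ((D ^ l * ((Finset.range n).filter fun u => p (s * n + u) ∧ q (u * n + v) ∧
        rebase d e l (Y (s * n + u)) + rebase d e l (w (u * n + v)) = z).card : ℕ) : S) := by
  have hc := fun x y => pairCode_lt ha k x y
  have hlt : ∀ y < d ^ l, ∀ i j, y * (a * a) ^ k + pairCode a k i j < d ^ l * (a * a) ^ k :=
    fun y hy i j => mul_add_lt_mul hy (hc i j)
  rw [sum_sum_card_fiber_mul (n * n) (d ^ l * (a * a) ^ k) p q _ _ (fun x hx hp => hlt _ (hY x hx hp) _ _)
    (fun x hx hp => hlt _ (hw x hx hp) _ _)]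
  simp only [mul_add_mod_of_lt_right (hc _ _), mul_add_div_of_lt_right (hc _ _)]
  have key : ∀ x ∈ Finset.range (n * n), ∀ y ∈ Finset.range (n * n), (if p x ∧ q y then
      tensorPow (fun x y z => (matMulTensor a x y z : S)) (a * a) (a * a) k (pairCode a k (x / n) (x % n))
          (pairCode a k (y / n) (y % n)) (pairCode a k s v) *
        tensorPow (fun x y z => (polyMulTensor D x y z : S)) d e l (Y x) (w y) z else 0) =
      if x / n = s ∧ y / n = x % n ∧ y % n = v then
        (if p x ∧ q y ∧ rebase d e l (Y x) + rebase d e l (w y) = z then (D : S) ^ l else 0) else 0 := by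
    intro x hx y hy
    rw [Finset.mem_range] at hx hy
    have h₁ := div_lt_of_lt_sq hx
    have h₂ := mod_lt_of_lt_sq hx
    have h₃ := div_lt_of_lt_sq hy
    have h₄ := mod_lt_of_lt_sq hy
    by_cases hpq : p x ∧ q y
    · rw [if_pos hpq, tensorPow_matMulTensor ha k (by omega) (by omega) (by omega) (by omega) (by omega)
        (by omega), tensorPow_polyMulTensor D hd he l (hY x hx hpq.1) (hw y hy hpq.2) hz]
      simp only [hpq.1, hpq.2, true_and, eq_comm (a := y / n), ite_mul, one_mul, zero_mul, Int.cast_natCast]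
    · rw [if_neg hpq, if_neg (c := p x ∧ q y ∧ _) (by tauto), ite_self]
  rw [Finset.sum_congr rfl fun x hx => Finset.sum_congr rfl (key x hx), Finset.sum_range_mul_eq]
  have key₂ : ∀ i ∈ Finset.range n, ∀ u ∈ Finset.range n, ∑ y ∈ Finset.range (n * n),
      (if (i * n + u) / n = s ∧ y / n = (i * n + u) % n ∧ y % n = v then
        (if p (i * n + u) ∧ q y ∧ rebase d e l (Y (i * n + u)) + rebase d e l (w y) = z then (D : S) ^ l
          else 0) else 0) =
      if i = s then (if p (i * n + u) ∧ q (u * n + v) ∧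
        rebase d e l (Y (i * n + u)) + rebase d e l (w (u * n + v)) = z then (D : S) ^ l else 0) else 0 := by
    intro i hi u hu
    rw [Finset.mem_range] at hi hu
    rw [mul_add_div_of_lt_right hu, mul_add_mod_of_lt_right hu, Finset.sum_eq_single (u * n + v)]
    · simp [mul_add_div_of_lt_right hv, mul_add_mod_of_lt_right hv]
    · intro y hy hne
      refine if_neg fun h => hne ?_
      rw [← h.2.1, ← h.2.2, div_mul_add_mod]
    · intro h
      exact absurd (Finset.mem_range.2 (mul_add_lt_sq hu hv)) h
  rw [Finset.sum_congr rfl fun i hi => Finset.sum_congr rfl (key₂ i hi), Finset.sum_eq_single s]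
  · rw [Nat.cast_mul, Nat.cast_pow, Finset.card_filter, Nat.cast_sum, Finset.mul_sum]
    simp
  · intro i _ hi
    simp [hi]
  · intro h
    exact absurd (Finset.mem_range.2 hs) h

/-! ### Parameters and tables -/

/-- A leading zero digit changes nothing. This turns the recursion in `k` into a recursion between
entries of one table with fixed `k`. -/
theorem pairCode_succ_of_lt {a k s u : ℕ} (hs : s < a ^ k) (hu : u < a ^ k) :
    pairCode a (k + 1) s u = pairCode a k s u := by
  induction k generalizing s u with
  | zero =>
    simp only [pow_zero, Nat.lt_one_iff] at hs hu
    simp [pairCode, hs, hu]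
  | succ k ih =>
    have hlt : ∀ {x : ℕ}, x < a ^ (k + 1) → x / a < a ^ k := fun hx =>
      Nat.div_lt_of_lt_mul (by rwa [pow_succ'] at hx)
    rw [pairCode, ih (hlt hs) (hlt hu), pairCode]

theorem rebase_succ_of_lt {d e k y : ℕ} (hy : y < d ^ k) : rebase d e (k + 1) y = rebase d e k y := by
  induction k generalizing y with
  | zero =>
    simp only [pow_zero, Nat.lt_one_iff] at hy
    simp [rebase, hy]
  | succ k ih =>
    rw [rebase, ih (Nat.div_lt_of_lt_mul (by rwa [pow_succ'] at hy)), rebase]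

/-- Compute in register `x` the least power of `c` that is not less than the bound, and in register `y` its
exponent. -/
def powLoop (x y c : ℕ) (bound : WordExpr) : WordProg :=
  block [.assign x (const 1), .assign y (const 0),
    .loop ((reg x).lt bound) (block [.assign x (reg x * const c), .assign y (reg y + const 1)])]

theorem powLoop_spec {K x y c N : ℕ} {bound : WordExpr} {s : WordState} (hc : 2 ≤ c) (hxy : x ≠ y)
    (hb : ∀ s', (powLoop x y c bound).Frame s s' → bound.eval s' = N) (hK : c ^ Nat.clog c N ≤ K) :
    Ensures K (powLoop x y c bound) s ((bound.cost + 20) * (Nat.clog c N + 1))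
      (fun s' => s'.reg x = c ^ Nat.clog c N ∧ s'.reg y = Nat.clog c N) := by
  have hpos : 1 ≤ c ^ Nat.clog c N := Nat.pow_pos (by omega)
  have hlt : Nat.clog c N < c ^ Nat.clog c N := Nat.lt_pow_self (by omega)
  refine Ensures.mono (T := 2 + (2 + (Nat.clog c N * (((reg x).lt bound).cost + 1 + 8) +
    (((reg x).lt bound).cost + 1)))) ?_ ?_ fun _ _ h => h
  · refine Ensures.seq ⟨_, _, .assign x _ s (hpos.trans hK), le_rfl, Ensures.seq ⟨_, _, .assign y _ _
      (Nat.zero_le _), le_rfl, ?_⟩⟩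
    refine Ensures.loop_count (fun j s' => s'.reg x = c ^ j ∧ s'.reg y = j) (Nat.clog c N) ?_ ?_ ?_
    · simp [hxy]
    · rintro j s' hf ⟨h₁, -⟩
      rw [Ne, eval_lt_eq_zero, eval_reg, h₁, hb, Nat.lt_clog_iff_pow_lt (by omega), not_le]
      refine ⟨fun a ha => ?_, fun a ha => ?_⟩
      · simp only [powLoop, block, setsReg, Bool.or_eq_false_iff, beq_eq_false_iff_ne] at ha
        rw [hf.1 a (by simp [block, setsReg, ha])]
        simp [ha.1, ha.2.1]
      · rw [hf.2 a (by simp [block, setsArr])]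
        simp
    · rintro j s' hj hf ⟨h₁, h₂⟩
      have h₃ : c ^ (j + 1) ≤ K := (Nat.pow_le_pow_right (by omega) hj).trans hK
      refine (Ensures.of_wp ?_).mono (T := (block [.assign x (reg x * const c),
        .assign y (reg y + const 1)]).cost) le_rfl fun _ _ h => h
      simp [block, wp, h₁, h₂, hxy, Ne.symm hxy, ← pow_succ, h₃]
      omega
  · simp [WordExpr.lt, WordExpr.cost]
    nlinarith

/-- Compute the table of `rebase`. -/
def rebaseTable (a : ℕ) (bound : WordExpr) (d e : ℕ) : WordProg :=
  fill 2 bound a (reg 2) (load a (reg 2 / const d) * const e + reg 2 % const d)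

/-- Entry `y` is computed from entry `y / d`, which is smaller unless `y = 0`; entry `0` reads
itself, so the initial content `0` matters. -/
theorem rebaseTable_spec {K a d e l : ℕ} {bound : WordExpr} {s : WordState} (hd : 2 ≤ d)
    (hb : ∀ s', (rebaseTable a bound d e).Frame s s' → bound.eval s' = d ^ l) (hK : d ^ l ≤ K)
    (hK' : ∀ y, rebase d e l y ≤ K) (h₀ : s.arr a 0 = 0) :
    Ensures K (rebaseTable a bound d e) s ((bound.cost + 30) * (d ^ l + 1))
      (fun s' => ∀ y < d ^ l, s'.arr a y = rebase d e l y) := by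
  have h0 : ∀ k, rebase d e k 0 = 0 := fun k => by
    induction k with
    | zero => rfl
    | succ k ih => simp [rebase, ih]
  refine (Ensures.fill (off := 0) (F := rebase d e l) hK hb (fun j _ => hK' j) ?_).mono ?_ ?_
  · intro j s' hj hf hi hI
    refine ⟨by simp [hi], ?_⟩
    have hdiv : s'.arr a (j / d) = rebase d e l (j / d) := by
      rw [hI]
      split_ifs with h
      · simp
      · have hj₀ : j = 0 := by
          by_contra hne
          exact h ⟨Nat.zero_le _, (Nat.div_lt_self (Nat.pos_of_ne_zero hne) hd).trans_eq (zero_add j).symm⟩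
        simp [hj₀, h₀, h0]
    rw [← rebase_succ_of_lt hj, rebase]
    simp [hi, hdiv]
  · refine Nat.mul_le_mul_right _ ?_
    change bound.cost + (1 + 10 + 1) + 12 ≤ bound.cost + 30
    omega
  · intro s' _ h y hy
    simpa [hy] using h y

/-- The parameters of the tensor product. -/
structure HasParams (n M a d D k l : ℕ) (s : WordState) : Prop where
  side : s.reg 17 = a ^ k
  sideExp : s.reg 18 = k
  deg : s.reg 19 = d ^ l
  degExp : s.reg 20 = l
  prodDeg : s.reg 21 = (2 * d - 1) ^ l
  scale : s.reg 22 = D ^ l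
  modulus : s.reg 23 = (n + 1) * D ^ l

/-- Compute the parameters. -/
def paramProg (a d D : ℕ) : WordProg :=
  block [powLoop 17 18 a (reg 0), powLoop 19 20 d (reg 1 + const 1), .assign 21 (const 1),
    .assign 22 (const 1), forLoop 2 (reg 20) (block [.assign 21 (reg 21 * const (2 * d - 1)),
      .assign 22 (reg 22 * const D)]), .assign 23 ((reg 0 + const 1) * reg 22)]

theorem paramProg_spec {a d D : ℕ} (ha : 2 ≤ a) (hd : 2 ≤ d) (hD : 0 < D) : ∃ c, ∀ {K n M : ℕ} {s : WordState},
    s.reg 0 = n → s.reg 1 = M → a ^ Nat.clog a n ≤ K → (2 * d - 1) ^ Nat.clog d (M + 1) ≤ K →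
    (n + 1) * D ^ Nat.clog d (M + 1) ≤ K →
    Ensures K (paramProg a d D) s (c * (Nat.clog a n + Nat.clog d (M + 1) + 1))
      (HasParams n M a d D (Nat.clog a n) (Nat.clog d (M + 1))) := by
  refine ⟨100, fun {K n M s} h0 h1 hK₁ hK₂ hK₃ => ?_⟩
  set k := Nat.clog a n
  set l := Nat.clog d (M + 1)
  have hdl : d ^ l ≤ (2 * d - 1) ^ l := Nat.pow_le_pow_left (by omega) l
  have hl : l < d ^ l := Nat.lt_pow_self (by omega)
  refine Ensures.mono (T := 21 * (k + 1) + (23 * (l + 1) + (2 + (2 + (21 * (l + 1) + 6))))) ?_ (by omega)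
    fun _ _ h => h
  refine Ensures.seq ((powLoop_spec ha (by norm_num) (fun s' hf => ?_) hK₁).mono le_rfl
    fun s₁ hf₁ ⟨h17, h18⟩ => Ensures.seq ((powLoop_spec (N := M + 1) hd (by norm_num) (fun s' hf => ?_)
      (hdl.trans hK₂)).mono le_rfl fun s₂ hf₂ ⟨h19, h20⟩ => Ensures.seq ⟨_, _, .assign 21 _ s₂ ?_, le_rfl,
        Ensures.seq ⟨_, _, .assign 22 _ _ ?_, le_rfl, Ensures.seq ((Ensures.forLoop (N := l) (T := 8) (fun j s' =>
          s'.reg 21 = (2 * d - 1) ^ j ∧ s'.reg 22 = D ^ j) ?_ rfl ?_ ?_ ?_).mono ?_ ?_)⟩⟩))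
  · exact (hf.1 0 rfl).trans h0
  · simp [hf.1 1 rfl, hf₁.1 1 rfl, h1]
  · simp; omega
  · simp; omega
  · omega
  · intro s' hf
    simp [hf.1 20 rfl, h20, l]
  · simp
  · rintro j s' hj hf hi ⟨h₁, h₂⟩
    have e₁ : (2 * d - 1) ^ (j + 1) ≤ K := (Nat.pow_le_pow_right (by omega) hj).trans hK₂
    have e₂ : D ^ (j + 1) ≤ K := (Nat.pow_le_pow_right hD hj).trans
      ((Nat.le_mul_of_pos_left _ (by omega)).trans hK₃)
    refine (Ensures.of_wp ?_).mono (T := (block [.assign 21 (reg 21 * const (2 * d - 1)),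
      .assign 22 (reg 22 * const D)]).cost) le_rfl fun _ _ h => h
    simp [block, wp, h₁, h₂, ← pow_succ, e₁, e₂]
  · exact le_rfl
  · rintro s₃ hf₃ ⟨h21, h22⟩
    have e0 : s₃.reg 0 = n := by
      rw [hf₃.1 0 rfl]
      simp [hf₂.1 0 rfl, hf₁.1 0 rfl, h0]
    refine ⟨_, _, .assign 23 _ s₃ ?_, le_rfl, ?_⟩
    · simpa [e0, h22] using hK₃
    · refine ⟨?_, ?_, ?_, ?_, ?_, ?_, ?_⟩
      · simp [hf₃.1 17 rfl, hf₂.1 17 rfl, h17, k]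
      · simp [hf₃.1 18 rfl, hf₂.1 18 rfl, h18, k]
      · simp [hf₃.1 19 rfl, h19, l]
      · simp [hf₃.1 20 rfl, h20, l]
      · simp [h21]
      · simp [h22]
      · simp [e0, h22]

/-- A label at most `r`, from which an edge of weight at most `M` may lead to a label greater than `r`. -/
abbrev InWindow (M r t : ℕ) : Prop := t ≠ 0 ∧ t ≤ r ∧ r + 1 ≤ t + M

/-- The condition that the value of an expression lies in the window. -/
def windowCond (e : WordExpr) : WordExpr :=
  e.ne (const 0) * e.lt (reg 3 + const 1) * (reg 3).lt (e + reg 1)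

theorem eval_windowCond {s : WordState} {M r : ℕ} (h1 : s.reg 1 = M) (h3 : s.reg 3 = r) (e : WordExpr) :
    (windowCond e).eval s ≠ 0 ↔ InWindow M r (e.eval s) := by
  simp only [windowCond, eval_mul, Ne, mul_eq_zero, eval_ne_eq_zero, eval_lt_eq_zero, eval_const, eval_add,
    eval_reg, h1, h3]
  omega

theorem pairCode_zero (a k : ℕ) : pairCode a k 0 0 = 0 := by
  induction k with
  | zero => rfl
  | succ k ih => simp [pairCode, ih]

/-- Compute the table of `pairCode`. -/
def codeTable (a : ℕ) : WordProg :=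
  fill 2 (reg 0 * reg 0) 9 (reg 2)
    (load 9 (reg 2 / reg 0 / const a * reg 0 + reg 2 % reg 0 / const a) * const (a * a) +
      (reg 2 / reg 0 % const a * const a + reg 2 % reg 0 % const a))

theorem codeTable_spec {K n a k : ℕ} {s : WordState} (ha : 2 ≤ a) (h0 : s.reg 0 = n) (hK : n * n ≤ K)
    (hn : n ≤ a ^ k) (hK' : (a * a) ^ k ≤ K) (h₀ : s.arr 9 0 = 0) :
    Ensures K (codeTable a) s (50 * (n * n + 1))
      (fun s' => ∀ i < n, ∀ j < n, s'.arr 9 (i * n + j) = pairCode a k i j) := by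
  refine (Ensures.fill (off := 0) (N := n * n) (F := fun x => pairCode a k (x / n) (x % n)) hK ?_ ?_ ?_).mono ?_ ?_
  · intro s' hf
    simp [hf.1 0 rfl, h0]
  · exact fun j _ => (pairCode_lt (by omega) _ _ _).le.trans hK'
  · intro j s' hj hf hi hI
    have h0' : s'.reg 0 = n := (hf.1 0 rfl).trans h0
    have h₁ := div_lt_of_lt_sq hj
    have h₂ := mod_lt_of_lt_sq hj
    refine ⟨by simp [hi], ?_⟩
    have h₃ : j / n / a ≤ j / n := Nat.div_le_self _ _
    have h₄ : j % n / a ≤ j % n := Nat.div_le_self _ _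
    have hload : s'.arr 9 (j / n / a * n + j % n / a) = pairCode a k (j / n / a) (j % n / a) := by
      rw [hI]
      -- Cell `0` reads itself before it is written and relies on the initial zero; every other cell
      -- reads an earlier one.
      by_cases hj₀ : j = 0
      · rw [if_neg (by omega), hj₀]
        simp [h₀, pairCode_zero]
      · have hlt : j / n / a * n + j % n / a < j := by
          have h₅ := div_mul_add_mod n j
          have h₆ := Nat.mul_le_mul_right n h₃
          by_contra! hge
          have h₇ : j % n / a = j % n := by omega
          have h₈ : j / n / a * n = j / n * n := by omega
          have h₉ : j / n / a = j / n := Nat.eq_of_mul_eq_mul_right (by omega) h₈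
          have e₁ : j % n = 0 := by
            by_contra hne
            exact (Nat.div_lt_self (Nat.pos_of_ne_zero hne) ha).ne h₇
          have e₂ : j / n = 0 := by
            by_contra hne
            exact (Nat.div_lt_self (Nat.pos_of_ne_zero hne) ha).ne h₉
          rw [e₁, e₂] at h₅
          omega
        rw [if_pos ⟨Nat.zero_le _, by rw [zero_add]; exact hlt⟩, Nat.sub_zero,
          mul_add_div_of_lt_right (by omega), mul_add_mod_of_lt_right (by omega)]
    rw [← pairCode_succ_of_lt (h₁.trans_le hn) (h₂.trans_le hn), pairCode]
    simp [hi, h0', hload]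
  · exact Nat.mul_le_mul_right _ (Nat.le_of_ble_eq_true rfl)
  · intro s' _ h i hi j hj
    rw [h, if_pos ⟨Nat.zero_le _, by rw [zero_add]; exact mul_add_lt_sq hi hj⟩, Nat.sub_zero,
      mul_add_div_of_lt_right hj, mul_add_mod_of_lt_right hj]

/-- The tables for the tensor product: the codes, and the numbers of vertices in the window, of edges
and of children, by their keys. -/
structure HasTables (n M : ℕ) (w lab par : ℕ → ℕ → ℕ) (r a d k l : ℕ) (s : WordState) : Prop where
  code : ∀ i < n, ∀ j < n, s.arr 9 (i * n + j) = pairCode a k i j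
  enc : ∀ y < d ^ l, s.arr 10 y = rebase d (2 * d - 1) l y
  dec : ∀ z < (2 * d - 1) ^ l, s.arr 11 z = rebase (2 * d - 1) d l z
  left : ∀ I, s.arr 12 I = ((Finset.range (n * n)).filter fun x => InWindow M r (lab (x / n) (x % n)) ∧
    (lab (x / n) (x % n) + M - (r + 1)) * (a * a) ^ k + pairCode a k (x / n) (x % n) = I).card
  right : ∀ I, s.arr 13 I = ((Finset.range (n * n)).filter fun x => w (x / n) (x % n) ≠ 0 ∧
    w (x / n) (x % n) * (a * a) ^ k + pairCode a k (x / n) (x % n) = I).card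
  child : ∀ I, s.arr 15 I = ((Finset.range (n * n)).filter fun x =>
    (InWindow M r (lab (x / n) (x % n)) ∧ x / n ≠ x % n) ∧
      (rebase d (2 * d - 1) l (lab (x / n) (x % n) + M - (r + 1)) +
          rebase d (2 * d - 1) l (w (x % n) (par (x / n) (x % n)))) * (a * a) ^ k +
        pairCode a k (x / n) (par (x / n) (x % n)) = I).card

/-- The window cells, by key. -/
def leftHist : WordProg :=
  histogram 2 (reg 0 * reg 0) 12 (windowCond (load 5 (reg 2)))
    ((load 5 (reg 2) + reg 1 - (reg 3 + const 1)) * (reg 17 * reg 17) + load 9 (reg 2))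

/-- The edges, by key. -/
def rightHist : WordProg :=
  histogram 2 (reg 0 * reg 0) 13 ((load 0 (reg 2)).ne (const 0))
    (load 0 (reg 2) * (reg 17 * reg 17) + load 9 (reg 2))

/-- The tree edges, by key. -/
def childHist : WordProg :=
  histogram 2 (reg 0 * reg 0) 15 (windowCond (load 5 (reg 2)) * (reg 2 / reg 0).ne (reg 2 % reg 0))
    ((load 10 (load 5 (reg 2) + reg 1 - (reg 3 + const 1)) +
        load 10 (load 0 (reg 2 % reg 0 * reg 0 + load 6 (reg 2)))) * (reg 17 * reg 17) +
      load 9 (reg 2 / reg 0 * reg 0 + load 6 (reg 2)))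

/-- Compute all tables. -/
def tableProg (a d : ℕ) : WordProg :=
  block [codeTable a, rebaseTable 10 (reg 19) d (2 * d - 1), rebaseTable 11 (reg 21) (2 * d - 1) d,
    leftHist, rightHist, childHist]

theorem tableProg_spec {a d D : ℕ} (ha : 2 ≤ a) (hd : 2 ≤ d) : ∃ c, ∀ {K n M k l : ℕ}
    {w lab par dep : ℕ → ℕ → ℕ} {r : ℕ} {s : WordState}, StoresForest n M w lab par r s →
    HasParams n M a d D k l s → IsForest n w lab par dep → (∀ u < n, ∀ v < n, w u v ≤ M) → n ≤ a ^ k →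
    M < d ^ l → n * n ≤ K → (a * a) ^ k ≤ K → (2 * d - 1) ^ l ≤ K →
    (∀ a ∈ [9, 10, 11, 12, 13, 15], s.arr a = fun _ => 0) →
    Ensures K (tableProg a d) s (c * (n * n + (2 * d - 1) ^ l + 1)) (HasTables n M w lab par r a d k l) := by
  refine ⟨1000, fun {K n M k l w lab par dep r s} hs hp hF hM hn hMd hK₁ hK₂ hK₃ hz => ?_⟩
  simp only [List.mem_cons, List.not_mem_nil, or_false, forall_eq_or_imp, forall_eq] at hz
  obtain ⟨z9, z10, z11, z12, z13, z15⟩ := hz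
  have hdl : d ^ l ≤ (2 * d - 1) ^ l := Nat.pow_le_pow_left (by omega) l
  have hside : ∀ x, x * (a ^ k * a ^ k) = x * (a * a) ^ k := fun x => by rw [mul_pow]
  have hxlab : ∀ x, s.arr 5 x = lab (x / n) (x % n) := fun x => by rw [← hs.lab, tableOf, div_mul_add_mod]
  have hxw : ∀ x, s.arr 0 x = w (x / n) (x % n) := fun x => by rw [← hs.weight, tableOf, div_mul_add_mod]
  have hxpar : ∀ x, s.arr 6 x = par (x / n) (x % n) := fun x => by rw [← hs.par, tableOf, div_mul_add_mod]
  refine Ensures.mono (T := 50 * (n * n + 1) + (31 * (d ^ l + 1) + (31 * ((2 * d - 1) ^ l + 1) +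
    (100 * (n * n + 1) + (100 * (n * n + 1) + 200 * (n * n + 1)))))) ?_ (by omega) fun _ _ h => h
  refine Ensures.seq ((codeTable_spec ha hs.size hK₁ hn hK₂ (by rw [z9])).mono le_rfl fun s₁ hf₁ h9 =>
    Ensures.seq ((rebaseTable_spec (bound := reg 19) (l := l) hd ?_ (hdl.trans hK₃) ?_ ?_).mono le_rfl
      fun s₂ hf₂ h10 => Ensures.seq ((rebaseTable_spec (bound := reg 21) (l := l) (by omega) ?_ hK₃ ?_ ?_).mono
        le_rfl fun s₃ hf₃ h11 => ?_)))
  · intro s' hf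
    simp [hf.1 19 rfl, hf₁.1 19 rfl, hp.deg]
  · exact fun y => (rebase_lt (by omega) (by omega) _ _).le.trans hK₃
  · rw [hf₁.2 10 rfl, z10]
  · intro s' hf
    simp [hf.1 21 rfl, hf₂.1 21 rfl, hf₁.1 21 rfl, hp.prodDeg]
  · intro y
    -- Here the digits may exceed the new base, so `rebase_lt` does not apply; the value still does
    -- not exceed that in the old base.
    have : ∀ k y, rebase (2 * d - 1) d k y ≤ (2 * d - 1) ^ k - 1 := by
      intro k
      induction k with
      | zero => simp [rebase]
      | succ k ih =>
        intro y
        have h₁ := ih (y / (2 * d - 1))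
        have h₂ := Nat.mod_lt y (show 2 * d - 1 > 0 by omega)
        have h₃ : 1 ≤ (2 * d - 1) ^ k := Nat.pow_pos (by omega)
        have h₄ := Nat.mul_le_mul h₁ (show d ≤ 2 * d - 1 by omega)
        rw [Nat.sub_mul, one_mul] at h₄
        have h₅ := Nat.mul_le_mul_right (2 * d - 1) h₃
        rw [rebase, pow_succ]
        omega
    have := this l y
    omega
  · rw [hf₂.2 11 rfl, hf₁.2 11 rfl, z11]
  · have e0 : s₃.reg 0 = n := by rw [hf₃.1 0 rfl, hf₂.1 0 rfl, hf₁.1 0 rfl, hs.size]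
    have e1 : s₃.reg 1 = M := by rw [hf₃.1 1 rfl, hf₂.1 1 rfl, hf₁.1 1 rfl, hs.maxWeight]
    have e3 : s₃.reg 3 = r := by rw [hf₃.1 3 rfl, hf₂.1 3 rfl, hf₁.1 3 rfl, hs.radius]
    have e17 : s₃.reg 17 = a ^ k := by rw [hf₃.1 17 rfl, hf₂.1 17 rfl, hf₁.1 17 rfl, hp.side]
    have a0 : s₃.arr 0 = s.arr 0 := by rw [hf₃.2 0 rfl, hf₂.2 0 rfl, hf₁.2 0 rfl]
    have a5 : s₃.arr 5 = s.arr 5 := by rw [hf₃.2 5 rfl, hf₂.2 5 rfl, hf₁.2 5 rfl]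
    have a6 : s₃.arr 6 = s.arr 6 := by rw [hf₃.2 6 rfl, hf₂.2 6 rfl, hf₁.2 6 rfl]
    have a9 : s₃.arr 9 = s₁.arr 9 := by rw [hf₃.2 9 rfl, hf₂.2 9 rfl]
    have a10 : s₃.arr 10 = s₂.arr 10 := by rw [hf₃.2 10 rfl]
    have a12 : s₃.arr 12 = fun _ => 0 := by rw [hf₃.2 12 rfl, hf₂.2 12 rfl, hf₁.2 12 rfl, z12]
    have a13 : s₃.arr 13 = fun _ => 0 := by rw [hf₃.2 13 rfl, hf₂.2 13 rfl, hf₁.2 13 rfl, z13]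
    have a15 : s₃.arr 15 = fun _ => 0 := by rw [hf₃.2 15 rfl, hf₂.2 15 rfl, hf₁.2 15 rfl, z15]
    refine Ensures.seq ((Ensures.histogram (N := n * n) (p := fun x => InWindow M r (lab (x / n) (x % n)))
      (κ := fun x => (lab (x / n) (x % n) + M - (r + 1)) * (a * a) ^ k + pairCode a k (x / n) (x % n))
      hK₁ ?_ a12 ?_).mono ?_ fun s₄ hf₄ h12 => Ensures.seq ((Ensures.histogram (N := n * n)
        (p := fun x => w (x / n) (x % n) ≠ 0)
        (κ := fun x => w (x / n) (x % n) * (a * a) ^ k + pairCode a k (x / n) (x % n))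
        hK₁ ?_ ?_ ?_).mono ?_ fun s₅ hf₅ h13 => (Ensures.histogram (N := n * n)
          (p := fun x => InWindow M r (lab (x / n) (x % n)) ∧ x / n ≠ x % n)
          (κ := fun x => (rebase d (2 * d - 1) l (lab (x / n) (x % n) + M - (r + 1)) +
            rebase d (2 * d - 1) l (w (x % n) (par (x / n) (x % n)))) * (a * a) ^ k +
              pairCode a k (x / n) (par (x / n) (x % n))) hK₁ ?_ ?_ ?_).mono ?_ fun s₆ hf₆ h15 => ?_))
    · intro s' hf
      simp [hf.1 0 rfl, e0]
    · intro j s' hj hf hi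
      have b5 : s'.arr 5 j = lab (j / n) (j % n) := by rw [hf.2 5 rfl, a5, hxlab]
      have b9 : s'.arr 9 j = pairCode a k (j / n) (j % n) := by
        rw [hf.2 9 rfl, a9, ← h9 _ (div_lt_of_lt_sq hj) _ (mod_lt_of_lt_sq hj), div_mul_add_mod]
      refine ⟨?_, fun _ => ?_⟩
      · rw [eval_windowCond ((hf.1 1 rfl).trans e1) ((hf.1 3 rfl).trans e3)]
        simp only [eval_load, eval_reg, hi, b5]
      · simp only [eval_add, eval_mul, eval_sub, eval_load, eval_reg, eval_const, hi, b5, b9, hf.1 1 rfl, e1,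
          hf.1 3 rfl, e3, hf.1 17 rfl, e17, hside]
    · exact Nat.mul_le_mul_right _ (by decide)
    · intro s' hf
      simp [hf.1 0 rfl, hf₄.1 0 rfl, e0]
    · rw [hf₄.2 13 rfl, a13]
    · intro j s' hj hf hi
      have b0 : s'.arr 0 j = w (j / n) (j % n) := by rw [hf.2 0 rfl, hf₄.2 0 rfl, a0, hxw]
      have b9 : s'.arr 9 j = pairCode a k (j / n) (j % n) := by
        rw [hf.2 9 rfl, hf₄.2 9 rfl, a9, ← h9 _ (div_lt_of_lt_sq hj) _ (mod_lt_of_lt_sq hj), div_mul_add_mod]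
      refine ⟨?_, fun _ => ?_⟩
      · simp only [Ne, eval_ne_eq_zero, eval_load, eval_reg, eval_const, hi, b0]
      · simp only [eval_add, eval_mul, eval_load, eval_reg, hi, b0, b9, hf.1 17 rfl, hf₄.1 17 rfl, e17, hside]
    · exact Nat.mul_le_mul_right _ (by decide)
    · intro s' hf
      simp [hf.1 0 rfl, hf₅.1 0 rfl, hf₄.1 0 rfl, e0]
    · rw [hf₅.2 15 rfl, hf₄.2 15 rfl, a15]
    · intro j s' hj hf hi
      have hj₁ := div_lt_of_lt_sq hj
      have hj₂ := mod_lt_of_lt_sq hj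
      have b5 : s'.arr 5 j = lab (j / n) (j % n) := by rw [hf.2 5 rfl, hf₅.2 5 rfl, hf₄.2 5 rfl, a5, hxlab]
      have b6 : s'.arr 6 j = par (j / n) (j % n) := by rw [hf.2 6 rfl, hf₅.2 6 rfl, hf₄.2 6 rfl, a6, hxpar]
      have b0 : ∀ u, ∀ v < n, s'.arr 0 (u * n + v) = w u v := fun u v hv => by
        rw [hf.2 0 rfl, hf₅.2 0 rfl, hf₄.2 0 rfl, a0, hxw, mul_add_div_of_lt_right hv,
          mul_add_mod_of_lt_right hv]
      have b9 : ∀ i < n, ∀ j < n, s'.arr 9 (i * n + j) = pairCode a k i j := fun i hi j hj => by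
        rw [hf.2 9 rfl, hf₅.2 9 rfl, hf₄.2 9 rfl, a9, ← h9 _ hi _ hj]
      have b10 : ∀ y < d ^ l, s'.arr 10 y = rebase d (2 * d - 1) l y := fun y hy => by
        rw [hf.2 10 rfl, hf₅.2 10 rfl, hf₄.2 10 rfl, a10, h10 y hy]
      have e0' : s'.reg 0 = n := by rw [hf.1 0 rfl, hf₅.1 0 rfl, hf₄.1 0 rfl, e0]
      have e1' : s'.reg 1 = M := by rw [hf.1 1 rfl, hf₅.1 1 rfl, hf₄.1 1 rfl, e1]
      have e3' : s'.reg 3 = r := by rw [hf.1 3 rfl, hf₅.1 3 rfl, hf₄.1 3 rfl, e3]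
      have e17' : s'.reg 17 = a ^ k := by rw [hf.1 17 rfl, hf₅.1 17 rfl, hf₄.1 17 rfl, e17]
      refine ⟨?_, fun ⟨hwin, hne⟩ => ?_⟩
      · rw [eval_mul, Nat.mul_ne_zero_iff, eval_windowCond e1' e3', Ne, Ne, eval_ne_eq_zero]
        simp only [eval_load, eval_reg, eval_div, eval_mod, hi, b5, e0']
      -- The diagonal cells are excluded because the root has no genuine parent.
      · obtain ⟨hpar, -⟩ := hF.step _ hj₁ _ hj₂ hwin.1 (Ne.symm hne)
        have hle := hM _ hj₂ _ hpar
        simp only [eval_add, eval_mul, eval_sub, eval_div, eval_mod, eval_load, eval_reg, eval_const, hi, b5, b6,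
          e0', e1', e3', e17', hside]
        rw [b0 _ _ hpar, b9 _ hj₁ _ hpar, b10 _ (by omega), b10 _ (by omega)]
    · exact Nat.mul_le_mul_right _ (by decide)
    · refine ⟨fun i hi j hj => ?_, fun y hy => ?_, fun z hz => ?_, fun I => ?_, fun I => ?_, h15⟩
      · rw [hf₆.2 9 rfl, hf₅.2 9 rfl, hf₄.2 9 rfl, a9, h9 i hi j hj]
      · rw [hf₆.2 10 rfl, hf₅.2 10 rfl, hf₄.2 10 rfl, a10, h10 y hy]
      · rw [hf₆.2 11 rfl, hf₅.2 11 rfl, hf₄.2 11 rfl, h11 z hz]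
      · rw [hf₆.2 12 rfl, hf₅.2 12 rfl, h12 I]
      · rw [hf₆.2 13 rfl, h13 I]

/-! ### Candidates for the best chord -/

theorem pairCode_inj {a k s u s' u' : ℕ} (hs : s < a ^ k) (hu : u < a ^ k) (hs' : s' < a ^ k)
    (hu' : u' < a ^ k) (h : pairCode a k s u = pairCode a k s' u') : s = s' ∧ u = u' := by
  induction k generalizing s u s' u' with
  | zero =>
    simp only [pow_zero, Nat.lt_one_iff] at *
    omega
  | succ k ih =>
    have ha : 0 < a := by
      by_contra hcon
      obtain rfl : a = 0 := by omega
      simp at hs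
    have hlt : ∀ {x : ℕ}, x < a ^ (k + 1) → x / a < a ^ k := fun hx =>
      Nat.div_lt_of_lt_mul (by rwa [pow_succ'] at hx)
    rw [pairCode, pairCode, mul_add_inj (mod_mul_add_mod_lt ha _ _) (mod_mul_add_mod_lt ha _ _),
      mul_add_inj (Nat.mod_lt _ ha) (Nat.mod_lt _ ha)] at h
    obtain ⟨h₁, h₂⟩ := ih (hlt hs) (hlt hu) (hlt hs') (hlt hu') h.1
    have e₁ := div_mul_add_mod a s
    have e₂ := div_mul_add_mod a u
    rw [h₁, h.2.1, div_mul_add_mod] at e₁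
    rw [h₂, h.2.2, div_mul_add_mod] at e₂
    exact ⟨e₁.symm, e₂.symm⟩

theorem rebase_add_rebase_lt {d : ℕ} (hd : 0 < d) (k x y : ℕ) :
    rebase d (2 * d - 1) k x + rebase d (2 * d - 1) k y < (2 * d - 1) ^ k := by
  induction k generalizing x y with
  | zero => simp [rebase]
  | succ k ih =>
    have h₁ := Nat.mod_lt x hd
    have h₂ := Nat.mod_lt y hd
    have h₃ := mul_add_lt_mul (ih (x / d) (y / d)) (show x % d + y % d < 2 * d - 1 by omega)
    rw [add_mul] at h₃
    rw [rebase, rebase, pow_succ]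
    omega

/-- A vertex `v` in the window of `s` that is joined by an edge outside of the tree to another vertex `u` in
the window, where `z` encodes the label of `u` and the weight of the edge. -/
def IsCandidate (n M : ℕ) (w lab par : ℕ → ℕ → ℕ) (r d l s v z : ℕ) : Prop :=
  InWindow M r (lab s v) ∧ M ≤ rebase (2 * d - 1) d l z ∧ ∃ u < n, InWindow M r (lab s u) ∧ w u v ≠ 0 ∧
    par s u ≠ v ∧ rebase d (2 * d - 1) l (lab s u + M - (r + 1)) + rebase d (2 * d - 1) l (w u v) = z

section Candidate

variable {n M : ℕ} {w lab par dep : ℕ → ℕ → ℕ} {r d l : ℕ}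

/-- Decoding gives `lab s u + w u v ≥ r + 1`. If `u` were the parent of `v`, this sum would be `lab
s v ≤ r`; that `v` is not the parent of `u` is part of the definition. -/
theorem IsCandidate.exists_isChord (hd : 0 < d) (hF : IsForest n w lab par dep)
    (hM : ∀ u < n, ∀ v < n, w u v ≤ M) (hMd : M < d ^ l) (hirr : ∀ u < n, w u u = 0) {s v z : ℕ}
    (h : IsCandidate n M w lab par r d l s v z) (hs : s < n) (hv : v < n) :
    ∃ u < n, IsChord n w lab par s u v ∧
      lab s u + M + w u v = r + 1 + rebase (2 * d - 1) d l z := by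
  obtain ⟨h₁, h₂, u, hu, h₃, h₄, h₅, h₆⟩ := h
  have h₇ := hM u hu v hv
  rw [← h₆, rebase_rebase_add hd rfl l (by omega) (by omega)] at h₂ ⊢
  refine ⟨u, hu, ⟨hs, hu, hv, h₃.1, h₁.1, h₄, ?_⟩, by omega⟩
  rintro (h | h)
  · exact h₅ h
  · by_cases hvs : v = s
    · subst hvs
      rw [hF.par_self v hv] at h
      subst h
      exact h₄ (hirr v hv)
    · have := (hF.step s hs v hv h₁.1 hvs).2.2.2.1
      rw [h] at this
      omega

/-- An edge outside the tree is unexplored from either end, so each label plus the weight exceeds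
`r`. As weights are at most `M`, both ends lie in the window. -/
theorem IsChord.exists_isCandidate (hd : 0 < d) (hE : IsExplored n w lab par r)
    (hM : ∀ u < n, ∀ v < n, w u v ≤ M) (hMd : M < d ^ l) (hsym : ∀ u < n, ∀ v < n, w u v = w v u)
    {s u v : ℕ} (h : IsChord n w lab par s u v) (hu : lab s u ≤ r) (hv : lab s v ≤ r) :
    InWindow M r (lab s v) ∧ ∃ z < (2 * d - 1) ^ l, IsCandidate n M w lab par r d l s v z ∧
      lab s u + M + w u v = r + 1 + rebase (2 * d - 1) d l z := by
  have h₁ := hM u h.left_lt v h.right_lt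
  have h₂ : r + 1 ≤ lab s u + w u v := by
    by_contra! hlt
    exact h.not_tree (hE s h.source_lt u h.left_lt v h.right_lt h.left_lab h.weight (by omega)).2.2
  have h₃ : r + 1 ≤ lab s v + w u v := by
    by_contra! hlt
    have := (hE s h.source_lt v h.right_lt u h.left_lt h.right_lab
      (by rw [hsym v h.right_lt u h.left_lt]; exact h.weight)
      (by rw [hsym v h.right_lt u h.left_lt]; omega)).2.2
    exact h.not_tree this.symm
  have h₄ : InWindow M r (lab s v) := ⟨h.right_lab, hv, by omega⟩
  have hr : rebase (2 * d - 1) d l (rebase d (2 * d - 1) l (lab s u + M - (r + 1)) +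
      rebase d (2 * d - 1) l (w u v)) = lab s u + M - (r + 1) + w u v :=
    rebase_rebase_add hd rfl l (by omega) (by omega)
  refine ⟨h₄, _, rebase_add_rebase_lt hd l _ _, ⟨h₄, ?_, u, h.left_lt, ⟨h.left_lab, hu, by omega⟩, h.weight,
    fun he => h.not_tree (Or.inl he), rfl⟩, ?_⟩
  · rw [hr]; omega
  · rw [hr]; omega

/-- The second set consists of the cells `(s, u)` with `par s u = v`, that is, of the children of
`v` in the first set. The cardinals differ if and only if some `u` in the first set is not a child
of `v`. The root is no exception: it could only be its own child, along a loop. -/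
theorem card_ne_card_iff {a k : ℕ} (hF : IsForest n w lab par dep) (hirr : ∀ u < n, w u u = 0)
    (hsym : ∀ u < n, ∀ v < n, w u v = w v u) (hn : n ≤ a ^ k) (ha : 0 < a) {s v z : ℕ} (hs : s < n)
    (hv : v < n) (f : ℕ → ℕ → ℕ) :
    ((Finset.range n).filter fun u => InWindow M r (lab s u) ∧ w u v ≠ 0 ∧ f (lab s u) (w u v) = z).card ≠
      ((Finset.range (n * n)).filter fun x => (InWindow M r (lab (x / n) (x % n)) ∧ x / n ≠ x % n) ∧
        f (lab (x / n) (x % n)) (w (x % n) (par (x / n) (x % n))) * (a * a) ^ k +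
          pairCode a k (x / n) (par (x / n) (x % n)) = z * (a * a) ^ k + pairCode a k s v).card ↔
    ∃ u < n, InWindow M r (lab s u) ∧ w u v ≠ 0 ∧ par s u ≠ v ∧ f (lab s u) (w u v) = z := by
  have hkid : ((Finset.range (n * n)).filter fun x => (InWindow M r (lab (x / n) (x % n)) ∧ x / n ≠ x % n) ∧
        f (lab (x / n) (x % n)) (w (x % n) (par (x / n) (x % n))) * (a * a) ^ k +
          pairCode a k (x / n) (par (x / n) (x % n)) = z * (a * a) ^ k + pairCode a k s v).card =
      (((Finset.range n).filter fun u => InWindow M r (lab s u) ∧ w u v ≠ 0 ∧ f (lab s u) (w u v) = z).filter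
        fun u => par s u = v).card := by
    symm
    refine Finset.card_bij (fun u _ => s * n + u) ?_ ?_ ?_
    · intro u hu
      simp only [Finset.mem_filter, Finset.mem_range] at hu ⊢
      obtain ⟨⟨hu, hwin, hw, hf⟩, hp⟩ := hu
      rw [mul_add_div_of_lt_right hu, mul_add_mod_of_lt_right hu, hp]
      refine ⟨mul_add_lt_sq hs hu, ⟨hwin, ?_⟩, by rw [hf]⟩
      rintro rfl
      rw [hF.par_self s hs] at hp
      subst hp
      exact hw (hirr s hs)
    · intro u hu u' hu' he
      omega
    · intro x hx
      simp only [Finset.mem_filter, Finset.mem_range] at hx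
      obtain ⟨hx, ⟨hwin, hne⟩, he⟩ := hx
      have hx₁ := div_lt_of_lt_sq hx
      have hx₂ := mod_lt_of_lt_sq hx
      obtain ⟨hp, -, hw, -⟩ := hF.step _ hx₁ _ hx₂ hwin.1 (Ne.symm hne)
      rw [mul_add_inj (pairCode_lt ha _ _ _) (pairCode_lt ha _ _ _)] at he
      obtain ⟨e₁, e₂⟩ := pairCode_inj (by omega) (by omega) (by omega) (by omega) he.2
      refine ⟨x % n, ?_, by rw [← e₁, div_mul_add_mod]⟩
      simp only [Finset.mem_filter, Finset.mem_range]
      have he₁ := he.1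
      rw [e₂, e₁] at he₁
      rw [e₂] at hw
      rw [e₁] at e₂ hwin
      exact ⟨⟨hx₂, hwin, by rwa [hsym _ hx₂ _ hv], he₁⟩, e₂⟩
  rw [hkid, ← Finset.card_filter_add_card_filter_not (fun u => par s u = v)
    (s := (Finset.range n).filter fun u => InWindow M r (lab s u) ∧ w u v ≠ 0 ∧ f (lab s u) (w u v) = z)]
  rw [Ne, Nat.add_eq_left, Finset.card_eq_zero, ← Ne, ← Finset.nonempty_iff_ne_empty]
  constructor
  · rintro ⟨u, hu⟩
    simp only [Finset.mem_filter, Finset.mem_range] at hu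
    exact ⟨u, hu.1.1, hu.1.2.1, hu.1.2.2.1, hu.2, hu.1.2.2.2⟩
  · rintro ⟨u, hu, h₁, h₂, h₃, h₄⟩
    refine ⟨u, ?_⟩
    simp only [Finset.mem_filter, Finset.mem_range]
    exact ⟨⟨hu, h₁, h₂, h₄⟩, h₃⟩

end Candidate

/-- The search for the best candidate: register `29` holds its value and register `30` the cell of `s`
and `v`. -/
def searchBody : WordProg :=
  block [.assign 11 (reg 2 / reg 21), .assign 12 (reg 2 % reg 21),
    .assign 13 (reg 12 * (reg 17 * reg 17) + load 9 (reg 11)),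
    .ite (windowCond (load 5 (reg 11)) * (reg 1).lt (load 11 (reg 12) + const 1) *
        (load 14 (reg 24 + reg 13) % reg 23).ne (reg 22 * load 15 (reg 13)) *
        (load 11 (reg 12) + (load 5 (reg 11) + reg 1 - (reg 3 + const 1))).lt (reg 29))
      (block [.assign 29 (load 11 (reg 12) + (load 5 (reg 11) + reg 1 - (reg 3 + const 1))),
        .assign 30 (reg 11)])
      .skip]

/-- Find the best candidate. -/
def searchProg : WordProg :=
  block [.assign 29 (const 3 * reg 1), .assign 30 (const 0), forLoop 2 (reg 0 * reg 0 * reg 21) searchBody]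

/-- The initial value `3 * M` is a sentinel: it exceeds `lab s u + M - (r + 1)`, `w u v` and `lab s
v + M - (r + 1)` together for every candidate. It is returned only if there is no candidate. -/
theorem searchProg_spec : ∃ c, ∀ {K n M a k d D l : ℕ} {w lab par : ℕ → ℕ → ℕ} {r : ℕ} {s : WordState},
    StoresForest n M w lab par r s → HasParams n M a d D k l s → 0 < n → 3 * M ≤ K → n * n ≤ K →
    n * n * (2 * d - 1) ^ l ≤ K → (2 * d - 1) ^ l * (a * a) ^ k ≤ K → 0 < a → 0 < d →
    (∀ i < n, ∀ j < n, s.arr 9 (i * n + j) = pairCode a k i j) →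
    (∀ z < (2 * d - 1) ^ l, s.arr 11 z = rebase (2 * d - 1) d l z) →
    (∀ i < n, ∀ j < n, InWindow M r (lab i j) → ∀ z < (2 * d - 1) ^ l,
      M ≤ rebase (2 * d - 1) d l z →
      (s.arr 14 (s.reg 24 + (z * (a * a) ^ k + pairCode a k i j)) % s.reg 23 ≠
        s.reg 22 * s.arr 15 (z * (a * a) ^ k + pairCode a k i j) ↔
          IsCandidate n M w lab par r d l i j z)) →
    Ensures K searchProg s (c * (n * n * (2 * d - 1) ^ l + 1)) (fun s' =>
      (∀ i < n, ∀ j < n, ∀ z < (2 * d - 1) ^ l, IsCandidate n M w lab par r d l i j z →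
        s'.reg 29 ≤ rebase (2 * d - 1) d l z + (lab i j + M - (r + 1))) ∧
      s'.reg 30 < n * n ∧ (s'.reg 29 < 3 * M → ∃ z < (2 * d - 1) ^ l,
        IsCandidate n M w lab par r d l (s'.reg 30 / n) (s'.reg 30 % n) z ∧
        s'.reg 29 = rebase (2 * d - 1) d l z + (lab (s'.reg 30 / n) (s'.reg 30 % n) + M - (r + 1)))) := by
  refine ⟨10 + ((reg 0 * reg 0 * reg 21).cost + searchBody.cost + 12),
    fun {K n M a k d D l w lab par r s} hs hp hn hMK hnK hzK hkey ha hd h9 h11 h14 => ?_⟩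
  set Z := (2 * d - 1) ^ l with hZ
  have hZpos : 0 < Z := Nat.pow_pos (by omega)
  refine Ensures.mono (T := 4 + (2 + ((reg 0 * reg 0 * reg 21).cost + searchBody.cost + 12) * (n * n * Z + 1)))
    ?_ (by nlinarith) fun _ _ h => h
  refine Ensures.seq ⟨_, _, .assign 29 _ s (by simpa [hs.maxWeight] using hMK), le_rfl, Ensures.seq ⟨_, _,
    .assign 30 _ _ (Nat.zero_le _), le_rfl, (Ensures.forLoop (N := n * n * Z) (T := searchBody.cost) (fun i s' =>
      (∀ x < n * n, ∀ z < Z, x * Z + z < i → IsCandidate n M w lab par r d l (x / n) (x % n) z →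
        s'.reg 29 ≤ rebase (2 * d - 1) d l z + (lab (x / n) (x % n) + M - (r + 1))) ∧
      s'.reg 30 < n * n ∧ s'.reg 29 ≤ 3 * M ∧ (s'.reg 29 < 3 * M → ∃ z < Z,
        IsCandidate n M w lab par r d l (s'.reg 30 / n) (s'.reg 30 % n) z ∧
        s'.reg 29 = rebase (2 * d - 1) d l z + (lab (s'.reg 30 / n) (s'.reg 30 % n) + M - (r + 1))))
      hzK rfl ?_ ?_ ?_).mono le_rfl ?_⟩⟩
  · intro s' hf
    simp [hf.1 0 rfl, hf.1 21 rfl, hs.size, hp.prodDeg, hZ]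
  · refine ⟨by simp, by simp [hn], by simp [hs.maxWeight], by simp [hs.maxWeight]⟩
  · rintro i s' hi hf hr ⟨hI₁, hI₂, hI₃, hI₄⟩
    obtain ⟨x, hx⟩ : ∃ x, x = i / Z := ⟨_, rfl⟩
    obtain ⟨z, hz⟩ : ∃ z, z = i % Z := ⟨_, rfl⟩
    have hxn : x < n * n := by rw [hx]; exact Nat.div_lt_of_lt_mul (by rwa [mul_comm])
    have hzZ : z < Z := by rw [hz]; exact Nat.mod_lt _ hZpos
    have hi' : x * Z + z = i := by rw [hx, hz, div_mul_add_mod]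
    have h₁ := div_lt_of_lt_sq hxn
    have h₂ := mod_lt_of_lt_sq hxn
    have e1 : s'.reg 1 = M := (hf.1 1 rfl).trans (by simp [hs.maxWeight])
    have e3 : s'.reg 3 = r := (hf.1 3 rfl).trans (by simp [hs.radius])
    have e17 : s'.reg 17 = a ^ k := (hf.1 17 rfl).trans (by simp [hp.side])
    have e21 : s'.reg 21 = Z := (hf.1 21 rfl).trans (by simp [hp.prodDeg, hZ])
    have e22 : s'.reg 22 = s.reg 22 := (hf.1 22 rfl).trans (by simp)
    have e23 : s'.reg 23 = s.reg 23 := (hf.1 23 rfl).trans (by simp)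
    have e24 : s'.reg 24 = s.reg 24 := (hf.1 24 rfl).trans (by simp)
    have a5 : s'.arr 5 x = lab (x / n) (x % n) := by
      rw [hf.2 5 rfl, ← hs.lab, tableOf, div_mul_add_mod]; rfl
    have a9 : s'.arr 9 x = pairCode a k (x / n) (x % n) := by
      rw [hf.2 9 rfl, ← h9 _ h₁ _ h₂, div_mul_add_mod]; rfl
    have a11 : s'.arr 11 z = rebase (2 * d - 1) d l z := by
      rw [hf.2 11 rfl, ← h11 z hzZ]; rfl
    have a14 : s'.arr 14 = s.arr 14 := by rw [hf.2 14 rfl]; rfl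
    have a15 : s'.arr 15 = s.arr 15 := by rw [hf.2 15 rfl]; rfl
    have hside : z * (a ^ k * a ^ k) = z * (a * a) ^ k := by rw [mul_pow]
    have hcand := h14 _ h₁ _ h₂
    have hcode : z * (a * a) ^ k + pairCode a k (x / n) (x % n) ≤ K :=
      ((mul_add_lt_mul hzZ (pairCode_lt ha _ _ _)).trans_le hkey).le
    have hzZ' : Z ≤ K := (Nat.le_mul_of_pos_left _ (by positivity)).trans hzK
    have hlast : ∀ x' < n * n, ∀ z' < Z, x' * Z + z' < i + 1 → x' * Z + z' < i ∨ x' = x ∧ z' = z := by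
      intro x' hx' z' hz' hlt
      rcases Nat.lt_or_eq_of_le (Nat.le_of_lt_succ hlt) with h | h
      · exact Or.inl h
      · rw [← hi', mul_add_inj hz' hzZ] at h
        exact Or.inr h
    refine Ensures.of_wp ?_
    simp only [searchBody, block, wp, eval_div, eval_mod, eval_add, eval_mul, eval_reg, eval_load,
      WordState.setReg_reg, WordState.setReg_arr, Nat.reduceEqDiff, if_true, if_false, hr, e21, ← hx, ← hz, e17,
      a9, hside, Nat.mul_ne_zero_iff]
    rw [eval_windowCond (M := M) (r := r) (by simp [e1]) (by simp [e3])]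
    simp only [eval_lt_eq_zero, eval_ne_eq_zero, eval_add, eval_sub, eval_mul, eval_mod, eval_reg, eval_const, eval_load,
      WordState.setReg_reg, WordState.setReg_arr, Nat.reduceEqDiff, if_true, if_false, e1, e3, e22, e23, e24,
      a5, a11, a14, a15, Ne, not_le, mul_eq_zero]
    refine ⟨by omega, by omega, hcode, fun ⟨⟨⟨c₁, c₂⟩, c₃⟩, c₄⟩ => ⟨by omega, by omega, ?_⟩, fun hc => ?_⟩
    · have hc' := (hcand c₁ z hzZ (by omega)).1 c₃
      refine ⟨fun x' hx' z' hz' hlt hcc => ?_, hxn, by omega, fun _ => ⟨z, hzZ, hc', rfl⟩⟩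
      rcases hlast x' hx' z' hz' hlt with h | ⟨rfl, rfl⟩
      · have := hI₁ x' hx' z' hz' h hcc
        omega
      · exact le_rfl
    · refine ⟨fun x' hx' z' hz' hlt hcc => ?_, hI₂, hI₃, hI₄⟩
      rcases hlast x' hx' z' hz' hlt with h | ⟨rfl, rfl⟩
      · exact hI₁ x' hx' z' hz' h hcc
      · by_contra! hgt
        have := (hcand hcc.1 z' hzZ hcc.2.1).2 hcc
        have c₁ := hcc.1
        have c₂ := hcc.2.1
        rcases hc with ((h | h) | h) | h
        · refine (eval_windowCond (M := M) (r := r) ?_ ?_ (load 5 (reg 11))).2 ?_ h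
          · simp [e1]
          · simp [e3]
          · simpa [a5] using c₁
        · omega
        · exact this h
        · omega
  · rintro s' hf ⟨hI₁, hI₂, hI₃, hI₄⟩
    refine ⟨fun i hi j hj z hz hc => ?_, hI₂, hI₄⟩
    have := hI₁ (i * n + j) (mul_add_lt_sq hi hj) z hz
      (mul_add_lt_mul (mul_add_lt_sq hi hj) hz)
    rw [mul_add_div_of_lt_right hj, mul_add_mod_of_lt_right hj] at this
    exact this hc

/-! ### The best chord by fast matrix multiplication -/

/-- Examine all triples with the source and the last vertex given by register `30`. -/
def tryAllProg : WordProg :=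
  forLoop 2 (reg 0) (block [.assign 11 (reg 30 / reg 0), .assign 12 (reg 2), .assign 14 (reg 30 % reg 0),
    tryProg])

theorem tryAllProg_spec : ∃ c, ∀ {K n M : ℕ} {w lab par : ℕ → ℕ → ℕ} {r : ℕ} {s : WordState},
    StoresForest n M w lab par r s → HoldsChord n w lab par s → n ≤ K → s.reg 16 ≤ K → s.reg 30 < n * n →
    Ensures K tryAllProg s (c * (n + 1)) (fun s' => HoldsChord n w lab par s' ∧
      s'.reg 16 ≤ s.reg 16 ∧ ∀ u < n, IsChord n w lab par (s.reg 30 / n) u (s.reg 30 % n) →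
        s'.reg 16 ≤ lab (s.reg 30 / n) u + w u (s.reg 30 % n) + lab (s.reg 30 / n) (s.reg 30 % n)) := by
  refine ⟨_, fun {K n M w lab par r s} hs hc hK hb h30 => (Ensures.forLoop (T := 4 + (2 + (4 + tryProg.cost)))
    (fun j s' => HoldsChord n w lab par s' ∧ s'.reg 16 ≤ s.reg 16 ∧ ∀ u < n, u < j →
      IsChord n w lab par (s.reg 30 / n) u (s.reg 30 % n) →
      s'.reg 16 ≤ lab (s.reg 30 / n) u + w u (s.reg 30 % n) + lab (s.reg 30 / n) (s.reg 30 % n))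
    hK rfl ?_ ?_ ?_).mono le_rfl fun s' _ h => ⟨h.1, h.2.1, fun u hu hch => h.2.2 u hu hu hch⟩⟩
  · intro s' hf
    simp [hf.1 0 rfl, hs.size]
  · refine ⟨by simpa [HoldsChord] using hc, by simp, by simp⟩
  · intro j s' hj hf hi ⟨hc', hle, hI⟩
    have hs' := hs.frame hf rfl rfl rfl rfl rfl rfl
    have e30 : s'.reg 30 = s.reg 30 := hf.1 30 rfl
    have h₁ := div_lt_of_lt_sq h30
    have h₂ := mod_lt_of_lt_sq h30
    refine Ensures.seq ⟨_, _, .assign 11 _ s' ?_, le_rfl, Ensures.seq ⟨_, _, .assign 12 _ _ ?_, le_rfl,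
      Ensures.seq ⟨_, _, .assign 14 _ _ ?_, le_rfl, (tryProg_spec (s := _) (n := n) (M := M) (w := w) (lab := lab)
        (par := par) (r := r) ?_ ?_ hK ?_ ?_ ?_ ?_).mono le_rfl ?_⟩⟩⟩
    · simp [hs'.size, e30]; omega
    · simp [hi]; omega
    · simp [hs'.size, e30]; omega
    · exact ⟨by simp [hs'.size], by simp [hs'.maxWeight], by simp [hs'.radius], by simp [hs'.weight],
        by simp [hs'.lab], by simp [hs'.par]⟩
    · simpa [HoldsChord] using hc'
    · simp; omega
    · simpa [hs'.size, e30] using h₁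
    · simpa [hi] using hj
    · simpa [hs'.size, e30] using h₂
    · rintro s'' - ⟨g₁, g₂, g₃⟩
      simp [hs'.size, hi, e30] at g₂ g₃
      refine ⟨by simpa [HoldsChord] using g₁, by simp; omega, fun u hu hlt hch => ?_⟩
      rw [WordState.setReg_reg, if_neg (by norm_num)]
      rcases Nat.lt_or_eq_of_le (Nat.le_of_lt_succ hlt) with h | rfl
      · exact g₂.trans (hI u hu h hch)
      · exact g₃ hch

/-- Find the best chord whose ends have labels at most `r`, by means of schemes for the products of
matrices and of polynomials. -/
def fastProg (a r : ℕ) (U V W : ℕ → ℕ → ℤ) (d D : ℕ) (U' V' W' : ℕ → ℕ → ℤ) : WordProg :=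
  block [paramProg a d D, tableProg a d,
    bilinearProg r (a * a) (a * a) U V W (2 * d - 1) d (2 * d - 1) U' V' W', searchProg, tryAllProg]

-- The value of a candidate differs from that of its chord by a constant depending on `M` and `r`
-- only, so a best candidate has the `s` and `v` of a best chord with labels at most `r`. The scan
-- over `u` then meets a chord that is at least as good as all of these.
set_option maxHeartbeats 1000000 in
theorem fastProg_spec {a rk d D : ℕ} {U V W U' V' W' : ℕ → ℕ → ℤ} (ha : 2 ≤ a) (hrk : a * a ≤ rk) (hd : 2 ≤ d)
    (hD : 0 < D) (hS : IsScheme rk (a * a) (a * a) (matMulTensor a) U V W)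
    (hS' : IsScheme (2 * d - 1) d (2 * d - 1) (polyMulTensor D) U' V' W') :
    ∃ c, ∀ {K n M k l S : ℕ} {w lab par dep : ℕ → ℕ → ℕ} {r : ℕ} {s : WordState},
      k = Nat.clog a n → l = Nat.clog d (M + 1) → S = (2 * d - 1) ^ l * rk ^ k →
      StoresForest n M w lab par r s → HoldsChord n w lab par s → IsForest n w lab par dep →
      IsExplored n w lab par r → (∀ u < n, ∀ v < n, w u v ≤ M) →
      (∀ u < n, ∀ v < n, w u v = w v u) → (∀ u < n, w u u = 0) → 0 < n →
      (∀ a ∈ [9, 10, 11, 12, 13, 15], s.arr a = fun _ => 0) → (k + l + 2) * (S + 1) ≤ K →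
      (n + 1) * D ^ l ≤ K → 3 * M ≤ K → s.reg 16 ≤ K →
      Ensures K (fastProg a rk U V W d D U' V' W') s (c * (S + 1) * (k + l + 1)) (fun s' =>
        HoldsChord n w lab par s' ∧ s'.reg 16 ≤ s.reg 16 ∧ ∀ x u v, IsChord n w lab par x u v →
          lab x u ≤ r → lab x v ≤ r → s'.reg 16 ≤ lab x u + w u v + lab x v) := by
  have haa : 0 < a * a := by positivity
  obtain ⟨c₁, hc₁⟩ := paramProg_spec ha hd hD
  obtain ⟨c₂, hc₂⟩ := tableProg_spec (D := D) ha hd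
  obtain ⟨c₃, hc₃⟩ := bilinearProg_spec hS hS' haa haa (by omega) (by omega) hrk hrk (by omega) le_rfl
  obtain ⟨c₄, hc₄⟩ := searchProg_spec
  obtain ⟨c₅, hc₅⟩ := tryAllProg_spec
  refine ⟨c₁ + 2 * c₂ + c₃ + c₄ + c₅, fun {K n M k l S w lab par dep r s} hk hl hSe hs hc hF hE hM hsym hirr hn hz hK
    hKm hKM hKb => ?_⟩
  have hnk : n ≤ a ^ k := hk ▸ Nat.le_pow_clog (by omega) n
  have hMl : M < d ^ l := hl ▸ Nat.le_pow_clog (by omega) (M + 1)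
  have hnn : n * n ≤ (a * a) ^ k := by rw [mul_pow]; exact Nat.mul_le_mul hnk hnk
  have har : (a * a) ^ k ≤ rk ^ k := Nat.pow_le_pow_left hrk k
  have he : 1 ≤ (2 * d - 1) ^ l := Nat.pow_pos (by omega)
  have hrk' : 1 ≤ rk ^ k := Nat.pow_pos (by omega)
  have hS₁ : (2 * d - 1) ^ l ≤ S := hSe ▸ Nat.le_mul_of_pos_right _ hrk'
  have hS₂ : rk ^ k ≤ S := hSe ▸ Nat.le_mul_of_pos_left _ he
  have hS₃ : (2 * d - 1) ^ l * (a * a) ^ k ≤ S := hSe ▸ Nat.mul_le_mul_left _ har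
  have hS₄ : n * n * (2 * d - 1) ^ l ≤ S := by
    rw [mul_comm]; exact (Nat.mul_le_mul_left _ hnn).trans hS₃
  have hSK : S ≤ K := le_trans (by nlinarith) hK
  have hn₁ : n ≤ n * n := Nat.le_mul_self n
  have hak : a ^ k ≤ (a * a) ^ k := Nat.pow_le_pow_left (Nat.le_mul_self a) k
  simp only [List.mem_cons, List.not_mem_nil, or_false, forall_eq_or_imp, forall_eq] at hz
  obtain ⟨z9, z10, z11, z12, z13, z15⟩ := hz
  refine Ensures.mono (T := c₁ * (k + l + 1) + (c₂ * (n * n + (2 * d - 1) ^ l + 1) +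
    (c₃ * (S + 1) * (k + l + 1) + (c₄ * (n * n * (2 * d - 1) ^ l + 1) + c₅ * (n + 1))))) ?_ ?_ fun _ _ h => h
  · refine Ensures.seq (Ensures.mono (hc₁ (K := K) hs.size hs.maxWeight ?_ ?_ ?_) ?_ fun s₁ hf₁ hp₁ => ?_)
    · rw [← hk]; omega
    · rw [← hl]; omega
    · rwa [← hl]
    · rw [← hk, ← hl]
    rw [← hk, ← hl] at hp₁
    have hs₁ := hs.frame hf₁ rfl rfl rfl rfl rfl rfl
    refine Ensures.seq ((hc₂ (K := K) hs₁ hp₁ hF hM hnk hMl (by omega) (by omega) (by omega) ?_).mono le_rfl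
      fun s₂ hf₂ ht => ?_)
    · simp only [List.mem_cons, List.not_mem_nil, or_false, forall_eq_or_imp, forall_eq]
      exact ⟨(hf₁.2 9 rfl).trans z9, (hf₁.2 10 rfl).trans z10, (hf₁.2 11 rfl).trans z11,
        (hf₁.2 12 rfl).trans z12, (hf₁.2 13 rfl).trans z13, (hf₁.2 15 rfl).trans z15⟩
    have hs₂ := hs₁.frame hf₂ rfl rfl rfl rfl rfl rfl
    have e17 : s₂.reg 17 = a ^ k := (hf₂.1 17 rfl).trans hp₁.side
    have e18 : s₂.reg 18 = k := (hf₂.1 18 rfl).trans hp₁.sideExp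
    have e19 : s₂.reg 19 = d ^ l := (hf₂.1 19 rfl).trans hp₁.deg
    have e20 : s₂.reg 20 = l := (hf₂.1 20 rfl).trans hp₁.degExp
    have e21 : s₂.reg 21 = (2 * d - 1) ^ l := (hf₂.1 21 rfl).trans hp₁.prodDeg
    have e22 : s₂.reg 22 = D ^ l := (hf₂.1 22 rfl).trans hp₁.scale
    have e23 : s₂.reg 23 = (n + 1) * D ^ l := (hf₂.1 23 rfl).trans hp₁.modulus
    have hDl : 0 < D ^ l := Nat.pow_pos hD
    refine Ensures.seq ((hc₃ (K := K) e18 e20 e23 (Nat.mul_pos n.succ_pos hDl) hKm (by rw [e17, mul_pow]) e19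
      (by rw [← hSe]; exact hK)).mono (by rw [← hSe]) fun s₃ hf₃ hprod => ?_)
    have hs₃ := hs₂.frame hf₃ rfl rfl rfl rfl rfl rfl
    have hp₃ : HasParams n M a d D k l s₃ := ⟨(hf₃.1 17 rfl).trans e17, (hf₃.1 18 rfl).trans e18,
      (hf₃.1 19 rfl).trans e19, (hf₃.1 20 rfl).trans e20, (hf₃.1 21 rfl).trans e21, (hf₃.1 22 rfl).trans e22,
      (hf₃.1 23 rfl).trans e23⟩
    refine Ensures.seq ((hc₄ (K := K) hs₃ hp₃ hn hKM (by omega) (by omega) (by omega) (by omega) (by omega) ?_ ?_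
      ?_).mono le_rfl fun s₄ hf₄ ⟨hmin, h30, hex⟩ => ?_)
    · rw [hf₃.2 9 rfl]; exact ht.code
    · rw [hf₃.2 11 rfl]; exact ht.dec
    · intro i hi j hj hwin z hz' hMz
      have h₁ := hprod _ (mul_add_lt_mul hz' (pairCode_lt (by omega : 0 < a) k i j))
      simp only [ht.left, ht.right] at h₁
      rw [sum_tensorPow_eq_card D (by omega) (by omega) rfl hnk
        (fun x => InWindow M r (lab (x / n) (x % n))) (fun x => w (x / n) (x % n) ≠ 0)
        (fun x => lab (x / n) (x % n) + M - (r + 1)) (fun x => w (x / n) (x % n))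
        (fun x _ h => by have := h.1; have := h.2.1; omega)
        (fun x hx _ => (hM _ (div_lt_of_lt_sq hx) _ (mod_lt_of_lt_sq hx)).trans_lt hMl) hi hj hz',
        ZMod.natCast_eq_natCast_iff'] at h₁
      have h₂ : ∀ u ∈ Finset.range n, ((InWindow M r (lab ((i * n + u) / n) ((i * n + u) % n)) ∧
          w ((u * n + j) / n) ((u * n + j) % n) ≠ 0 ∧
          rebase d (2 * d - 1) l (lab ((i * n + u) / n) ((i * n + u) % n) + M - (r + 1)) +
            rebase d (2 * d - 1) l (w ((u * n + j) / n) ((u * n + j) % n)) = z) ↔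
          (InWindow M r (lab i u) ∧ w u j ≠ 0 ∧ rebase d (2 * d - 1) l (lab i u + M - (r + 1)) +
            rebase d (2 * d - 1) l (w u j) = z)) := by
        intro u hu
        rw [Finset.mem_range] at hu
        rw [mul_add_div_of_lt_right hu, mul_add_mod_of_lt_right hu, mul_add_div_of_lt_right hj,
          mul_add_mod_of_lt_right hj]
      rw [Finset.filter_congr h₂] at h₁
      have h₃ := Finset.card_filter_le (Finset.range n) fun u => InWindow M r (lab i u) ∧ w u j ≠ 0 ∧
        rebase d (2 * d - 1) l (lab i u + M - (r + 1)) + rebase d (2 * d - 1) l (w u j) = z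
      rw [Finset.card_range] at h₃
      -- The count is at most `n`, so its multiple by `D ^ l` is below the modulus and equals its
      -- residue.
      rw [Nat.mod_eq_of_lt (b := (n + 1) * D ^ l) (a := D ^ l * _)
        (by rw [mul_comm]; exact (Nat.mul_lt_mul_right hDl).2 (by omega))] at h₁
      rw [hp₃.modulus, hp₃.scale, h₁, hf₃.2 15 rfl, ht.child, Ne, Nat.mul_right_inj hDl.ne', ← Ne,
        card_ne_card_iff hF hirr hsym hnk (by omega) hi hj fun x y => rebase d (2 * d - 1) l (x + M - (r + 1)) +
          rebase d (2 * d - 1) l y]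
      exact ⟨fun h => ⟨hwin, hMz, h⟩, fun h => h.2.2⟩
    have hs₄ := hs₃.frame hf₄ rfl rfl rfl rfl rfl rfl
    have e16 : s₄.reg 16 = s.reg 16 := by rw [hf₄.1 16 rfl, hf₃.1 16 rfl, hf₂.1 16 rfl, hf₁.1 16 rfl]
    have hc₄ : HoldsChord n w lab par s₄ := by
      rw [HoldsChord, e16]
      rw [hf₄.1 8 rfl, hf₃.1 8 rfl, hf₂.1 8 rfl, hf₁.1 8 rfl, hf₄.1 9 rfl, hf₃.1 9 rfl, hf₂.1 9 rfl,
        hf₁.1 9 rfl, hf₄.1 10 rfl, hf₃.1 10 rfl, hf₂.1 10 rfl, hf₁.1 10 rfl]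
      exact hc
    refine (hc₅ (K := K) hs₄ hc₄ (by omega) (by omega) h30).mono le_rfl fun s₅ hf₅ ⟨g₁, g₂, g₃⟩ =>
      ⟨g₁, by omega, fun x u v hch hu hv => ?_⟩
    obtain ⟨hwin, z, hz', hcand, hval⟩ := hch.exists_isCandidate (M := M) (d := d) (l := l) (by omega) hE hM hMl
      hsym hu hv
    have h₁ := hmin x hch.source_lt v hch.right_lt z hz' hcand
    have h₂ := hM u hch.left_lt v hch.right_lt
    have h₃ := hwin.2.1
    -- The given chord yields a candidate of value below `3 * M`, so the search has not returned the
    -- sentinel.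
    obtain ⟨z', hz'', hcand', hval'⟩ := hex (by omega)
    obtain ⟨u', hu', hch', hval''⟩ := hcand'.exists_isChord (by omega) hF hM hMl hirr (div_lt_of_lt_sq h30)
      (mod_lt_of_lt_sq h30)
    have h₄ := g₃ u' hu' hch'
    have h₅ := hcand'.1.2.2
    have h₆ := hwin.2.2
    omega
  · have q₁ : c₁ * (k + l + 1) ≤ c₁ * ((S + 1) * (k + l + 1)) :=
      Nat.mul_le_mul_left _ (Nat.le_mul_of_pos_left _ (by omega))
    have q₂ : c₂ * (n * n + (2 * d - 1) ^ l + 1) ≤ c₂ * (2 * ((S + 1) * (k + l + 1))) := by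
      refine Nat.mul_le_mul_left _ ?_
      have : S + 1 ≤ (S + 1) * (k + l + 1) := Nat.le_mul_of_pos_right _ (by omega)
      omega
    have q₄ : c₄ * (n * n * (2 * d - 1) ^ l + 1) ≤ c₄ * ((S + 1) * (k + l + 1)) :=
      Nat.mul_le_mul_left _ ((Nat.succ_le_succ hS₄).trans (Nat.le_mul_of_pos_right _ (by omega)))
    have q₅ : c₅ * (n + 1) ≤ c₅ * ((S + 1) * (k + l + 1)) :=
      Nat.mul_le_mul_left _ (le_trans (by omega) (Nat.le_mul_of_pos_right (S + 1) (by omega)))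
    linarith

/-! ### The output -/

/-- Iteration never leaves the tree, because the root is its own parent. -/
theorem IsForest.iterate {n : ℕ} {w lab par dep : ℕ → ℕ → ℕ} (hF : IsForest n w lab par dep) {s u : ℕ}
    (hs : s < n) (hu : u < n) (hl : lab s u ≠ 0) (i : ℕ) :
    (par s)^[i] u < n ∧ lab s ((par s)^[i] u) ≠ 0 := by
  induction i with
  | zero => exact ⟨hu, hl⟩
  | succ i ih =>
    rw [Function.iterate_succ_apply']
    by_cases h : (par s)^[i] u = s
    · rw [h, hF.par_self s hs]
      exact ⟨hs, by rw [hF.lab_self s hs]; exact one_ne_zero⟩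
    · obtain ⟨h₁, h₂, -⟩ := hF.step s hs _ ih.1 ih.2 h
      exact ⟨h₁, h₂⟩

/-- The list of the vertices of the closed walk given by a chord. -/
theorem map_range_eq_chord (f p q : ℕ → ℕ) (v a b : ℕ) (h₀ : f 0 = v)
    (h₁ : ∀ i ≤ a, f (i + 1) = p i) (h₂ : ∀ i < b, f (a + b + 1 - i) = q i) :
    (List.range (a + b + 1)).map f = v :: ((List.range (a + 1)).map p ++
      ((List.range b).map q).reverse).dropLast := by
  apply List.ext_getElem
  · simp
  · intro i hi hi'
    simp only [List.length_map, List.length_range] at hi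
    rw [List.getElem_map, List.getElem_range]
    rcases i with _ | i
    · simpa using h₀
    · rw [List.getElem_cons_succ, List.getElem_dropLast, List.getElem_append]
      split_ifs with h
      · simp only [List.length_map, List.length_range] at h
        simpa using h₁ i (by omega)
      · simp only [List.length_map, List.length_range] at h
        simp only [List.getElem_reverse, List.getElem_map, List.getElem_range, List.length_map,
          List.length_range]
        rw [← h₂ _ (by omega)]
        congr 1
        omega

/-- Write a path to the root of the tree into array `1`. -/
def pathProg (bound pos : WordExpr) : WordProg :=
  forLoop 2 bound (block [.store 1 pos (reg 15), .assign 15 (load 6 (reg 8 * reg 0 + reg 15))])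

/-- Write the closed walk given by the best chord into array `1`, and its length into register `0`. -/
def outputProg : WordProg :=
  block [.assign 13 (load 7 (reg 8 * reg 0 + reg 9)), .assign 14 (load 7 (reg 8 * reg 0 + reg 10)),
    .store 1 (const 0) (reg 10), .assign 15 (reg 9), pathProg (reg 13 + const 1) (reg 2 + const 1),
    .assign 15 (reg 10), pathProg (reg 14) (reg 13 + reg 14 + const 1 - reg 2),
    .assign 0 (reg 13 + reg 14 + const 1)]

/-- The injectivity of the positions `f` ensures that no vertex of the path is overwritten by a
later one. -/
theorem pathProg_spec {K n N : ℕ} {w lab par dep : ℕ → ℕ → ℕ} {bound pos : WordExpr} {s : WordState}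
    {f : ℕ → ℕ} (hF : IsForest n w lab par dep) (h0 : s.reg 0 = n) (h6 : tableOf n (s.arr 6) = par)
    (h8 : s.reg 8 < n) (h15 : s.reg 15 < n) (hl : lab (s.reg 8) (s.reg 15) ≠ 0) (hn : n ≤ K) (hN : N ≤ K)
    (hb : ∀ s', (pathProg bound pos).Frame s s' → bound.eval s' = N)
    (hp : ∀ j s', j < N → (pathProg bound pos).Frame s s' → s'.reg 2 = j → pos.eval s' = f j)
    (hf : ∀ i < N, ∀ j < N, f i = f j → i = j) :
    Ensures K (pathProg bound pos) s ((bound.cost + pos.cost + 30) * (N + 1)) (fun s' =>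
      (∀ i < N, s'.arr 1 (f i) = (par (s.reg 8))^[i] (s.reg 15)) ∧
      ∀ x, (∀ i < N, x ≠ f i) → s'.arr 1 x = s.arr 1 x) := by
  refine (Ensures.forLoop (N := N) (T := (block [.store 1 pos (reg 15),
    .assign 15 (load 6 (reg 8 * reg 0 + reg 15))]).cost) (fun j s' =>
      s'.reg 15 = (par (s.reg 8))^[j] (s.reg 15) ∧
      (∀ i < j, s'.arr 1 (f i) = (par (s.reg 8))^[i] (s.reg 15)) ∧
      ∀ x, (∀ i < j, x ≠ f i) → s'.arr 1 x = s.arr 1 x) hN rfl hb ?_ ?_).mono ?_ ?_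
  · simp
  · rintro j s' hj hfr hi ⟨h₁, h₂, h₃⟩
    have e0 : s'.reg 0 = n := (hfr.1 0 rfl).trans h0
    have e8 : s'.reg 8 = s.reg 8 := hfr.1 8 rfl
    have e6 : ∀ v, s'.arr 6 (s.reg 8 * n + v) = par (s.reg 8) v := fun v => by
      rw [hfr.2 6 rfl, ← h6, tableOf]
    have b₁ := (hF.iterate h8 h15 hl j).1
    have b₂ := (hF.iterate h8 h15 hl (j + 1)).1
    rw [Function.iterate_succ_apply'] at b₂
    have epos := hp j s' hj hfr hi
    refine Ensures.of_wp ?_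
    simp only [block, wp, epos, eval_reg, h₁, eval_load, eval_add, eval_mul, WordState.setArr_reg, e0, e8,
      WordState.setReg_reg, WordState.setReg_arr, WordState.setArr_arr_self]
    rw [WordState.setArr_arr_ne _ _ _ _ _ (by norm_num), e6]
    refine ⟨by omega, by omega, ?_, fun i hi => ?_, fun x hx => ?_⟩
    · simp [Function.iterate_succ_apply']
    · rw [Function.update_apply]
      split_ifs with h
      · rw [hf i (by omega) j hj h]
      · refine h₂ i (lt_of_le_of_ne (by omega) ?_)
        rintro rfl
        exact h rfl
    · rw [Function.update_of_ne (hx j (by omega))]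
      exact h₃ x fun i hi => hx i (by omega)
  · refine Nat.mul_le_mul_right _ ?_
    simp only [block, WordProg.cost]
    change bound.cost + (pos.cost + 1 + 1 + (6 + 1)) + 12 ≤ _
    omega
  · rintro s' - ⟨-, h₂, h₃⟩
    exact ⟨h₂, h₃⟩

theorem outputProg_spec {K n B : ℕ} {w lab par dep : ℕ → ℕ → ℕ} {s : WordState}
    (hF : IsForest n w lab par dep) (h0 : s.reg 0 = n) (h6 : tableOf n (s.arr 6) = par)
    (h7 : tableOf n (s.arr 7) = dep) (hc : IsChord n w lab par (s.reg 8) (s.reg 9) (s.reg 10))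
    (hB : ∀ u < n, ∀ v < n, lab u v ≤ B) (hnK : n ≤ K) (hBK : 2 * B + 1 ≤ K) :
    Ensures K outputProg s (200 * (B + 1)) (fun s' => cycleOutput s' =
      s.reg 10 :: ((List.range (dep (s.reg 8) (s.reg 9) + 1)).map (fun i => (par (s.reg 8))^[i] (s.reg 9)) ++
        ((List.range (dep (s.reg 8) (s.reg 10))).map
          (fun i => (par (s.reg 8))^[i] (s.reg 10))).reverse).dropLast) := by
  obtain ⟨hs, hu, hv, lu, lv, -, -⟩ := hc
  have d₁ := hF.dep_lt_lab hs _ _ hu le_rfl lu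
  have d₂ := hF.dep_lt_lab hs _ _ hv le_rfl lv
  have b₁ := hB _ hs _ hu
  have b₂ := hB _ hs _ hv
  have e7 : ∀ x y, s.arr 7 (x * n + y) = dep x y := fun x y => by rw [← h7, tableOf]
  obtain ⟨a, ha⟩ : ∃ a, a = dep (s.reg 8) (s.reg 9) := ⟨_, rfl⟩
  obtain ⟨b, hb⟩ : ∃ b, b = dep (s.reg 8) (s.reg 10) := ⟨_, rfl⟩
  rw [← ha] at d₁
  rw [← hb] at d₂
  rw [← ha, ← hb]
  refine Ensures.mono (T := 7 + (7 + (3 + (2 + (36 * (a + 1 + 1) + (2 + (38 * (b + 1) + 6))))))) ?_ (by omega)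
    fun _ _ h => h
  refine Ensures.seq ⟨_, _, .assign 13 _ s ?_, le_rfl, Ensures.seq ⟨_, _, .assign 14 _ _ ?_, le_rfl,
    Ensures.seq ⟨_, _, .store 1 _ _ _ ?_, le_rfl, Ensures.seq ⟨_, _, .assign 15 _ _ ?_, le_rfl,
      Ensures.seq ((pathProg_spec (N := a + 1) (f := fun i => i + 1) (n := n) (w := w) (lab := lab) (par := par)
        (dep := dep) hF ?_ ?_ ?_ ?_ ?_ hnK ?_ ?_ ?_ ?_).mono le_rfl ?_)⟩⟩⟩⟩
  · simp [h0, e7]; omega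
  · simp [h0, e7]; omega
  · simp; omega
  · simp; omega
  · simp [h0]
  · simpa using h6
  · simpa using hs
  · simpa using hu
  · simpa using lu
  · omega
  · intro s' hf
    simp [hf.1 13 rfl, h0, e7, ha]
  · intro j s' hj hf hi
    simp [hi]
  · intro i _ j _ h
    exact Nat.succ_injective h
  rintro s₁ hf₁ ⟨g₁, g₂⟩
  have r0 : s₁.reg 0 = n := (hf₁.1 0 rfl).trans (by simp [h0])
  have r8 : s₁.reg 8 = s.reg 8 := (hf₁.1 8 rfl).trans (by simp)
  have r10 : s₁.reg 10 = s.reg 10 := (hf₁.1 10 rfl).trans (by simp)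
  have r13 : s₁.reg 13 = a := (hf₁.1 13 rfl).trans (by simp [h0, e7, ha])
  have r14 : s₁.reg 14 = b := (hf₁.1 14 rfl).trans (by simp [h0, e7, hb])
  have a6 : s₁.arr 6 = s.arr 6 := (hf₁.2 6 rfl).trans (by simp)
  simp only [WordState.setReg_reg, WordState.setReg_arr, WordState.setArr_reg, Nat.reduceEqDiff, if_false, if_true,
    eval_reg, eval_const, WordState.setArr_arr_self] at g₁ g₂
  -- The path from `v` is written backwards from position `a + b + 1`, just past the output: `v`
  -- itself is already in cell `0`. The root, written by the first path, is not repeated.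
  refine Ensures.seq ⟨_, _, .assign 15 _ s₁ ?_, le_rfl, Ensures.seq ((pathProg_spec (N := b)
    (f := fun i => a + b + 1 - i) (n := n) (w := w) (lab := lab) (par := par) (dep := dep) hF ?_ ?_ ?_ ?_ ?_ hnK ?_ ?_
      ?_ ?_).mono le_rfl ?_)⟩
  · simp [r10]; omega
  · simp [r0]
  · simpa [a6] using h6
  · simpa [r8] using hs
  · simpa [r10] using hv
  · simpa [r8, r10] using lv
  · omega
  · intro s' hf
    simp [hf.1 14 rfl, r14]
  · intro j s' hj hf hi
    simp [hi, hf.1 13 rfl, hf.1 14 rfl, r13, r14]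
  · intro i hi j hj h
    omega
  rintro s₂ hf₂ ⟨k₁, k₂⟩
  have t13 : s₂.reg 13 = a := (hf₂.1 13 rfl).trans (by simp [r13])
  have t14 : s₂.reg 14 = b := (hf₂.1 14 rfl).trans (by simp [r14])
  simp only [WordState.setReg_reg, WordState.setReg_arr, Nat.reduceEqDiff, if_false, if_true, eval_reg, r8, r10]
    at k₁ k₂
  refine ⟨_, _, .assign 0 _ s₂ ?_, le_rfl, ?_⟩
  · simp [t13, t14]; omega
  · simp only [cycleOutput, WordState.setReg_reg, WordState.setReg_arr, if_true, eval_add, eval_reg, eval_const, t13, t14]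
    apply map_range_eq_chord
    · rw [k₂ 0 (fun i _ => by omega), g₂ 0 (fun i _ => by omega)]
      simp
    · intro i hi
      rw [k₂ (i + 1) (fun j _ => by omega), g₁ i (by omega)]
    · exact k₁

/-! ### The algorithm -/

theorem cycleInput_weight {n : ℕ} (G : SimpleGraph (Fin n)) (wt : Sym2 (Fin n) → ℕ) (M : ℕ) (i j : Fin n) :
    (G.Adj i j → tableOf n ((cycleInput G wt M).arr 0) i j = wt s(i, j)) ∧
      (¬ G.Adj i j → tableOf n ((cycleInput G wt M).arr 0) i j = 0) := by
  have h : (i : ℕ) * n + j < n * n := mul_add_lt_sq i.2 j.2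
  have h₁ : (⟨i * n + j, h⟩ : Fin (n * n)).divNat = i := Fin.ext (by simp [mul_add_div_of_lt_right j.2])
  have h₂ : (⟨i * n + j, h⟩ : Fin (n * n)).modNat = j := Fin.ext (by simp [mul_add_mod_of_lt_right j.2])
  simp only [tableOf, cycleInput, if_true, dif_pos h]
  refine ⟨fun hA => ?_, fun hA => if_neg (by rwa [h₁, h₂])⟩
  rw [if_pos (by rwa [h₁, h₂]), h₁, h₂]

/-- Find a minimum weight cycle. -/
def minCycleProg (a rk : ℕ) (U V W : ℕ → ℕ → ℤ) (d D : ℕ) (U' V' W' : ℕ → ℕ → ℤ) : WordProg :=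
  block [sortAdjProg, exploreProg, .ite ((reg 7).eq (const 0)) (.assign 0 (const 0))
    (block [.assign 16 (load 5 (reg 8 * reg 0 + reg 9) + load 0 (reg 9 * reg 0 + reg 10) +
      load 5 (reg 8 * reg 0 + reg 10)),
      .ite ((reg 1).lt (reg 0)) (fastProg a rk U V W d D U' V' W') bruteForceProg, outputProg])]

/-- The first chord serves as the initial best chord. For `M < n` it is improved by the tensor
product, for `M ≥ n` by testing all triples, since then `n³ ≤ M n²`. -/
theorem minCycleProg_spec {a rk d D : ℕ} {U V W U' V' W' : ℕ → ℕ → ℤ} (ha : 2 ≤ a) (hrk : a * a ≤ rk)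
    (hd : 2 ≤ d) (hD : 0 < D) (hS : IsScheme rk (a * a) (a * a) (matMulTensor a) U V W)
    (hS' : IsScheme (2 * d - 1) d (2 * d - 1) (polyMulTensor D) U' V' W') :
    ∃ c, ∀ {K n M k l S : ℕ} (G : SimpleGraph (Fin n)) (wt : Sym2 (Fin n) → ℕ),
      k = Nat.clog a n → l = Nat.clog d (M + 1) → S = (2 * d - 1) ^ l * rk ^ k → 1 ≤ n → 1 ≤ M →
      (∀ e ∈ G.edgeSet, 1 ≤ wt e ∧ wt e ≤ M) → n * n * n + M * (n * n) + 4 * (n * M) + 20 ≤ K →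
      (M < n → (k + l + 2) * (S + 1) ≤ K ∧ (n + 1) * D ^ l ≤ K) →
      Ensures K (minCycleProg a rk U V W d D U' V' W') (cycleInput G wt M)
        (c * (M * (n * n) + if M < n then (S + 1) * (k + l + 1) else 0))
        (fun s' => IsCorrectOutput G wt (cycleOutput s')) := by
  obtain ⟨c₁, hc₁⟩ := sortAdjProg_spec
  obtain ⟨c₂, hc₂⟩ := exploreProg_spec
  obtain ⟨c₃, hc₃⟩ := fastProg_spec ha hrk hd hD hS hS'
  obtain ⟨c₄, hc₄⟩ := bruteForceProg_spec
  refine ⟨2 * c₁ + 9 * c₂ + c₃ + 2 * c₄ + 1000, fun {K n M k l S} G wt hk hl hSe hn hM hwt hK hKf => ?_⟩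
  obtain ⟨s, hs⟩ : ∃ s, s = cycleInput G wt M := ⟨_, rfl⟩
  obtain ⟨w, hw⟩ : ∃ w, w = tableOf n (s.arr 0) := ⟨_, rfl⟩
  obtain ⟨F, hF⟩ : ∃ F, F = if M < n then (S + 1) * (k + l + 1) else 0 := ⟨_, rfl⟩
  rw [← hs, ← hF]
  have s0 : s.reg 0 = n := by rw [hs]; rfl
  have s1 : s.reg 1 = M := by rw [hs]; rfl
  have sz : ∀ a ≠ 0, s.arr a = fun _ => 0 := fun a ha => by
    rw [hs]; funext i; simp [cycleInput, ha]
  have hwf : ∀ i j : Fin n, (G.Adj i j → w i j = wt s(i, j)) ∧ (¬ G.Adj i j → w i j = 0) := fun i j => by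
    rw [hw, hs]; exact cycleInput_weight G wt M i j
  have hadj : ∀ i j : Fin n, w i j ≠ 0 → G.Adj i j ∧ wt s(i, j) = w i j := fun i j h => by
    have hA : G.Adj i j := by
      by_contra hA
      exact h ((hwf i j).2 hA)
    exact ⟨hA, ((hwf i j).1 hA).symm⟩
  have hadj' : ∀ i j : Fin n, G.Adj i j → w i j ≠ 0 ∧ wt s(i, j) = w i j := fun i j h => by
    have h₁ := (hwf i j).1 h
    have h₂ := (hwt s(i, j) (G.mem_edgeSet.2 h)).1
    exact ⟨by omega, h₁.symm⟩
  have hM' : ∀ u < n, ∀ v < n, w u v ≤ M := fun u hu v hv => by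
    by_cases hA : G.Adj ⟨u, hu⟩ ⟨v, hv⟩
    · have h₁ := (hwf ⟨u, hu⟩ ⟨v, hv⟩).1 hA
      have h₂ := (hwt _ (G.mem_edgeSet.2 hA)).2
      simp only at h₁
      omega
    · have h₁ := (hwf ⟨u, hu⟩ ⟨v, hv⟩).2 hA
      simp only at h₁
      omega
  have hsym : ∀ u < n, ∀ v < n, w u v = w v u := fun u hu v hv => by
    by_cases hA : G.Adj ⟨u, hu⟩ ⟨v, hv⟩
    · have h₁ := (hwf ⟨u, hu⟩ ⟨v, hv⟩).1 hA
      have h₂ := (hwf ⟨v, hv⟩ ⟨u, hu⟩).1 hA.symm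
      rw [Sym2.eq_swap] at h₂
      exact h₁.trans h₂.symm
    · have h₁ := (hwf ⟨u, hu⟩ ⟨v, hv⟩).2 hA
      have h₂ := (hwf ⟨v, hv⟩ ⟨u, hu⟩).2 fun h => hA h.symm
      exact h₁.trans h₂.symm
  have hirr : ∀ u < n, w u u = 0 := fun u hu => (hwf ⟨u, hu⟩ ⟨u, hu⟩).2 (G.loopless.irrefl _)
  have hn₂ : n ≤ n * n := Nat.le_mul_self n
  have hn₃ : n * n ≤ n * n * n := Nat.le_mul_of_pos_right _ hn
  have hnM : n * M ≤ M * (n * n) := by rw [mul_comm]; exact Nat.mul_le_mul_left _ hn₂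
  have hMn : n * n ≤ M * (n * n) := Nat.le_mul_of_pos_left _ hM
  have hMnM : M ≤ n * M := Nat.le_mul_of_pos_left _ hn
  refine Ensures.mono (T := c₁ * (M * (n * n) + 1) + (c₂ * (n * M + n * n * (M + 3) + n + 3) +
    (((reg 7).eq (const 0)).cost + 1 + (21 + ((4 + (c₃ * F + c₄ * (2 * (M * (n * n))))) +
      200 * (n * M + 2 + 1)))))) ?_ ?_ fun _ _ h => h
  · refine Ensures.seq ((hc₁ (K := K) s0 s1 (by omega) (by omega) (sz 3 (by norm_num)) (by
      intro u hu v hv; have := hM' u hu v hv; rwa [hw] at this)).mono le_rfl fun s₁ hf₁ hA => ?_)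
    refine Ensures.seq ((hc₂ (K := K) (w := w) ((hf₁.1 0 rfl).trans s0) ((hf₁.1 1 rfl).trans s1) (by omega)
      ((hf₁.2 5 rfl).trans (sz 5 (by norm_num))) ((hf₁.2 7 rfl).trans (sz 7 (by norm_num)))
      ((hf₁.2 8 rfl).trans (sz 8 (by norm_num))) (by rw [hf₁.2 0 rfl, hw]) (by rw [hw]; exact hA) hM').mono
      le_rfl ?_)
    rintro s₂ hf₂ ⟨hFo, hE, hlab, hr, hfound⟩
    obtain ⟨lab, hlab'⟩ : ∃ lab, lab = tableOf n (s₂.arr 5) := ⟨_, rfl⟩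
    obtain ⟨par, hpar⟩ : ∃ par, par = tableOf n (s₂.arr 6) := ⟨_, rfl⟩
    obtain ⟨dep, hdep⟩ : ∃ dep, dep = tableOf n (s₂.arr 7) := ⟨_, rfl⟩
    obtain ⟨r, hr'⟩ : ∃ r, r = s₂.reg 3 := ⟨_, rfl⟩
    rw [← hlab', ← hpar, ← hdep] at hFo
    rw [← hlab', ← hpar, ← hr'] at hE hfound
    rw [← hlab', ← hr'] at hlab
    rw [← hr'] at hr
    have hs₂ : StoresForest n M w lab par r s₂ := ⟨(hf₂.1 0 rfl).trans ((hf₁.1 0 rfl).trans s0),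
      (hf₂.1 1 rfl).trans ((hf₁.1 1 rfl).trans s1), hr'.symm, by rw [hf₂.2 0 rfl, hf₁.2 0 rfl, hw], hlab'.symm,
      hpar.symm⟩
    refine Ensures.ite (fun h7 => ?_) (fun h7 => ?_)
    · have h7' : s₂.reg 7 = 0 := by simpa using h7
      refine ⟨_, _, .assign 0 _ s₂ (Nat.zero_le _), by change 2 ≤ _; omega, Or.inl ⟨?_, ?_⟩⟩
      · rcases hfound with h | h
        · exact hE.isAcyclic hFo h.2 (fun e he => (hwt e he).2) hadj'
        · omega
      · simp [cycleOutput]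
    · obtain ⟨-, hch, hval, hlv⟩ := hfound.resolve_left fun h => by simp [h.1] at h7
      have e5 : ∀ x y, s₂.arr 5 (x * n + y) = lab x y := fun x y => by rw [hlab', tableOf]
      have e0 : ∀ x y, s₂.arr 0 (x * n + y) = w x y := fun x y => by rw [← hs₂.weight, tableOf]
      have hlu := hlab _ hch.source_lt _ hch.left_lt
      refine Ensures.seq ⟨_, _, .assign 16 _ s₂ ?_, le_rfl, ?_⟩
      · simp only [eval_add, eval_mul, eval_load, eval_reg, hs₂.size, e5, e0]
        omega
      obtain ⟨s₃, hs₃'⟩ : ∃ s₃, s₃ = s₂.setReg 16 (eval s₂ (load 5 (reg 8 * reg 0 + reg 9) +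
        load 0 (reg 9 * reg 0 + reg 10) + load 5 (reg 8 * reg 0 + reg 10))) := ⟨_, rfl⟩
      rw [← hs₃']
      have hs₃ : StoresForest n M w lab par r s₃ := by
        rw [hs₃']
        exact ⟨by simp [hs₂.size], by simp [hs₂.maxWeight], by simp [hs₂.radius], by simp [hs₂.weight],
          by simp [hs₂.lab], by simp [hs₂.par]⟩
      have hc₃' : HoldsChord n w lab par s₃ := by
        rw [hs₃']
        simp only [HoldsChord, WordState.setReg_reg, Nat.reduceEqDiff, if_false, if_true, eval_add, eval_mul,
          eval_load, eval_reg, hs₂.size, e5, e0]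
        exact ⟨hch, trivial⟩
      have h16 : s₃.reg 16 ≤ 2 * (r + 1) := by
        rw [hs₃']
        simp only [WordState.setReg_reg, if_true, eval_add, eval_mul, eval_load, eval_reg, hs₂.size, e5, e0]
        omega
      have h7₃ : tableOf n (s₃.arr 7) = dep := by rw [hs₃', hdep]; rfl
      have hz₃ : ∀ a ∈ [9, 10, 11, 12, 13, 15], s₃.arr a = fun _ => 0 := by
        simp only [List.mem_cons, List.not_mem_nil, or_false, forall_eq_or_imp, forall_eq]
        rw [hs₃']
        simp only [WordState.setReg_arr]
        refine ⟨?_, ?_, ?_, ?_, ?_, ?_⟩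
        · rw [hf₂.2 9 rfl, hf₁.2 9 rfl, sz 9 (by norm_num)]
        · rw [hf₂.2 10 rfl, hf₁.2 10 rfl, sz 10 (by norm_num)]
        · rw [hf₂.2 11 rfl, hf₁.2 11 rfl, sz 11 (by norm_num)]
        · rw [hf₂.2 12 rfl, hf₁.2 12 rfl, sz 12 (by norm_num)]
        · rw [hf₂.2 13 rfl, hf₁.2 13 rfl, sz 13 (by norm_num)]
        · rw [hf₂.2 15 rfl, hf₁.2 15 rfl, sz 15 (by norm_num)]
      refine Ensures.seq (Ensures.mono (Ensures.ite (Q := fun s' => (HoldsChord n w lab par s' ∧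
        s'.reg 16 ≤ s₃.reg 16 ∧ ∀ x u v, IsChord n w lab par x u v → lab x u ≤ r → lab x v ≤ r →
          s'.reg 16 ≤ lab x u + w u v + lab x v) ∧ tableOf n (s'.arr 6) = par ∧ tableOf n (s'.arr 7) = dep ∧
            s'.reg 0 = n) (T := c₃ * F + c₄ * (2 * (M * (n * n)))) ?_ ?_) le_rfl ?_)
      · intro hlt
        have hlt' : M < n := by simpa [hs₃.size, hs₃.maxWeight] using hlt
        obtain ⟨k₁, k₂⟩ := hKf hlt'
        refine (hc₃ (K := K) hk hl hSe hs₃ hc₃' hFo hE hM' hsym hirr hn hz₃ k₁ k₂ (by omega) (by omega)).mono ?_ ?_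
        · rw [hF, if_pos hlt', mul_assoc]
          exact Nat.le_add_right _ _
        · rintro s' hf h
          exact ⟨h, by rw [hf.2 6 rfl]; exact hs₃.par, by rw [hf.2 7 rfl]; exact h7₃,
            (hf.1 0 rfl).trans hs₃.size⟩
      · intro hge
        have hge' : n ≤ M := by simpa [hs₃.size, hs₃.maxWeight] using hge
        refine (hc₄ (K := K) hs₃ hc₃' (by omega) (by omega)).mono ?_ ?_
        · have : n * n * n ≤ M * (n * n) := by rw [mul_comm]; exact Nat.mul_le_mul_right _ hge'
          exact (Nat.mul_le_mul_left c₄ (by omega)).trans (Nat.le_add_left _ _)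
        · rintro s' hf ⟨h₁, h₂, h₃⟩
          exact ⟨⟨h₁, h₂, fun x u v hc _ _ => h₃ x u v hc⟩, by rw [hf.2 6 rfl]; exact hs₃.par,
            by rw [hf.2 7 rfl]; exact h7₃, (hf.1 0 rfl).trans hs₃.size⟩
      rintro s₄ - ⟨⟨⟨hch₄, hv₄⟩, hle, hmin⟩, h6, h7', h0⟩
      refine (outputProg_spec (B := n * M + 2) hFo h0 h6 h7' hch₄ (fun u hu v hv => ?_) (by omega)
        (by omega)).mono le_rfl fun s₅ _ hout => Or.inr ?_
      · have := hlab u hu v hv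
        omega
      have hmin' : ∀ (x : Fin n) (c : G.Walk x x), c.IsCycle →
          lab (s₄.reg 8) (s₄.reg 9) + w (s₄.reg 9) (s₄.reg 10) + lab (s₄.reg 8) (s₄.reg 10) ≤
            walkWeight wt c + 2 := by
        intro x c hc
        rw [← hv₄]
        -- A cycle of weight at least `2 r` cannot be lighter than the closed walk of the chord that
        -- ended the exploration.
        by_cases hr₂ : walkWeight wt c + 1 ≤ 2 * r
        · obtain ⟨x', u', v', q₁, q₂, q₃, q₄⟩ := hE.exists_isChord hFo hadj' c hc hr₂
          exact (hmin x' u' v' q₁ q₃ q₄).trans q₂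
        · omega
      obtain ⟨x, c, hc, hsup⟩ := hch₄.exists_isMinWeightCycle hFo (fun e he => (hwt e he).1) hadj hmin'
      exact ⟨x, c, hc, by rw [hout, hsup]⟩
  · have h₁ : ((reg 7).eq (const 0)).cost = 3 := rfl
    rw [h₁]
    have h₂ : 1 ≤ M * (n * n) := by nlinarith
    have h₃ : n * n * (M + 3) = M * (n * n) + 3 * (n * n) := by ring
    have p₁ : c₁ * (M * (n * n) + 1) ≤ c₁ * (2 * (M * (n * n) + F)) := Nat.mul_le_mul_left _ (by omega)
    have p₂ : c₂ * (n * M + n * n * (M + 3) + n + 3) ≤ c₂ * (9 * (M * (n * n) + F)) :=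
      Nat.mul_le_mul_left _ (by omega)
    have p₃ : c₃ * F ≤ c₃ * (M * (n * n) + F) := Nat.mul_le_mul_left _ (by omega)
    have p₄ : c₄ * (2 * (M * (n * n))) ≤ c₄ * (2 * (M * (n * n) + F)) := Nat.mul_le_mul_left _ (by omega)
    have p₅ : 3 + 1 + 21 + 4 + 200 * (n * M + 2 + 1) ≤ 1000 * (M * (n * n) + F) := by omega
    linarith

/-! ### The running time -/

theorem pow_clog_le_mul {a x : ℕ} (ha : 2 ≤ a) (hx : 1 ≤ x) : a ^ Nat.clog a x ≤ a * x := by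
  rcases Nat.lt_or_eq_of_le hx with h | h
  · have h₁ := Nat.pow_pred_clog_lt_self (b := a) (by omega) h
    have h₂ := Nat.clog_pos (b := a) (by omega) h
    obtain ⟨k, hk⟩ := Nat.exists_eq_succ_of_ne_zero h₂.ne'
    rw [hk, Nat.succ_eq_add_one, pow_succ']
    rw [hk] at h₁
    exact Nat.mul_le_mul_left a h₁.le
  · rw [← h, Nat.clog_one_right, pow_zero]
    omega

/-- Rounding `x` up to a power of `a` costs a factor of at most `a`, hence a constant factor in the
rank. -/
theorem pow_clog_le_rpow {a x R : ℕ} {ρ : ℝ} (ha : 2 ≤ a) (hx : 1 ≤ x) (hρ : 0 ≤ ρ)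
    (hR : (R : ℝ) ≤ (a : ℝ) ^ ρ) : ((R ^ Nat.clog a x : ℕ) : ℝ) ≤ (a : ℝ) ^ ρ * (x : ℝ) ^ ρ := by
  have h : ((a ^ Nat.clog a x : ℕ) : ℝ) ≤ ((a * x : ℕ) : ℝ) := by exact_mod_cast pow_clog_le_mul ha hx
  push_cast at h ⊢
  calc (R : ℝ) ^ Nat.clog a x ≤ ((a : ℝ) ^ ρ) ^ Nat.clog a x := pow_le_pow_left₀ (Nat.cast_nonneg R) hR _
    _ = ((a : ℝ) ^ Nat.clog a x) ^ ρ := Real.rpow_pow_comm (Nat.cast_nonneg a) ρ _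
    _ ≤ ((a : ℝ) * x) ^ ρ := Real.rpow_le_rpow (by positivity) h hρ
    _ = _ := Real.mul_rpow (Nat.cast_nonneg a) (Nat.cast_nonneg x)

/-- A constant `a` with `a ^ δ ≥ C` absorbs the constant of the programs into the exponent. This
matters because Kronecker powers would raise `C` to the power `k`. -/
theorem exists_scheme_rank_le {τ δ : ℝ} (hδ : 0 < δ) (h : ∃ C : ℝ, ∀ n : ℕ, 1 ≤ n →
    ∃ p : List (SLInstr n), ComputesMatrixProduct p ∧ (p.length : ℝ) ≤ C * (n : ℝ) ^ τ) :
    ∃ a rk : ℕ, 2 ≤ a ∧ a * a ≤ rk ∧ (rk : ℝ) ≤ (a : ℝ) ^ (τ + δ) ∧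
      ∃ U V W, IsScheme rk (a * a) (a * a) (matMulTensor a) U V W := by
  obtain ⟨C, hC⟩ := h
  obtain ⟨a, ha, ha₂⟩ := ((((tendsto_rpow_atTop hδ).comp tendsto_natCast_atTop_atTop).eventually_ge_atTop C).and
    (Filter.eventually_ge_atTop 2)).exists
  obtain ⟨p, hp, hlen⟩ := hC a (by omega)
  refine ⟨a, p.length, ha₂, hp.sq_le_length, hlen.trans ?_, hp.exists_isScheme⟩
  have ha₀ : (0 : ℝ) < a := by exact_mod_cast (by omega : 0 < a)
  rw [add_comm, Real.rpow_add ha₀]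
  exact mul_le_mul_of_nonneg_right ha (by positivity)

/-- The factor `2` in `2 d - 1` is absorbed by `d ^ δ`, again to prevent it from growing with the
power. -/
theorem exists_degree {δ : ℝ} (hδ : 0 < δ) : ∃ d : ℕ, 2 ≤ d ∧ ((2 * d - 1 : ℕ) : ℝ) ≤ (d : ℝ) ^ (1 + δ) := by
  obtain ⟨d, hd, hd₂⟩ := ((((tendsto_rpow_atTop hδ).comp tendsto_natCast_atTop_atTop).eventually_ge_atTop 2).and
    (Filter.eventually_ge_atTop 2)).exists
  refine ⟨d, hd₂, ?_⟩
  have hd₀ : (0 : ℝ) < d := by exact_mod_cast (by omega : 0 < d)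
  have h : ((2 * d - 1 : ℕ) : ℝ) ≤ 2 * d := by exact_mod_cast Nat.sub_le (2 * d) 1
  rw [add_comm, Real.rpow_add hd₀, Real.rpow_one]
  exact h.trans (mul_le_mul_of_nonneg_right hd hd₀.le)

/-- One `δ` comes from the rank of the matrix scheme, the other from the polynomials: they cost `M ^
(1 + δ)`, and `M ^ δ ≤ n ^ δ` because `M ≤ n`. -/
theorem tensor_rank_le {a rk d n M : ℕ} {τ δ σ : ℝ} (ha : 2 ≤ a) (hd : 2 ≤ d) (hn : 1 ≤ n) (hM : 1 ≤ M)
    (hτ : 0 ≤ τ) (hδ : 0 ≤ δ) (hσ : τ + 2 * δ = σ) (hrk : (rk : ℝ) ≤ (a : ℝ) ^ (τ + δ))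
    (hd' : ((2 * d - 1 : ℕ) : ℝ) ≤ (d : ℝ) ^ (1 + δ)) (hMn : M ≤ n) :
    (((2 * d - 1) ^ Nat.clog d (M + 1) * rk ^ Nat.clog a n : ℕ) : ℝ) ≤
      ((d : ℝ) ^ (1 + δ) * (2 : ℝ) ^ (1 + δ) * (a : ℝ) ^ (τ + δ)) * (M * (n : ℝ) ^ σ) := by
  have h₁ := pow_clog_le_rpow (x := n) ha hn (by linarith) hrk
  have h₂ := pow_clog_le_rpow (x := M + 1) hd (by omega) (by linarith) hd'
  have hn₀ : (0 : ℝ) < n := by exact_mod_cast hn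
  have hM₀ : (0 : ℝ) < M := by exact_mod_cast hM
  have h₃ : ((M + 1 : ℕ) : ℝ) ^ (1 + δ) ≤ (2 : ℝ) ^ (1 + δ) * (M * (n : ℝ) ^ δ) := by
    have h₄ : ((M + 1 : ℕ) : ℝ) ≤ 2 * M := by exact_mod_cast (by omega : M + 1 ≤ 2 * M)
    calc ((M + 1 : ℕ) : ℝ) ^ (1 + δ) ≤ (2 * (M : ℝ)) ^ (1 + δ) :=
          Real.rpow_le_rpow (Nat.cast_nonneg _) h₄ (by linarith)
      _ = (2 : ℝ) ^ (1 + δ) * (M * (M : ℝ) ^ δ) := by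
          rw [Real.mul_rpow (by norm_num) hM₀.le, Real.rpow_add hM₀, Real.rpow_one]
      _ ≤ _ := by
          have : (M : ℝ) ^ δ ≤ (n : ℝ) ^ δ := Real.rpow_le_rpow hM₀.le (by exact_mod_cast hMn) hδ
          gcongr
  rw [Nat.cast_mul]
  calc _ ≤ ((d : ℝ) ^ (1 + δ) * ((2 : ℝ) ^ (1 + δ) * (M * (n : ℝ) ^ δ))) *
        ((a : ℝ) ^ (τ + δ) * (n : ℝ) ^ (τ + δ)) := by
        refine mul_le_mul (h₂.trans ?_) h₁ (Nat.cast_nonneg _) (by positivity)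
        exact mul_le_mul_of_nonneg_left h₃ (by positivity)
    _ = _ := by
        rw [show σ = δ + (τ + δ) by linarith, Real.rpow_add hn₀ δ (τ + δ)]
        ring

theorem clog_le_log_add_one {a n : ℕ} (ha : 2 ≤ a) (x : ℕ) (hx : x ≤ 2 ^ n) : Nat.clog a x ≤ n :=
  (Nat.clog_anti_left (by norm_num) ha).trans (Nat.clog_le_of_le_pow hx)

theorem pow_le_two_pow {R k L : ℕ} (h : k ≤ L) : R ^ k ≤ (2 ^ L) ^ R := by
  rcases Nat.eq_zero_or_pos R with rfl | hR
  · rcases k with _ | k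
    · simp
    · simp
  · calc R ^ k ≤ R ^ L := Nat.pow_le_pow_right hR h
      _ ≤ (2 ^ R) ^ L := Nat.pow_le_pow_left Nat.lt_two_pow_self.le _
      _ = (2 ^ L) ^ R := by rw [← pow_mul, ← pow_mul, mul_comm]

/-- All numbers that occur are polynomial in `n` and `M`: with `k, l ≤ L`, powers of constants to
`k` or `l` are bounded by fixed powers of `2 ^ L`. -/
theorem word_bounds {n M k l L rk e D : ℕ} (hL : 1 ≤ L) (hn : n < 2 ^ L) (hM : M < 2 ^ L) (hk : k ≤ L)
    (hl : l ≤ L) :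
    n * n * n + M * (n * n) + 4 * (n * M) + 20 ≤ (2 ^ L) ^ (8 + e + rk + D) ∧
      (k + l + 2) * (e ^ l * rk ^ k + 1) ≤ (2 ^ L) ^ (8 + e + rk + D) ∧
      (n + 1) * D ^ l ≤ (2 ^ L) ^ (8 + e + rk + D) := by
  have h₁ : e ^ l ≤ (2 ^ L) ^ e := pow_le_two_pow hl
  have h₂ : rk ^ k ≤ (2 ^ L) ^ rk := pow_le_two_pow hk
  have h₃ : D ^ l ≤ (2 ^ L) ^ D := pow_le_two_pow hl
  have h₄ : L < 2 ^ L := Nat.lt_two_pow_self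
  have h₅ : 2 ≤ 2 ^ L := Nat.le_self_pow (by omega) 2
  generalize 2 ^ L = x at *
  have hx : ∀ {i j : ℕ}, i ≤ j → x ^ i ≤ x ^ j := fun h => Nat.pow_le_pow_right (by omega) h
  have hS : e ^ l * rk ^ k ≤ x ^ (e + rk) := by
    rw [pow_add]; exact Nat.mul_le_mul h₁ h₂
  have hS' : 1 ≤ x ^ (e + rk) := Nat.pow_pos (by omega)
  refine ⟨?_, ?_, ?_⟩
  · have q₁ : n * n * n ≤ x ^ 3 := by
      rw [pow_succ, pow_two]; exact Nat.mul_le_mul (Nat.mul_le_mul hn.le hn.le) hn.le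
    have q₂ : M * (n * n) ≤ x ^ 3 := by
      rw [pow_succ', pow_two]; exact Nat.mul_le_mul hM.le (Nat.mul_le_mul hn.le hn.le)
    have q₃ : n * M ≤ x ^ 2 := by
      rw [pow_two]; exact Nat.mul_le_mul hn.le hM.le
    have q₄ : 2 * x ^ 3 + 4 * x ^ 2 + 20 ≤ x ^ 8 := by
      have r₁ : 2 * x ^ 7 ≤ x ^ 8 := by rw [pow_succ' x 7]; exact Nat.mul_le_mul_right _ h₅
      have r₂ : 2 * x ^ 6 ≤ x ^ 7 := by rw [pow_succ' x 6]; exact Nat.mul_le_mul_right _ h₅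
      have r₃ : 2 * x ^ 5 ≤ x ^ 6 := by rw [pow_succ' x 5]; exact Nat.mul_le_mul_right _ h₅
      have r₄ : 2 * x ^ 4 ≤ x ^ 5 := by rw [pow_succ' x 4]; exact Nat.mul_le_mul_right _ h₅
      have r₅ : 2 * x ^ 3 ≤ x ^ 4 := by rw [pow_succ' x 3]; exact Nat.mul_le_mul_right _ h₅
      have r₆ : 2 * x ^ 2 ≤ x ^ 3 := by rw [pow_succ' x 2]; exact Nat.mul_le_mul_right _ h₅
      have r₇ : 2 * 2 ≤ x ^ 2 := by rw [pow_two]; exact Nat.mul_le_mul h₅ h₅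
      omega
    exact le_trans (by omega) (hx (show 8 ≤ 8 + e + rk + D by omega))
  · have q : k + l + 2 ≤ x * x := by nlinarith
    calc (k + l + 2) * (e ^ l * rk ^ k + 1) ≤ (x * x) * (x * x ^ (e + rk)) :=
          Nat.mul_le_mul q (by nlinarith)
      _ = x ^ (3 + (e + rk)) := by rw [pow_add]; ring
      _ ≤ _ := hx (by omega)
  · calc (n + 1) * D ^ l ≤ x * x ^ D := Nat.mul_le_mul hn h₃
      _ = x ^ (D + 1) := by rw [pow_succ']
      _ ≤ _ := hx (by omega)

theorem cycleInput_bounded {n : ℕ} {G : SimpleGraph (Fin n)} {wt : Sym2 (Fin n) → ℕ} {M K : ℕ}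
    (hwt : ∀ e ∈ G.edgeSet, 1 ≤ wt e ∧ wt e ≤ M) (hn : n ≤ K) (hM : M ≤ K) :
    (cycleInput G wt M).Bounded K := by
  refine ⟨fun x => ?_, fun a i => ?_⟩
  · simp only [cycleInput]
    split_ifs <;> omega
  · simp only [cycleInput]
    split_ifs with h₁ h₂ h₃
    · exact (hwt _ (G.mem_edgeSet.2 h₃)).2.trans hM
    all_goals omega

theorem mainTheorem3 (ε : ℝ) (hε : 0 < ε) :
    ∃ (P : WordProg) (c C k : ℕ),
      ∀ (n M : ℕ), 1 ≤ n → 1 ≤ M →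
      ∀ (G : SimpleGraph (Fin n)) (wt : Sym2 (Fin n) → ℕ),
        (∀ e ∈ G.edgeSet, 1 ≤ wt e ∧ wt e ≤ M) →
      ∀ b : ℕ, c * (Nat.log 2 (n * M) + 1) ≤ b →
        ∃ (s : WordState) (t : ℕ),
          WordRuns b P (cycleInput G wt M) s t ∧
          IsCorrectOutput G wt (cycleOutput s) ∧
          (t : ℝ) ≤ C * (M : ℝ) * (n : ℝ) ^ (matMulExponent + ε) *
            ((Nat.log 2 (n * M) : ℝ) + 1) ^ k := by
  obtain ⟨σ, hσ⟩ : ∃ σ, σ = matMulExponent + ε := ⟨_, rfl⟩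
  obtain ⟨τ, hτσ, hτ, hslp⟩ := exists_exponent_lt (σ := σ) (by linarith)
  -- Half of the gap is left to each of the two losses in `tensor_rank_le`.
  obtain ⟨δ, hδ⟩ : ∃ δ, δ = (σ - τ) / 2 := ⟨_, rfl⟩
  have hδ₀ : 0 < δ := by linarith
  obtain ⟨a, rk, ha, hark, hrk, U, V, W, hS⟩ := exists_scheme_rank_le hδ₀ hslp
  obtain ⟨d, hd, hd'⟩ := exists_degree hδ₀
  obtain ⟨D, hD, U', V', W', hS'⟩ := exists_polyMul_isScheme d
  obtain ⟨c, hc⟩ := minCycleProg_spec ha hark hd hD hS hS'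
  obtain ⟨P, hP⟩ : ∃ P, P = minCycleProg a rk U V W d D U' V' W' := ⟨_, rfl⟩
  rw [← hP] at hc
  obtain ⟨C', hC'⟩ : ∃ C', C' = (d : ℝ) ^ (1 + δ) * (2 : ℝ) ^ (1 + δ) * (a : ℝ) ^ (τ + δ) := ⟨_, rfl⟩
  obtain ⟨E, hE⟩ : ∃ E, E = 8 + (2 * d - 1) + rk + D := ⟨_, rfl⟩
  -- With `K = 2 ^ (L * E)`, words need strictly more than `L * E * P.size` bits, whence the `+ 1`.
  -- The one logarithmic factor comes from the `k + l + 1` passes of the transforms. The `6` is `2 *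
  -- 3`, from `S + 1 ≤ 2 * (⌈C'⌉₊ * X)` and `k + l + 1 ≤ 3 * L`.
  refine ⟨P, E * P.size + 1, c * (1 + 6 * ⌈C'⌉₊), 1, fun n M hn hM G wt hwt b hb => ?_⟩
  obtain ⟨L, hL⟩ : ∃ L, L = Nat.log 2 (n * M) + 1 := ⟨_, rfl⟩
  have hL' : ((Nat.log 2 (n * M) : ℝ) + 1) = L := by rw [hL]; push_cast; rfl
  rw [← hL] at hb
  rw [hL', pow_one, ← hσ]
  have hL₁ : 1 ≤ L := by omega
  have hnM : n * M < 2 ^ L := hL ▸ Nat.lt_pow_succ_log_self (by norm_num) _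
  have hn' : n < 2 ^ L := (Nat.le_mul_of_pos_right n hM).trans_lt hnM
  have hM' : M < 2 ^ L := (Nat.le_mul_of_pos_left M hn).trans_lt hnM
  have hk : Nat.clog a n ≤ L := clog_le_log_add_one ha n hn'.le
  have hl : Nat.clog d (M + 1) ≤ L := clog_le_log_add_one hd (M + 1) hM'
  obtain ⟨b₁, b₂, b₃⟩ := word_bounds (e := 2 * d - 1) (rk := rk) (D := D) hL₁ hn' hM' hk hl
  rw [← hE] at b₁ b₂ b₃
  have h2K : 2 ≤ (2 ^ L) ^ E := le_trans (by omega) b₁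
  obtain ⟨s, t, hrun, ht, hout⟩ := hc (K := (2 ^ L) ^ E) G wt rfl rfl rfl hn hM hwt b₁ fun _ => ⟨b₂, b₃⟩
  refine ⟨s, t, (hrun.wordRuns h2K (cycleInput_bounded hwt ?_ ?_) ?_).1, hout, ?_⟩
  · nlinarith [Nat.le_mul_self n]
  · nlinarith [Nat.le_mul_of_pos_left M hn]
  · rw [← pow_mul, ← pow_mul]
    refine Nat.pow_lt_pow_right (by norm_num) (lt_of_lt_of_le ?_ hb)
    nlinarith
  · have hn₁ : (1 : ℝ) ≤ n := by exact_mod_cast hn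
    have hM₁ : (1 : ℝ) ≤ M := by exact_mod_cast hM
    have hL₂ : (1 : ℝ) ≤ L := by exact_mod_cast hL₁
    have hX : (M : ℝ) * (n * n) ≤ M * (n : ℝ) ^ σ := by
      refine mul_le_mul_of_nonneg_left ?_ (by linarith)
      rw [← pow_two, ← Real.rpow_natCast]
      exact Real.rpow_le_rpow_of_exponent_le hn₁ (by push_cast; linarith)
    have hrk₀ : 0 < rk := lt_of_lt_of_le (by positivity) hark
    have hS₁ : 1 ≤ (2 * d - 1) ^ Nat.clog d (M + 1) * rk ^ Nat.clog a n :=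
      Nat.mul_pos (Nat.pow_pos (by omega)) (Nat.pow_pos hrk₀)
    have hS₂ := fun h : M < n => tensor_rank_le (σ := σ) ha hd hn hM (by linarith) hδ₀.le (by linarith) hrk hd' h.le
    rw [← hC'] at hS₂
    clear b₁ b₂ b₃ hrun hout hc
    generalize (2 * d - 1) ^ Nat.clog d (M + 1) * rk ^ Nat.clog a n = S at *
    generalize Nat.clog a n = k at *
    generalize Nat.clog d (M + 1) = l at *
    obtain ⟨X, hXe⟩ : ∃ X, X = (M : ℝ) * (n : ℝ) ^ σ := ⟨_, rfl⟩
    rw [← hXe] at hS₂ hX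
    have hX₀ : 0 ≤ X := by rw [hXe]; positivity
    have hF : ((if M < n then (S + 1) * (k + l + 1) else 0 : ℕ) : ℝ) ≤ 6 * ⌈C'⌉₊ * X * L := by
      split_ifs with hMn
      · have h₁ := hS₂ hMn
        have h₂ : (1 : ℝ) ≤ S := by exact_mod_cast hS₁
        have h₃ : ((k + l + 1 : ℕ) : ℝ) ≤ ((3 * L : ℕ) : ℝ) := Nat.cast_le.2 (by omega)
        have h₄ : C' * X ≤ ⌈C'⌉₊ * X := mul_le_mul_of_nonneg_right (Nat.le_ceil C') hX₀
        calc (((S + 1) * (k + l + 1) : ℕ) : ℝ) = ((S : ℝ) + 1) * ((k + l + 1 : ℕ) : ℝ) := by push_cast; ring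
          _ ≤ (2 * (⌈C'⌉₊ * X)) * ((3 * L : ℕ) : ℝ) :=
            mul_le_mul (by linarith) h₃ (Nat.cast_nonneg _) (by positivity)
          _ = _ := by push_cast; ring
      · rw [Nat.cast_zero]
        positivity
    calc (t : ℝ) ≤ c * (M * (n * n) + ((if M < n then (S + 1) * (k + l + 1) else 0 : ℕ) : ℝ)) := by
          have := (Nat.cast_le (α := ℝ)).2 ht
          rwa [Nat.cast_mul, Nat.cast_add, Nat.cast_mul, Nat.cast_mul] at this
      _ ≤ c * (X * L + 6 * ⌈C'⌉₊ * X * L) := by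
          refine mul_le_mul_of_nonneg_left (add_le_add ?_ hF) (Nat.cast_nonneg c)
          exact hX.trans (le_mul_of_one_le_right hX₀ hL₂)
      _ = _ := by rw [hXe]; push_cast; ring
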